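/- Let $\Phi$ be a commutative unital ring with $\frac16\in\Phi$. All modules, Lie algebras and Jordan pairs are over $\Phi$. **Conventions.** A Jordan pair is a pair of modules $V=(V^+,V^-)$ with quadratic maps $Q^\sigma:V^\sigma\to \mathrm{Hom}(V^{-\sigma},V^\sigma)$ ($\sigma=\pm$) and linearizations $\{x,y,z\}=D_{x,y}z=(Q_{x+z}-Q_x-Q_z)y$, such that $D_{x,y}Q_x=Q_xD_{y,x}$, $D_{Q_xy,y}=D_{x,Q_yx}$ and $Q_{Q_xy}=Q_xQ_yQ_x$ hold in all scalar extensions. It is *strongly nondegenerate* if $Q_x=0$ implies $x=0$, and *semiprime* if an ideal $I$ with $Q_{I^\pm}I^\mp=0$ is zero. For an ideal $I$ of $V$, $\mathrm{Ann}_V(I)^\sigma$ is the set of all $z\in V^\sigma$ with $\{z,I^{-\sigma},V^\sigma\}=\{z,V^{-\sigma},I^\sigma\}=\{V^{-\sigma},z,I^{-\sigma}\}=0$. Its Tits–Kantor–Koecher algebra is $\mathrm{TKK}(V)=V^+\oplus \mathrm{IDer}(V)\oplus V^-$, where $\mathrm{IDer}(V)$ is spanned by the $\delta(x,y)=(D_{x,y},-D_{y,x})$,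 with components in degrees $1,0,-1$ and product $$[x^+\oplus\gamma\oplus x^-,\;y^+\oplus\mu\oplus y^-]=(\gamma_+y^+-\mu_+x^+)\oplus([\gamma,\mu]+\delta(x^+,y^-)-\delta(y^+,x^-))\oplus(\gamma_-y^--\mu_-x^-).$$ A Jordan pair $W$ containing a semiprime Jordan pair $V$ as a subpair is a *pair of $\mathfrak M$-quotients* of $V$ if for each $\sigma=\pm$ and each $0\ne q\in W^\sigma$ there is an ideal $I$ of $V$ with $\mathrm{Ann}_V(I)=0$, $\{q,I^{-\sigma},V^\sigma\}+\{q,V^{-\sigma},I^\sigma\}\subseteq V^\sigma$ and $\{I^{-\sigma},q,V^{-\sigma}\}\subseteq V^{-\sigma}$, these two sets not being both zero. The *maximal Jordan pair of $\mathfrak M$-quotients* $Q_m(V)$ is a pair of $\mathfrak M$-quotients of $V$ into which every pair of $\mathfrak M$-quotients of $V$ embeds by a unique homomorphism that is the identity on $V$. A Lie algebra $L$ is *strongly nondegenerate* if $(\mathrm{ad}\,x)^2=0$ implies $x=0$, and *semiprime* if $[I,I]\ne0$ for each nonzero ideal $I$ (strongly nondegenerate Lie algebras, and the algebras $\mathrm{TKK}(V)$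 of strongly nondegenerate Jordan pairs $V$, are semiprime). For $L$ semiprime, $Q_m(L)=\varinjlim \mathrm{Der}(I,L)$ over the essential ideals $I$ of $L$, with $[\delta_I,\mu_J]=(\delta\mu-\mu\delta)_{(I\cap J)^2}$ and with $L\to Q_m(L)$, $x\mapsto \mathrm{ad}\,x$. If $L=L_{-1}\oplus L_0\oplus L_1$ is $3$-graded, $Q_m(L)_i$ is the set of classes of derivations $\delta:I\to L$ of degree $i$ defined on graded essential ideals $I$. A $3$-graded Lie algebra is *Jordan $3$-graded* if $[L_1,L_{-1}]=L_0$ and there is a Jordan pair structure on $(L_1,L_{-1})$ with $\{x,y,z\}=[[x,y],z]$; this is then the associated Jordan pair. **Theorem.** (i) Let $V$ be a strongly nondegenerate Jordan pair. Then $Q_m(\mathrm{TKK}(V))$ is $3$-graded by the submodules $Q_m(\mathrm{TKK}(V))_i$, the pair $\big(Q_m(\mathrm{TKK}(V))_1,\,Q_m(\mathrm{TKK}(V))_{-1}\big)$ has a Jordan pair structure with $\{x,y,z\}=[[x,y],z]$, the map $\mathrm{TKK}(V)\to Q_m(\mathrm{TKK}(V))$ restricts to a homomorphism from $V$ to this pair,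 and with this homomorphism it is the maximal Jordan pair of $\mathfrak M$-quotients of $V$: $$Q_m(V)=\big(Q_m(\mathrm{TKK}(V))_1,\;Q_m(\mathrm{TKK}(V))_{-1}\big).$$ (ii) Let $L=L_{-1}\oplus L_0\oplus L_1$ be a strongly nondegenerate Jordan $3$-graded Lie algebra with associated Jordan pair $V=(L_1,L_{-1})$, and suppose that $Q_m(L)$, with the components $Q_m(L)_i$, is Jordan $3$-graded. Then there are isomorphisms of graded Lie algebras $$Q_m(L)\;\cong\; Q_m(\mathrm{TKK}(V))\;\cong\;\mathrm{TKK}(Q_m(V)).$$ -/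

import Mathlib

open scoped TensorProduct

universe u v w v₁ v₂ w₁ w₂ a₁ a₂

noncomputable section

/-! ### Jordan pairs -/

namespace QuadraticMap

variable {R : Type*} [CommRing R] {M N : Type*} [AddCommGroup M] [Module R M]
  [AddCommGroup N] [Module R N]

/-- The trilinear product `{x, y, z} = D_{x,y} z = Q_{x,z} y = (Q_{x+z} - Q_x - Q_z) y`
attached to a quadratic map `Q : M → Hom(N, M)`. -/
def triple (q : QuadraticMap R M (N →ₗ[R] M)) : M →ₗ[R] N →ₗ[R] M →ₗ[R] M :=
  LinearMap.lflip.toLinearMap ∘ₗ q.polarBilin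

theorem triple_apply (q : QuadraticMap R M (N →ₗ[R] M)) (x : M) (y : N) (z : M) :
    q.triple x y z = q (x + z) y - q x y - q z y := rfl

/-- The extension of a quadratic map `Q : M → Hom_R(N, M)` to a commutative `R`-algebra `K`, a
`K`-quadratic map `K ⊗ M → Hom_K(K ⊗ N, K ⊗ M)`; it is the only one with
`Q (a ⊗ x) (b ⊗ y) = a ^ 2 * b ⊗ Q x y`. -/
def scalarExt [Invertible (2 : R)] (K : Type*) [CommRing K] [Algebra R K]
    (q : QuadraticMap R M (N →ₗ[R] M)) :
    QuadraticMap K (K ⊗[R] M) (K ⊗[R] N →ₗ[K] K ⊗[R] M) :=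
  (LinearMap.tensorProduct R K N M).compQuadraticMap
    (QuadraticMap.tmul (R := R) (A := K) (QuadraticMap.sq (R := K)) q)

theorem scalarExt_tmul [Invertible (2 : R)] (K : Type*) [CommRing K] [Algebra R K]
    (q : QuadraticMap R M (N →ₗ[R] M)) (a b : K) (x : M) (y : N) :
    q.scalarExt K (a ⊗ₜ x) (b ⊗ₜ y) = (a * a * b) ⊗ₜ[R] q x y := by
  simp [scalarExt, LinearMap.tensorProduct, QuadraticMap.tensorDistrib_tmul,
    TensorProduct.smul_tmul', QuadraticMap.sq]

end QuadraticMap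

/-- The Jordan pair identities for `q = Q^σ`, `q' = Q^{-σ}` over a fixed ring of scalars. -/
structure JordanPairIdentities {R M N : Type*} [CommRing R] [AddCommGroup M] [Module R M]
    [AddCommGroup N] [Module R N] (q : QuadraticMap R M (N →ₗ[R] M))
    (q' : QuadraticMap R N (M →ₗ[R] N)) : Prop where
  /-- `D_{x,y} Q_x = Q_x D_{y,x}` -/
  D_comp_Q : ∀ (x : M) (y : N), q.triple x y ∘ₗ q x = q x ∘ₗ q'.triple y x
  /-- `D_{Q_x y, y} = D_{x, Q_y x}` -/
  D_Q_left : ∀ (x : M) (y : N), q.triple (q x y) y = q.triple x (q' y x)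
  /-- `Q_{Q_x y} = Q_x Q_y Q_x` -/
  Q_Q : ∀ (x : M) (y : N), q (q x y) = q x ∘ₗ q' y ∘ₗ q x

/-- A Jordan pair structure over `Φ` (containing `1/2`) on the pair of modules `(V⁺, V⁻)`. -/
structure JordanPair (Φ : Type u) [CommRing Φ] [Invertible (2 : Φ)] (Vp : Type v₁) (Vm : Type v₂)
    [AddCommGroup Vp] [Module Φ Vp] [AddCommGroup Vm] [Module Φ Vm] where
  /-- `Q⁺ : V⁺ → Hom(V⁻, V⁺)` -/
  Qp : QuadraticMap Φ Vp (Vm →ₗ[Φ] Vp)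
  /-- `Q⁻ : V⁻ → Hom(V⁺, V⁻)` -/
  Qm : QuadraticMap Φ Vm (Vp →ₗ[Φ] Vm)
  identities_plus : ∀ (K : Type u) [CommRing K] [Algebra Φ K],
    JordanPairIdentities (Qp.scalarExt K) (Qm.scalarExt K)
  identities_minus : ∀ (K : Type u) [CommRing K] [Algebra Φ K],
    JordanPairIdentities (Qm.scalarExt K) (Qp.scalarExt K)

theorem JordanPair.tmul_inj {Φ : Type*} [CommRing Φ] {M : Type*} [AddCommGroup M] [Module Φ M]
    {x y : M} (h : (1 : Φ) ⊗ₜ[Φ] x = (1 : Φ) ⊗ₜ[Φ] y) : x = y := by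
  simpa using congrArg (TensorProduct.lid Φ M) h

namespace JordanPair

variable {Φ : Type u} [CommRing Φ] [Invertible (2 : Φ)]
  {Vp : Type v₁} {Vm : Type v₂} [AddCommGroup Vp] [Module Φ Vp] [AddCommGroup Vm] [Module Φ Vm]
  {Wp : Type w₁} {Wm : Type w₂} [AddCommGroup Wp] [Module Φ Wp] [AddCommGroup Wm] [Module Φ Wm]

/-- The opposite Jordan pair `(V⁻, V⁺)`; it is used to exchange the roles of `+` and `-`. -/
def op (V : JordanPair Φ Vp Vm) : JordanPair Φ Vm Vp where
  Qp := V.Qm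
  Qm := V.Qp
  identities_plus := V.identities_minus
  identities_minus := V.identities_plus

/-- `D⁺_{x,y} z = {x, y, z}` for `x, z ∈ V⁺`, `y ∈ V⁻`. -/
def Dp (V : JordanPair Φ Vp Vm) : Vp →ₗ[Φ] Vm →ₗ[Φ] Vp →ₗ[Φ] Vp := V.Qp.triple

/-- `D⁻_{y,x} z = {y, x, z}` for `y, z ∈ V⁻`, `x ∈ V⁺`. -/
def Dm (V : JordanPair Φ Vp Vm) : Vm →ₗ[Φ] Vp →ₗ[Φ] Vm →ₗ[Φ] Vm := V.Qm.triple

theorem Dp_symm (V : JordanPair Φ Vp Vm) (x : Vp) (y : Vm) (z : Vp) :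
    V.Dp x y z = V.Dp z y x := by
  simp only [Dp, QuadraticMap.triple_apply, add_comm z x]; abel

theorem Dm_symm (V : JordanPair Φ Vp Vm) (x : Vm) (y : Vp) (z : Vm) :
    V.Dm x y z = V.Dm z y x := V.op.Dp_symm x y z

/-! The identities over `Φ` itself, and the derivation property of `D_{x,y}`. -/

theorem ext_triple {M N : Type*} [AddCommGroup M] [Module Φ M] [AddCommGroup N] [Module Φ N]
    (q : QuadraticMap Φ M (N →ₗ[Φ] M)) (x : M) (y : N) (z : M) :
    (q.scalarExt Φ).triple (1 ⊗ₜ x) (1 ⊗ₜ y) (1 ⊗ₜ z) = (1 : Φ) ⊗ₜ[Φ] q.triple x y z := by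
  simp only [QuadraticMap.triple_apply, ← TensorProduct.tmul_add, QuadraticMap.scalarExt_tmul,
    mul_one, TensorProduct.tmul_sub]

theorem Dp_Qp (V : JordanPair Φ Vp Vm) (x : Vp) (y z : Vm) :
    V.Dp x y (V.Qp x z) = V.Qp x (V.Dm y x z) := by
  have h := LinearMap.congr_fun ((V.identities_plus Φ).D_comp_Q (1 ⊗ₜ x) (1 ⊗ₜ y)) (1 ⊗ₜ z)
  simp only [LinearMap.comp_apply, QuadraticMap.scalarExt_tmul, mul_one, ext_triple] at h
  exact tmul_inj h

theorem Dp_Qp_left (V : JordanPair Φ Vp Vm) (x : Vp) (y : Vm) (z : Vp) :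
    V.Dp (V.Qp x y) y z = V.Dp x (V.Qm y x) z := by
  have h := LinearMap.congr_fun ((V.identities_plus Φ).D_Q_left (1 ⊗ₜ x) (1 ⊗ₜ y)) (1 ⊗ₜ z)
  simp only [QuadraticMap.scalarExt_tmul, mul_one, ext_triple] at h
  exact tmul_inj h

theorem Qp_add (V : JordanPair Φ Vp Vm) (x z : Vp) (y : Vm) :
    V.Qp (x + z) y = V.Qp x y + V.Qp z y + V.Dp x y z := by
  simp only [Dp, QuadraticMap.triple_apply]; abel

theorem Qm_add (V : JordanPair Φ Vp Vm) (x z : Vm) (y : Vp) :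
    V.Qm (x + z) y = V.Qm x y + V.Qm z y + V.Dm x y z := V.op.Qp_add x z y

theorem Qp_neg (V : JordanPair Φ Vp Vm) (x : Vp) (y : Vm) :
    V.Qp (-x) y = V.Qp x y := by rw [QuadraticMap.map_neg]

theorem Dp_self (V : JordanPair Φ Vp Vm) (x : Vp) (y : Vm) :
    V.Dp x y x = (2 : Φ) • V.Qp x y := by
  simp only [Dp, QuadraticMap.triple_apply, ← two_smul Φ x, QuadraticMap.map_smul,
    LinearMap.smul_apply]
  module

theorem two_cancel {M : Type*} [AddCommGroup M] [Module Φ M] {x : M}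
    (h : (2 : Φ) • x = 0) : x = 0 := by
  have := congrArg ((⅟(2 : Φ)) • ·) h
  simpa [smul_smul] using this

theorem lin_one (V : JordanPair Φ Vp Vm) (x u : Vp) (y z : Vm) :
    V.Dp u y (V.Qp x z) + V.Dp x y (V.Dp x z u) =
      V.Dp x (V.Dm y x z) u + V.Qp x (V.Dm y u z) := by
  have h1 := V.Dp_Qp (x + u) y z
  have h2 := V.Dp_Qp (x + -u) y z
  have h3 := V.Dp_Qp x y z
  have h4 := V.Dp_Qp u y z
  simp only [Qp_add, Qp_neg, map_add, LinearMap.add_apply, map_neg, LinearMap.neg_apply,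
    h3, h4] at h1 h2
  rw [← sub_eq_zero]
  apply two_cancel (Φ := Φ)
  have h5 := congrArg₂ (· - ·) h1 h2
  rw [← sub_eq_zero] at h5 
  rw [← h5]
  module

theorem lin_two (V : JordanPair Φ Vp Vm) (x : Vp) (y v : Vm) (z : Vp) :
    V.Dp (V.Qp x y) v z + V.Dp (V.Qp x v) y z = V.Dp x (V.Dm y x v) z := by
  have h1 := V.Dp_Qp_left x (y + v) z
  simp only [Qm_add, map_add, LinearMap.add_apply, V.Dp_Qp_left x y z, V.Dp_Qp_left x v z] at h1
  rw [← sub_eq_zero] at h1 ⊢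
  rw [← h1]
  abel

theorem lin_three (V : JordanPair Φ Vp Vm) (x u : Vp) (y z : Vm) :
    V.Dp x y (V.Dp x z u) = V.Dp (V.Qp x y) z u + V.Qp x (V.Dm y u z) := by
  have h1 := V.lin_one x u y z
  have h2 := V.lin_two x y z u
  rw [← h2, V.Dp_symm u y] at h1
  rw [← sub_eq_zero] at h1 ⊢
  rw [← h1]
  abel

theorem lin_four (V : JordanPair Φ Vp Vm) (x w u : Vp) (y z : Vm) :
    V.Dp x y (V.Dp w z u) + V.Dp w y (V.Dp x z u) =
      V.Dp (V.Dp x y w) z u + V.Dp x (V.Dm y u z) w := by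
  have h1 := V.lin_three (x + w) u y z
  simp only [Qp_add, map_add, LinearMap.add_apply, V.lin_three x u y z, V.lin_three w u y z] at h1
  rw [← sub_eq_zero] at h1 ⊢
  rw [← h1]
  abel

/-- `D⁺_{x,y}` acts as a derivation:
`{x, y, {w, z, u}} = {{x, y, w}, z, u} - {w, {y, x, z}, u} + {w, z, {x, y, u}}`. -/
theorem Dp_Dp (V : JordanPair Φ Vp Vm) (x w u : Vp) (y z : Vm) :
    V.Dp x y (V.Dp w z u) =
      V.Dp (V.Dp x y w) z u - V.Dp w (V.Dm y x z) u + V.Dp w z (V.Dp x y u) := by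
  have h := V.lin_four u w x z y
  rw [V.Dp_symm w y x, V.Dp_symm (V.Dp u z w) y x, V.Dp_symm u z (V.Dp x y w),
    V.Dp_symm u y x, V.Dp_symm u z w, V.Dm_symm z x y, V.Dp_symm u _ w] at h
  rw [← sub_eq_zero] at h ⊢
  rw [← neg_eq_zero, ← h]
  abel

theorem Dm_Dm (V : JordanPair Φ Vp Vm) (x w u : Vm) (y z : Vp) :
    V.Dm x y (V.Dm w z u) =
      V.Dm (V.Dm x y w) z u - V.Dm w (V.Dp y x z) u + V.Dm w z (V.Dm x y u) :=
  V.op.Dp_Dp x w u y z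

/-! ### Inner derivations and the Tits-Kantor-Koecher algebra -/

/-- The inner derivation `δ(x, y) = (D_{x,y}, -D_{y,x})`. -/
def innerDer (V : JordanPair Φ Vp Vm) (x : Vp) (y : Vm) :
    Module.End Φ Vp × Module.End Φ Vm :=
  (V.Dp x y, -V.Dm y x)

/-- `IDer V`, the `Φ`-module spanned by all inner derivations of `V`. -/
def IDer (V : JordanPair Φ Vp Vm) : Submodule Φ (Module.End Φ Vp × Module.End Φ Vm) :=
  Submodule.span Φ {d | ∃ x y, V.innerDer x y = d}

theorem innerDer_mem (V : JordanPair Φ Vp Vm) (x : Vp) (y : Vm) : V.innerDer x y ∈ V.IDer :=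
  Submodule.subset_span ⟨x, y, rfl⟩

/-- `δ(x, y)` as an element of `IDer V`. -/
def inner (V : JordanPair Φ Vp Vm) (x : Vp) (y : Vm) : V.IDer :=
  ⟨V.innerDer x y, V.innerDer_mem x y⟩

/-- Derivations of a Jordan pair. -/
structure IsDerivation (V : JordanPair Φ Vp Vm) (d : Module.End Φ Vp × Module.End Φ Vm) :
    Prop where
  plus : ∀ x y z, d.1 (V.Dp x y z) = V.Dp (d.1 x) y z + V.Dp x (d.2 y) z + V.Dp x y (d.1 z)
  minus : ∀ x y z, d.2 (V.Dm x y z) = V.Dm (d.2 x) y z + V.Dm x (d.1 y) z + V.Dm x y (d.2 z)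

theorem isDerivation_of_mem (V : JordanPair Φ Vp Vm) {d : Module.End Φ Vp × Module.End Φ Vm}
    (hd : d ∈ V.IDer) : V.IsDerivation d := by
  induction hd using Submodule.span_induction with
  | mem d h =>
    obtain ⟨x, y, rfl⟩ := h
    constructor <;> intro a b c
    · simp only [innerDer, V.Dp_Dp x a c y b, LinearMap.neg_apply, map_neg]
      abel
    · simp only [innerDer, V.Dm_Dm y a c x b, LinearMap.neg_apply, map_neg]
      abel
  | zero => constructor <;> simp
  | add d e _ _ hd he =>
    constructor <;> intro a b c
    · simp only [Prod.fst_add, Prod.snd_add, LinearMap.add_apply, map_add, hd.plus, he.plus]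
      abel
    · simp only [Prod.fst_add, Prod.snd_add, LinearMap.add_apply, map_add, hd.minus, he.minus]
      abel
  | smul r d _ hd =>
    constructor <;> intro a b c
    · simp only [Prod.smul_fst, Prod.smul_snd, LinearMap.smul_apply, map_smul, hd.plus, smul_add]
    · simp only [Prod.smul_fst, Prod.smul_snd, LinearMap.smul_apply, map_smul, hd.minus, smul_add]

theorem commutator_innerDer (V : JordanPair Φ Vp Vm) {d : Module.End Φ Vp × Module.End Φ Vm}
    (hd : V.IsDerivation d) (x : Vp) (y : Vm) :
    d * V.innerDer x y - V.innerDer x y * d = V.innerDer (d.1 x) y + V.innerDer x (d.2 y) := by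
  refine Prod.ext (LinearMap.ext fun z => ?_) (LinearMap.ext fun z => ?_)
  · simp only [innerDer, Prod.fst_sub, Prod.fst_mul, Prod.fst_add, LinearMap.sub_apply,
      Module.End.mul_apply, LinearMap.add_apply, hd.plus]
    abel
  · simp only [innerDer, Prod.snd_sub, Prod.snd_mul, Prod.snd_add, LinearMap.sub_apply,
      Module.End.mul_apply, LinearMap.add_apply, LinearMap.neg_apply, map_neg, hd.minus]
    abel

theorem commutator_mem (V : JordanPair Φ Vp Vm) {d e : Module.End Φ Vp × Module.End Φ Vm}
    (hd : d ∈ V.IDer) (he : e ∈ V.IDer) : d * e - e * d ∈ V.IDer := by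
  have hd' := V.isDerivation_of_mem hd
  induction he using Submodule.span_induction with
  | mem e h =>
    obtain ⟨x, y, rfl⟩ := h
    rw [V.commutator_innerDer hd']
    exact add_mem (V.innerDer_mem _ _) (V.innerDer_mem _ _)
  | zero => simp
  | add e f _ _ he hf =>
    have : d * (e + f) - (e + f) * d = (d * e - e * d) + (d * f - f * d) := by
      noncomm_ring
    rw [this]
    exact add_mem he hf
  | smul r e _ he =>
    have : d * (r • e) - (r • e) * d = r • (d * e - e * d) := by
      rw [mul_smul_comm, smul_mul_assoc, smul_sub]
    rw [this]
    exact Submodule.smul_mem _ _ he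

/-- The underlying module `V⁺ ⊕ IDer V ⊕ V⁻` of the Tits-Kantor-Koecher algebra. -/
@[ext]
structure TKK (V : JordanPair Φ Vp Vm) : Type (max v₁ v₂) where
  plus : Vp
  der : V.IDer
  minus : Vm

namespace TKK

variable (V : JordanPair Φ Vp Vm)

/-- `TKK(V)` as a product. -/
def equivProd : V.TKK ≃ Vp × V.IDer × Vm where
  toFun a := (a.plus, a.der, a.minus)
  invFun a := ⟨a.1, a.2.1, a.2.2⟩
  left_inv _ := rfl
  right_inv _ := rfl

instance : AddCommGroup V.TKK := (equivProd V).addCommGroup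

instance : Module Φ V.TKK := (equivProd V).module Φ

/-- `[x⁺ ⊕ γ ⊕ x⁻, y⁺ ⊕ μ ⊕ y⁻] =
(γ₊ y⁺ - μ₊ x⁺) ⊕ ([γ, μ] + δ(x⁺, y⁻) - δ(y⁺, x⁻)) ⊕ (γ₋ y⁻ - μ₋ x⁻)`. -/
instance : Bracket V.TKK V.TKK where
  bracket a b :=
    ⟨a.der.1.1 b.plus - b.der.1.1 a.plus,
      ⟨a.der.1 * b.der.1 - b.der.1 * a.der.1, V.commutator_mem a.der.2 b.der.2⟩
        + V.inner a.plus b.minus - V.inner b.plus a.minus,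
      a.der.1.2 b.minus - b.der.1.2 a.minus⟩

variable {V}

theorem ext' {a b : V.TKK} (h1 : a.plus = b.plus) (h2 : a.der.1 = b.der.1)
    (h3 : a.minus = b.minus) :
    a = b :=
  TKK.ext h1 (Subtype.ext h2) h3

theorem add_fst (a b : V.TKK) : (a + b).plus = a.plus + b.plus := rfl
theorem add_mid (a b : V.TKK) : (a + b).der.1 = a.der.1 + b.der.1 := rfl
theorem add_lst (a b : V.TKK) : (a + b).minus = a.minus + b.minus := rfl
theorem smul_fst (r : Φ) (a : V.TKK) : (r • a).plus = r • a.plus := rfl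
theorem smul_mid (r : Φ) (a : V.TKK) : (r • a).der.1 = r • a.der.1 := rfl
theorem smul_lst (r : Φ) (a : V.TKK) : (r • a).minus = r • a.minus := rfl
theorem zero_fst : (0 : V.TKK).plus = 0 := rfl
theorem zero_mid : (0 : V.TKK).der.1 = 0 := rfl
theorem zero_lst : (0 : V.TKK).minus = 0 := rfl
theorem lie_fst (a b : V.TKK) : ⁅a, b⁆.plus = a.der.1.1 b.plus - b.der.1.1 a.plus := rfl
theorem lie_mid (a b : V.TKK) : ⁅a, b⁆.der.1 =
    (a.der.1 * b.der.1 - b.der.1 * a.der.1) + V.innerDer a.plus b.minus -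
      V.innerDer b.plus a.minus := rfl
theorem lie_lst (a b : V.TKK) : ⁅a, b⁆.minus = a.der.1.2 b.minus - b.der.1.2 a.minus := rfl

theorem innerDer_add_left (x x' : Vp) (y : Vm) :
    V.innerDer (x + x') y = V.innerDer x y + V.innerDer x' y := by
  simp only [innerDer, map_add, LinearMap.add_apply, neg_add, Prod.mk_add_mk]

theorem innerDer_add_right (x : Vp) (y y' : Vm) :
    V.innerDer x (y + y') = V.innerDer x y + V.innerDer x y' := by
  simp only [innerDer, map_add, LinearMap.add_apply, neg_add, Prod.mk_add_mk]

theorem innerDer_sub_left (x x' : Vp) (y : Vm) :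
    V.innerDer (x - x') y = V.innerDer x y - V.innerDer x' y := by
  simp only [innerDer, map_sub, LinearMap.sub_apply, neg_sub', Prod.mk_sub_mk]

theorem innerDer_sub_right (x : Vp) (y y' : Vm) :
    V.innerDer x (y - y') = V.innerDer x y - V.innerDer x y' := by
  simp only [innerDer, map_sub, LinearMap.sub_apply, neg_sub', Prod.mk_sub_mk]

theorem innerDer_smul_left (r : Φ) (x : Vp) (y : Vm) :
    V.innerDer (r • x) y = r • V.innerDer x y := by
  simp only [innerDer, map_smul, LinearMap.smul_apply, ← smul_neg, Prod.smul_mk]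

theorem innerDer_smul_right (r : Φ) (x : Vp) (y : Vm) :
    V.innerDer x (r • y) = r • V.innerDer x y := by
  simp only [innerDer, map_smul, LinearMap.smul_apply, ← smul_neg, Prod.smul_mk]

theorem innerDer_fst (x : Vp) (y : Vm) (z : Vp) : (V.innerDer x y).1 z = V.Dp x y z := rfl

theorem innerDer_snd (x : Vp) (y : Vm) (z : Vm) : (V.innerDer x y).2 z = -V.Dm y x z := rfl

instance : LieRing V.TKK where
  add_lie a b c := by
    refine ext' ?_ ?_ ?_
    · simp only [lie_fst, add_fst, add_mid, Prod.fst_add, LinearMap.add_apply, map_add]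
      abel
    · simp only [lie_mid, add_fst, add_mid, add_lst, innerDer_add_left, innerDer_add_right,
        add_mul, mul_add]
      abel
    · simp only [lie_lst, add_lst, add_mid, Prod.snd_add, LinearMap.add_apply, map_add]
      abel
  lie_add a b c := by
    refine ext' ?_ ?_ ?_
    · simp only [lie_fst, add_fst, add_mid, Prod.fst_add, LinearMap.add_apply, map_add]
      abel
    · simp only [lie_mid, add_fst, add_mid, add_lst, innerDer_add_left, innerDer_add_right,
        add_mul, mul_add]
      abel
    · simp only [lie_lst, add_lst, add_mid, Prod.snd_add, LinearMap.add_apply, map_add]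
      abel
  lie_self a := by
    refine ext' ?_ ?_ ?_
    · simp only [lie_fst, sub_self, zero_fst]
    · simp only [lie_mid, sub_self, zero_add, zero_mid]
    · simp only [lie_lst, sub_self, zero_lst]
  leibniz_lie a b c := by
    have ha := V.isDerivation_of_mem a.der.2
    have hb := V.isDerivation_of_mem b.der.2
    have hc := V.isDerivation_of_mem c.der.2
    refine ext' ?_ ?_ ?_
    · simp only [add_fst, lie_fst, lie_mid, Prod.fst_add, Prod.fst_sub, Prod.fst_mul,
        LinearMap.add_apply, LinearMap.sub_apply, Module.End.mul_apply, map_sub, innerDer_fst,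
        V.Dp_symm c.plus, V.Dp_symm b.plus _ a.plus]
      abel
    · have h1 := V.commutator_innerDer ha b.plus c.minus
      have h2 := V.commutator_innerDer ha c.plus b.minus
      have h3 := V.commutator_innerDer hb a.plus c.minus
      have h4 := V.commutator_innerDer hb c.plus a.minus
      have h5 := V.commutator_innerDer hc a.plus b.minus
      have h6 := V.commutator_innerDer hc b.plus a.minus
      simp only [add_mid, lie_fst, lie_mid, lie_lst, innerDer_sub_left, innerDer_sub_right]
      rw [sub_eq_iff_eq_add] at h1 h2 h3 h4 h5 h6
      simp only [mul_add, mul_sub, add_mul, sub_mul, h1, h2, h3, h4, h5, h6, mul_assoc]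
      abel
    · simp only [add_lst, lie_lst, lie_mid, Prod.snd_add, Prod.snd_sub, Prod.snd_mul,
        LinearMap.add_apply, LinearMap.sub_apply, Module.End.mul_apply, map_sub, innerDer_snd,
        V.Dm_symm c.minus, V.Dm_symm b.minus _ a.minus]
      abel

instance : LieAlgebra Φ V.TKK where
  lie_smul r a b := by
    refine ext' ?_ ?_ ?_
    · simp only [lie_fst, smul_fst, smul_mid, Prod.smul_fst, LinearMap.smul_apply, map_smul,
        smul_sub]
    · simp only [lie_mid, smul_fst, smul_mid, smul_lst, innerDer_smul_left, innerDer_smul_right,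
        mul_smul_comm, smul_mul_assoc, smul_sub, smul_add]
    · simp only [lie_lst, smul_lst, smul_mid, Prod.smul_snd, LinearMap.smul_apply, map_smul,
        smul_sub]

variable (V)

/-- The degree `i` component of the `3`-grading
`TKK(V)_1 = V⁺`, `TKK(V)_0 = IDer V`, `TKK(V)_{-1} = V⁻` (all other components are zero). -/
def grading (i : ℤ) : Submodule Φ V.TKK where
  carrier := {a | (i ≠ 1 → a.plus = 0) ∧ (i ≠ 0 → a.der = 0) ∧ (i ≠ -1 → a.minus = 0)}
  zero_mem' := ⟨fun _ => rfl, fun _ => rfl, fun _ => rfl⟩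
  add_mem' := by
    rintro a b ⟨h1, h2, h3⟩ ⟨k1, k2, k3⟩
    refine ⟨fun h => ?_, fun h => ?_, fun h => ?_⟩
    · rw [add_fst, h1 h, k1 h, add_zero]
    · exact (congrArg₂ (· + ·) (h2 h) (k2 h)).trans (add_zero _)
    · rw [add_lst, h3 h, k3 h, add_zero]
  smul_mem' := by
    rintro r a ⟨h1, h2, h3⟩
    refine ⟨fun h => ?_, fun h => ?_, fun h => ?_⟩
    · rw [smul_fst, h1 h, smul_zero]
    · exact (congrArg (r • ·) (h2 h)).trans (smul_zero _)
    · rw [smul_lst, h3 h, smul_zero]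

/-- The inclusion of `V⁺` into `TKK(V)`. -/
def ofPlus (x : Vp) : V.TKK := ⟨x, 0, 0⟩

/-- The inclusion of `V⁻` into `TKK(V)`. -/
def ofMinus (y : Vm) : V.TKK := ⟨0, 0, y⟩

end TKK


/-! ### Ideals, annihilators and regularity conditions -/

/-- A Jordan pair is strongly nondegenerate if it has no nonzero absolute zero divisors. -/
structure StronglyNondegenerate (V : JordanPair Φ Vp Vm) : Prop where
  plus : ∀ x : Vp, V.Qp x = 0 → x = 0
  minus : ∀ y : Vm, V.Qm y = 0 → y = 0

/-- Ideals `I = (I⁺, I⁻)` of a Jordan pair. -/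
structure PairIdeal (V : JordanPair Φ Vp Vm) where
  plus : Submodule Φ Vp
  minus : Submodule Φ Vm
  Qp_left : ∀ x ∈ plus, ∀ y : Vm, V.Qp x y ∈ plus
  Qp_right : ∀ x : Vp, ∀ y ∈ minus, V.Qp x y ∈ plus
  Dp_mem : ∀ (x : Vp) (y : Vm), ∀ z ∈ plus, V.Dp x y z ∈ plus
  Qm_left : ∀ y ∈ minus, ∀ x : Vp, V.Qm y x ∈ minus
  Qm_right : ∀ y : Vm, ∀ x ∈ plus, V.Qm y x ∈ minus
  Dm_mem : ∀ (y : Vm) (x : Vp), ∀ z ∈ minus, V.Dm y x z ∈ minus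

/-- A Jordan pair is semiprime if an ideal `I` with `Q_{I^±} I^∓ = 0` is zero. -/
def IsSemiprime (V : JordanPair Φ Vp Vm) : Prop :=
  ∀ I : V.PairIdeal, (∀ x ∈ I.plus, ∀ y ∈ I.minus, V.Qp x y = 0) →
    (∀ y ∈ I.minus, ∀ x ∈ I.plus, V.Qm y x = 0) → I.plus = ⊥ ∧ I.minus = ⊥

/-- `Ann_V(X)⁺`, the set of all `z ∈ V⁺` with
`{z, X⁻, V⁺} = {z, V⁻, X⁺} = {V⁻, z, X⁻} = 0`, for a pair of subsets `X = (X⁺, X⁻)`. -/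
def annPlus (V : JordanPair Φ Vp Vm) (Xp : Set Vp) (Xm : Set Vm) : Set Vp :=
  {z | (∀ y ∈ Xm, ∀ v : Vp, V.Dp z y v = 0) ∧ (∀ y : Vm, ∀ x ∈ Xp, V.Dp z y x = 0) ∧
    (∀ w : Vm, ∀ y ∈ Xm, V.Dm w z y = 0)}

/-- `Ann_V(X)⁻`, the set of all `z ∈ V⁻` with
`{z, X⁺, V⁻} = {z, V⁺, X⁻} = {V⁺, z, X⁺} = 0`. -/
def annMinus (V : JordanPair Φ Vp Vm) (Xp : Set Vp) (Xm : Set Vm) : Set Vm := V.op.annPlus Xm Xp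

/-- `Ann_V(I) = 0`. -/
def PairIdeal.AnnEqZero {V : JordanPair Φ Vp Vm} (I : V.PairIdeal) : Prop :=
  V.annPlus I.plus I.minus = {0} ∧ V.annMinus I.plus I.minus = {0}

/-! ### Homomorphisms and pairs of quotients -/

/-- Homomorphisms of Jordan pairs. -/
structure Hom (V : JordanPair Φ Vp Vm) (W : JordanPair Φ Wp Wm) where
  plus : Vp →ₗ[Φ] Wp
  minus : Vm →ₗ[Φ] Wm
  map_Qp : ∀ x y, plus (V.Qp x y) = W.Qp (plus x) (minus y)
  map_Qm : ∀ y x, minus (V.Qm y x) = W.Qm (minus y) (plus x)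

variable {V : JordanPair Φ Vp Vm} {W : JordanPair Φ Wp Wm}

/-- Injectivity (in both components) of a homomorphism. -/
def Hom.Injective (f : V.Hom W) : Prop :=
  Function.Injective f.plus ∧ Function.Injective f.minus

/-- The same homomorphism, between the opposite pairs. -/
def Hom.op (f : V.Hom W) : V.op.Hom W.op := ⟨f.minus, f.plus, f.map_Qm, f.map_Qp⟩

/-- `V` being embedded in `W` by `ι`, every `0 ≠ q ∈ W⁺` is absorbed by an ideal `I` of `V` with
zero annihilator: `{q, I⁻, V⁺} + {q, V⁻, I⁺} ⊆ V⁺` and `{I⁻, q, V⁻} ⊆ V⁻`, where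
`{q, I⁻, V⁺} + {q, V⁻, I⁺} ≠ 0` or `{I⁻, q, V⁻} ≠ 0`. -/
def Hom.AbsorbsPlus (ι : V.Hom W) : Prop :=
  ∀ q : Wp, q ≠ 0 → ∃ I : V.PairIdeal, I.AnnEqZero ∧
    (∀ y ∈ I.minus, ∀ v : Vp, W.Dp q (ι.minus y) (ι.plus v) ∈ LinearMap.range ι.plus) ∧
    (∀ w : Vm, ∀ x ∈ I.plus, W.Dp q (ι.minus w) (ι.plus x) ∈ LinearMap.range ι.plus) ∧
    (∀ y ∈ I.minus, ∀ w : Vm, W.Dm (ι.minus y) q (ι.minus w) ∈ LinearMap.range ι.minus) ∧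
    ((∃ y ∈ I.minus, ∃ v : Vp, W.Dp q (ι.minus y) (ι.plus v) ≠ 0) ∨
      (∃ w : Vm, ∃ x ∈ I.plus, W.Dp q (ι.minus w) (ι.plus x) ≠ 0) ∨
      (∃ y ∈ I.minus, ∃ w : Vm, W.Dm (ι.minus y) q (ι.minus w) ≠ 0))

/-- `W` is a pair of `𝔐`-quotients of its semiprime subpair `V`, embedded by `ι : V → W`. -/
structure Hom.IsMQuotient (ι : V.Hom W) : Prop where
  semiprime : V.IsSemiprime
  injective : ι.Injective
  absorbs_plus : ι.AbsorbsPlus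
  absorbs_minus : ι.op.AbsorbsPlus

/-- `W` (with `ι : V → W`) is the maximal Jordan pair of `𝔐`-quotients of `V`: it is a pair of
`𝔐`-quotients of `V`, and every pair of `𝔐`-quotients of `V` embeds into `W` by a unique
homomorphism that is the identity on `V`. The test pairs live in the universes `b₁, b₂`. -/
def Hom.IsMaximalMQuotient.{b₁, b₂, b₃, b₄, b₅, b₆, b₇} {Φ : Type b₃} [CommRing Φ]
    [Invertible (2 : Φ)] {Vp : Type b₄} {Vm : Type b₅} {Wp : Type b₆} {Wm : Type b₇}
    [AddCommGroup Vp] [Module Φ Vp] [AddCommGroup Vm] [Module Φ Vm]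
    [AddCommGroup Wp] [Module Φ Wp] [AddCommGroup Wm] [Module Φ Wm]
    {V : JordanPair Φ Vp Vm} {W : JordanPair Φ Wp Wm} (ι : V.Hom W) : Prop :=
  ι.IsMQuotient ∧
  ∀ (Up : Type b₁) (Um : Type b₂) [AddCommGroup Up] [Module Φ Up] [AddCommGroup Um] [Module Φ Um]
    (U : JordanPair Φ Up Um) (j : V.Hom U), j.IsMQuotient →
    ∃ f : U.Hom W, f.Injective ∧
      ((∀ x, f.plus (j.plus x) = ι.plus x) ∧ (∀ y, f.minus (j.minus y) = ι.minus y)) ∧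
      ∀ g : U.Hom W, (∀ x, g.plus (j.plus x) = ι.plus x) →
        (∀ y, g.minus (j.minus y) = ι.minus y) → g = f

end JordanPair

/-! ### Lie algebras of quotients -/

/-- A Lie algebra is semiprime if `[I, I] ≠ 0` for every nonzero ideal `I`. -/
def LieSemiprime (Φ : Type u) (L : Type v) [CommRing Φ] [LieRing L] [LieAlgebra Φ L] : Prop :=
  ∀ I : LieIdeal Φ L, I ≠ ⊥ → ⁅I, I⁆ ≠ ⊥

/-- A Lie algebra is strongly nondegenerate if it has no nonzero absolute zero divisors, that is,
`(ad x)² = 0` implies `x = 0`. -/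
def LieStronglyNondegenerate (L : Type v) [LieRing L] : Prop :=
  ∀ x : L, (∀ y : L, ⁅x, ⁅x, y⁆⁆ = 0) → x = 0

theorem LieStronglyNondegenerate.semiprime {Φ : Type u} {L : Type v} [CommRing Φ] [LieRing L]
    [LieAlgebra Φ L] (h : LieStronglyNondegenerate L) : LieSemiprime Φ L := by
  intro I hI hII
  refine hI ((LieSubmodule.eq_bot_iff I).2 fun x hx => h x fun y => ?_)
  have : ⁅x, ⁅x, y⁆⁆ ∈ ⁅I, I⁆ := LieSubmodule.lie_mem_lie hx (lie_mem_left Φ L I x y hx)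
  rw [hII] at this
  exact (LieSubmodule.mem_bot _).1 this

/-- The essential ideals of a Lie algebra: those which meet every nonzero ideal nontrivially. -/
def EssentialIdeal (Φ : Type u) (L : Type v) [CommRing Φ] [LieRing L] [LieAlgebra Φ L] : Type v :=
  {I : LieIdeal Φ L // ∀ J : LieIdeal Φ L, J ≠ ⊥ → I ⊓ J ≠ ⊥}

namespace EssentialIdeal

variable {Φ : Type u} {L : Type v} [CommRing Φ] [LieRing L] [LieAlgebra Φ L]

/-- Essential ideals are ordered by reverse inclusion: `I ≤ J` means `J ⊆ I`. -/
instance : Preorder (EssentialIdeal Φ L) where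
  le I J := J.1 ≤ I.1
  le_refl I := le_refl I.1
  le_trans I J K h1 h2 := le_trans (a := K.1) h2 h1

/-- The intersection of two essential ideals. -/
def inf (I J : EssentialIdeal Φ L) : EssentialIdeal Φ L :=
  ⟨I.1 ⊓ J.1, fun K hK => by rw [inf_assoc]; exact I.2 _ (J.2 K hK)⟩

instance : IsDirectedOrder (EssentialIdeal Φ L) where
  directed I J := ⟨I.inf J, (inf_le_left : I.1 ⊓ J.1 ≤ I.1), (inf_le_right : I.1 ⊓ J.1 ≤ J.1)⟩

/-- The whole algebra as an essential ideal. -/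
def top : EssentialIdeal Φ L := ⟨⊤, fun K hK => by rwa [top_inf_eq]⟩

instance : Nonempty (EssentialIdeal Φ L) := ⟨top⟩

/-- In a semiprime Lie algebra, `I² = [I, I]` is an essential ideal if `I` is. -/
def sq (h : LieSemiprime Φ L) (I : EssentialIdeal Φ L) : EssentialIdeal Φ L :=
  ⟨⁅I.1, I.1⁆, fun K hK h0 => h _ (I.2 K hK) (le_bot_iff.1 (le_trans (le_inf
    (LieSubmodule.mono_lie inf_le_left inf_le_left)
    (le_trans (LieSubmodule.mono_lie inf_le_right inf_le_right) (LieSubmodule.lie_le_right K K)))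
    (le_of_eq h0)))⟩

theorem le_sq (h : LieSemiprime Φ L) (I : EssentialIdeal Φ L) : I ≤ I.sq h :=
  LieSubmodule.lie_le_right I.1 I.1

end EssentialIdeal

section PartialDerivations

variable {Φ : Type u} {L : Type v} [CommRing Φ] [LieRing L] [LieAlgebra Φ L]

/-- The module `Der(I, L)` of derivations `δ : I → L`,
`δ [x, y] = [δ x, y] + [x, δ y]` for `x, y ∈ I`. -/
abbrev PDer (I : EssentialIdeal Φ L) : Type v := LieDerivation Φ I.1 L

theorem PDer.map_lie {I : EssentialIdeal Φ L} (d : PDer I) (x y : I.1) :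
    d ⁅x, y⁆ = ⁅d x, (y : L)⁆ + ⁅(x : L), d y⁆ := by
  rw [LieDerivation.apply_lie_eq_sub, ← lie_skew (d x) (y : L)]
  change ⁅(x : L), d y⁆ - ⁅(y : L), d x⁆ = _
  abel

/-- Restriction `Der(I, L) → Der(J, L)` for `J ⊆ I`. -/
def PDer.restrict (I J : EssentialIdeal Φ L) (h : I ≤ J) : PDer I →ₗ[Φ] PDer J where
  toFun d :=
    { toLinearMap := (d : I.1 →ₗ[Φ] L) ∘ₗ Submodule.inclusion h
      leibniz' := fun a b =>
        d.leibniz' (Submodule.inclusion h a) (Submodule.inclusion h b) }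
  map_add' _ _ := rfl
  map_smul' _ _ := rfl

theorem PDer.restrict_apply {I J : EssentialIdeal Φ L} (h : I ≤ J) (d : PDer I) (x : J.1) :
    PDer.restrict I J h d x = d ⟨x, h x.2⟩ := rfl

instance : DirectedSystem (fun I : EssentialIdeal Φ L => PDer I) (PDer.restrict · · ·) where
  map_self _ _ := rfl
  map_map _ _ _ _ _ _ := rfl

theorem PDer.map_mem {I : EssentialIdeal Φ L} (d : PDer I) (x : L) (hx : x ∈ ⁅I.1, I.1⁆)
    (hx' : x ∈ I.1) : d ⟨x, hx'⟩ ∈ I.1 := by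
  have key : ∀ y ∈ Submodule.span Φ {⁅a, b⁆ | (a ∈ I.1) (b ∈ I.1)},
      ∃ hy : y ∈ I.1, d ⟨y, hy⟩ ∈ I.1 := by
    intro y hy
    induction hy using Submodule.span_induction with
    | mem y hy =>
      obtain ⟨a, ha, b, hb, rfl⟩ := hy
      refine ⟨lie_mem_right Φ L I.1 a b hb, ?_⟩
      have h1 := d.map_lie ⟨a, ha⟩ ⟨b, hb⟩
      have h2 : (⟨⁅a, b⁆, lie_mem_right Φ L I.1 a b hb⟩ : I.1) =
        ⁅(⟨a, ha⟩ : I.1), (⟨b, hb⟩ : I.1)⁆ := rfl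
      rw [h2, h1]
      exact add_mem (lie_mem_right Φ L I.1 _ b hb) (lie_mem_left Φ L I.1 a _ ha)
    | zero =>
      refine ⟨zero_mem _, ?_⟩
      have h2 : (⟨0, zero_mem _⟩ : I.1) = 0 := rfl
      rw [h2, map_zero]
      exact zero_mem _
    | add y z _ _ hy hz =>
      obtain ⟨hy, hy'⟩ := hy
      obtain ⟨hz, hz'⟩ := hz
      refine ⟨add_mem hy hz, ?_⟩
      have h2 : (⟨y + z, add_mem hy hz⟩ : I.1) = ⟨y, hy⟩ + ⟨z, hz⟩ := rfl
      rw [h2, map_add]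
      exact add_mem hy' hz'
    | smul r y _ hy =>
      obtain ⟨hy, hy'⟩ := hy
      refine ⟨SMulMemClass.smul_mem r hy, ?_⟩
      have h2 : (⟨r • y, SMulMemClass.smul_mem r hy⟩ : I.1) = r • (⟨y, hy⟩ : I.1) := rfl
      rw [h2, map_smul]
      exact SMulMemClass.smul_mem r hy'
  rw [← LieSubmodule.mem_toSubmodule, LieSubmodule.lieIdeal_oper_eq_linear_span'] at hx
  exact (key x hx).2

/-- The restriction of a derivation `δ : I → L` to a map `I² → I`. -/
def PDer.onSq (h : LieSemiprime Φ L) {I : EssentialIdeal Φ L} (d : PDer I) :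
    (I.sq h).1 →ₗ[Φ] I.1 where
  toFun x := ⟨d ⟨x, I.le_sq h x.2⟩, d.map_mem x x.2 _⟩
  map_add' x y := Subtype.ext (map_add d ⟨x, I.le_sq h x.2⟩ ⟨y, I.le_sq h y.2⟩)
  map_smul' r x := Subtype.ext (map_smul d r ⟨x, I.le_sq h x.2⟩)

theorem PDer.coe_onSq (h : LieSemiprime Φ L) {I : EssentialIdeal Φ L} (d : PDer I)
    (x : (I.sq h).1) : (d.onSq h x : L) = d ⟨x, I.le_sq h x.2⟩ := rfl

theorem PDer.onSq_lie (h : LieSemiprime Φ L) {I : EssentialIdeal Φ L} (d : PDer I)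
    (x y : (I.sq h).1) : d.onSq h ⁅x, y⁆ =
      ⁅d.onSq h x, (⟨y, I.le_sq h y.2⟩ : I.1)⁆ + ⁅(⟨x, I.le_sq h x.2⟩ : I.1), d.onSq h y⁆ :=
  Subtype.ext (d.map_lie ⟨x, I.le_sq h x.2⟩ ⟨y, I.le_sq h y.2⟩)

/-- The commutator `δ μ - μ δ`, defined on `I²`, of two derivations `δ, μ : I → L`. -/
def PDer.comm (h : LieSemiprime Φ L) {I : EssentialIdeal Φ L} (d e : PDer I) : PDer (I.sq h) where
  toLinearMap := (d : I.1 →ₗ[Φ] L) ∘ₗ e.onSq h - (e : I.1 →ₗ[Φ] L) ∘ₗ d.onSq h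
  leibniz' x y := by
    change d (e.onSq h ⁅x, y⁆) - e (d.onSq h ⁅x, y⁆) =
      ⁅(x : L), d (e.onSq h y) - e (d.onSq h y)⁆ - ⁅(y : L), d (e.onSq h x) - e (d.onSq h x)⁆
    rw [e.onSq_lie h, d.onSq_lie h, map_add, map_add, d.map_lie, d.map_lie, e.map_lie, e.map_lie]
    simp only [PDer.coe_onSq, lie_sub]
    rw [← lie_skew (y : L) (d _), ← lie_skew (y : L) (e _)]
    abel

theorem PDer.comm_apply (h : LieSemiprime Φ L) {I : EssentialIdeal Φ L} (d e : PDer I)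
    (x : (I.sq h).1) : PDer.comm h d e x = d (e.onSq h x) - e (d.onSq h x) := rfl

/-- The derivation `ad x : L → L`, `y ↦ [x, y]`. -/
def PDer.ad (x : L) : PDer (EssentialIdeal.top : EssentialIdeal Φ L) where
  toLinearMap := (LieAlgebra.ad Φ L x : L →ₗ[Φ] L) ∘ₗ
    (EssentialIdeal.top (Φ := Φ)).1.toSubmodule.subtype
  leibniz' a b := by
    change ⁅x, ⁅(a : L), (b : L)⁆⁆ = ⁅(a : L), ⁅x, (b : L)⁆⁆ - ⁅(b : L), ⁅x, (a : L)⁆⁆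
    rw [leibniz_lie, ← lie_skew (b : L)]
    abel

end PartialDerivations

/-- The maximal algebra of quotients `Q_m(L)` of a semiprime Lie algebra `L`: the direct limit of
the modules `Der(I, L)`, where `I` runs over the essential ideals of `L`. -/
def MaxQuot {Φ : Type u} {L : Type v} [CommRing Φ] [LieRing L] [LieAlgebra Φ L]
    (_h : LieSemiprime Φ L) : Type v :=
  DirectLimit (fun I : EssentialIdeal Φ L => PDer I) (PDer.restrict · · ·)

namespace MaxQuot

variable {Φ : Type u} {L : Type v} [CommRing Φ] [LieRing L] [LieAlgebra Φ L]
  (h : LieSemiprime Φ L)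

instance : AddCommGroup (MaxQuot h) := inferInstanceAs (AddCommGroup
  (DirectLimit (fun I : EssentialIdeal Φ L => PDer I) (PDer.restrict · · ·)))

instance : Module Φ (MaxQuot h) := inferInstanceAs (Module Φ
  (DirectLimit (fun I : EssentialIdeal Φ L => PDer I) (PDer.restrict · · ·)))

/-- The class `δ_I ∈ Q_m(L)` of a derivation `δ : I → L`. -/
def mk (I : EssentialIdeal Φ L) : PDer I →ₗ[Φ] MaxQuot h :=
  DirectLimit.Module.of Φ _ _ (PDer.restrict · · ·) I

variable {h}

theorem mk_restrict {I J : EssentialIdeal Φ L} (hIJ : I ≤ J) (d : PDer I) :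
    mk h J (PDer.restrict I J hIJ d) = mk h I d :=
  DirectLimit.Module.of_f ..

theorem mk_eq_of_agree {I J K : EssentialIdeal Φ L} {d : PDer I} {e : PDer J} (hI : I ≤ K)
    (hJ : J ≤ K) (hde : ∀ x : K.1, d ⟨x, hI x.2⟩ = e ⟨x, hJ x.2⟩) : mk h I d = mk h J e := by
  rw [← mk_restrict hI, ← mk_restrict hJ]
  exact congrArg _ (LieDerivation.ext fun x => hde x)

theorem mk_ext {I J : EssentialIdeal Φ L} {d : PDer I} {e : PDer J} (hI : I ≤ J)
    (hde : ∀ x : J.1, d ⟨x, hI x.2⟩ = e x) : mk h I d = mk h J e :=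
  mk_eq_of_agree hI (le_refl J) hde

theorem induction₂ {C : MaxQuot h → MaxQuot h → Prop}
    (ih : ∀ I d e, C (mk h I d) (mk h I e)) (x y : MaxQuot h) : C x y :=
  DirectLimit.induction₂ _ ih x y

theorem induction₃ {C : MaxQuot h → MaxQuot h → MaxQuot h → Prop}
    (ih : ∀ I d e f, C (mk h I d) (mk h I e) (mk h I f)) (x y z : MaxQuot h) : C x y z :=
  DirectLimit.induction₃ _ ih x y z

theorem sq_le_sq {I J : EssentialIdeal Φ L} (hIJ : I ≤ J) : I.sq h ≤ J.sq h :=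
  LieSubmodule.mono_lie hIJ hIJ

/-- The product of `Q_m(L)` is given by `[δ_I, μ_I] = (δ μ - μ δ)_{I²}`. -/
instance : Bracket (MaxQuot h) (MaxQuot h) where
  bracket x y := DirectLimit.lift₂ _ _ (fun I d e => mk h (I.sq h) (PDer.comm h d e))
    (fun I J hIJ d e => mk_ext (d := PDer.comm h d e)
      (e := PDer.comm h (PDer.restrict I J hIJ d) (PDer.restrict I J hIJ e)) (sq_le_sq hIJ)
      fun _ => rfl) x y

theorem lie_mk (I : EssentialIdeal Φ L) (d e : PDer I) :
    ⁅mk h I d, mk h I e⁆ = mk h (I.sq h) (PDer.comm h d e) :=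
  DirectLimit.lift₂_def (F₁ := fun I : EssentialIdeal Φ L => PDer I)
    (F₂ := fun I : EssentialIdeal Φ L => PDer I) (PDer.restrict · · ·) (PDer.restrict · · ·)
    (fun I d e => mk h (I.sq h) (PDer.comm h d e)) _ I d e

instance : LieRing (MaxQuot h) where
  add_lie := induction₃ fun I d e f => by
    rw [← map_add, lie_mk, lie_mk, lie_mk, ← map_add]
    refine congrArg _ (LieDerivation.ext fun x => ?_)
    simp only [LieDerivation.add_apply, PDer.comm_apply]
    have : (d + e).onSq h x = d.onSq h x + e.onSq h x := rfl
    rw [this, map_add]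
    abel
  lie_add := induction₃ fun I d e f => by
    rw [← map_add, lie_mk, lie_mk, lie_mk, ← map_add]
    refine congrArg _ (LieDerivation.ext fun x => ?_)
    simp only [LieDerivation.add_apply, PDer.comm_apply]
    have : (e + f).onSq h x = e.onSq h x + f.onSq h x := rfl
    rw [this, map_add]
    abel
  lie_self x := by
    refine induction₂ (C := fun x _ => ⁅x, x⁆ = 0) (fun I d _ => ?_) x x
    rw [lie_mk, ← map_zero (mk h (I.sq h))]
    exact congrArg _ (LieDerivation.ext fun x => sub_self _)
  leibniz_lie := induction₃ fun I d e f => by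
    have hI := I.le_sq h
    rw [lie_mk, lie_mk, lie_mk, ← mk_restrict hI d, ← mk_restrict hI e, ← mk_restrict hI f,
      lie_mk, lie_mk, lie_mk, ← map_add]
    refine congrArg _ (LieDerivation.ext fun x => ?_)
    have key (d e f : PDer I) :
        PDer.comm h (PDer.restrict _ _ hI d) (PDer.comm h e f) x =
          d (e.onSq h ((PDer.restrict _ _ hI f).onSq h x)) -
            d (f.onSq h ((PDer.restrict _ _ hI e).onSq h x)) -
          (e (f.onSq h ((PDer.restrict _ _ hI d).onSq h x)) -
            f (e.onSq h ((PDer.restrict _ _ hI d).onSq h x))) := by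
      rw [← map_sub]
      rfl
    have key' (d e f : PDer I) :
        PDer.comm h (PDer.comm h e f) (PDer.restrict _ _ hI d) x =
          (e (f.onSq h ((PDer.restrict _ _ hI d).onSq h x)) -
            f (e.onSq h ((PDer.restrict _ _ hI d).onSq h x))) -
          (d (e.onSq h ((PDer.restrict _ _ hI f).onSq h x)) -
            d (f.onSq h ((PDer.restrict _ _ hI e).onSq h x))) := by
      rw [← map_sub]
      rfl
    rw [LieDerivation.add_apply, key, key, key']
    abel

instance : LieAlgebra Φ (MaxQuot h) where
  lie_smul r := induction₂ fun I d e => by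
    rw [← map_smul, lie_mk, lie_mk, ← map_smul]
    refine congrArg _ (LieDerivation.ext fun x => ?_)
    simp only [LieDerivation.smul_apply, PDer.comm_apply]
    have : (r • e).onSq h x = r • e.onSq h x := rfl
    rw [this, map_smul, smul_sub]

variable (h)

/-- The canonical map `L → Q_m(L)`, `x ↦ (ad x)_L`. -/
def of (x : L) : MaxQuot h := mk h EssentialIdeal.top (PDer.ad x)

end MaxQuot

/-! ### Gradings -/

section Gradings

variable {Φ : Type u} {L : Type v} [CommRing Φ] [LieRing L] [LieAlgebra Φ L]

/-- `L = L_{-1} ⊕ L_0 ⊕ L_1` is a `3`-graded Lie algebra. -/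
structure IsThreeGrading (𝓛 : ℤ → Submodule Φ L) : Prop where
  isInternal : DirectSum.IsInternal 𝓛
  lie_mem : ∀ i j x y, x ∈ 𝓛 i → y ∈ 𝓛 j → ⁅x, y⁆ ∈ 𝓛 (i + j)
  eq_bot : ∀ i, i ≠ -1 → i ≠ 0 → i ≠ 1 → 𝓛 i = ⊥

/-- The Jordan pair `V = (L_1, L_{-1})` is associated to the `3`-graded Lie algebra `L`:
`{x, y, z} = [[x, y], z]`. -/
structure IsAssociatedPair [Invertible (2 : Φ)] (𝓛 : ℤ → Submodule Φ L)
    (V : JordanPair Φ (𝓛 1) (𝓛 (-1))) : Prop where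
  plus : ∀ (x : 𝓛 1) (y : 𝓛 (-1)) (z : 𝓛 1), (V.Dp x y z : L) = ⁅⁅(x : L), (y : L)⁆, (z : L)⁆
  minus : ∀ (x : 𝓛 (-1)) (y : 𝓛 1) (z : 𝓛 (-1)),
    (V.Dm x y z : L) = ⁅⁅(x : L), (y : L)⁆, (z : L)⁆

/-- Jordan `3`-graded Lie algebras. -/
structure IsJordanThreeGrading [Invertible (2 : Φ)] (𝓛 : ℤ → Submodule Φ L) : Prop
    extends IsThreeGrading 𝓛 where
  lie_eq_zero_part : Submodule.span Φ {z | ∃ x ∈ 𝓛 1, ∃ y ∈ 𝓛 (-1), ⁅x, y⁆ = z} = 𝓛 0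
  exists_pair : ∃ V : JordanPair Φ (𝓛 1) (𝓛 (-1)), IsAssociatedPair 𝓛 V

/-- An ideal `I` is graded if it contains the homogeneous components of each of its elements. -/
def IsGradedIdeal (𝓛 : ℤ → Submodule Φ L) (I : LieIdeal Φ L) : Prop :=
  ∀ y : ℤ →₀ L, (∀ j, y j ∈ 𝓛 j) → (y.sum fun _ a => a) ∈ I → ∀ j, y j ∈ I

/-- A derivation `δ : I → L` has degree `i` if `δ(I_j) ⊆ L_{i + j}` for all `j`. -/
def PDer.HasDegree (𝓛 : ℤ → Submodule Φ L) {I : EssentialIdeal Φ L} (d : PDer I) (i : ℤ) : Prop :=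
  ∀ (j : ℤ) (x : I.1), (x : L) ∈ 𝓛 j → d x ∈ 𝓛 (i + j)

/-- The degree `i` component of `Q_m(L)`, for a graded Lie algebra `L`: the classes `δ_I` of
derivations `δ : I → L` of degree `i` defined on graded essential ideals `I`. -/
def MaxQuot.grading (h : LieSemiprime Φ L) (𝓛 : ℤ → Submodule Φ L) (i : ℤ) :
    Submodule Φ (MaxQuot h) where
  carrier := {q | ∃ (I : EssentialIdeal Φ L) (d : PDer I),
    IsGradedIdeal 𝓛 I.1 ∧ d.HasDegree 𝓛 i ∧ q = MaxQuot.mk h I d}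
  zero_mem' := ⟨EssentialIdeal.top, 0, fun _ _ _ _ => LieSubmodule.mem_top _,
    fun _ _ _ => zero_mem _, (map_zero _).symm⟩
  add_mem' := by
    rintro _ _ ⟨I, d, hI, hd, rfl⟩ ⟨J, e, hJ, he, rfl⟩
    have h1 : I ≤ I.inf J := (inf_le_left : I.1 ⊓ J.1 ≤ I.1)
    have h2 : J ≤ I.inf J := (inf_le_right : I.1 ⊓ J.1 ≤ J.1)
    refine ⟨I.inf J, PDer.restrict _ _ h1 d + PDer.restrict _ _ h2 e, ?_, ?_, ?_⟩
    · intro y hy hs j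
      exact ⟨hI y hy hs.1 j, hJ y hy hs.2 j⟩
    · intro j x hx
      exact add_mem (hd j ⟨x, h1 x.2⟩ hx) (he j ⟨x, h2 x.2⟩ hx)
    · rw [map_add, MaxQuot.mk_restrict, MaxQuot.mk_restrict]
  smul_mem' := by
    rintro r _ ⟨I, d, hI, hd, rfl⟩
    exact ⟨I, r • d, hI, fun j x hx => Submodule.smul_mem _ r (hd j x hx), (map_smul _ _ _).symm⟩

/-- An isomorphism of graded Lie algebras. -/
def IsGradedIso {L' : Type w} [LieRing L'] [LieAlgebra Φ L'] (𝓛 : ℤ → Submodule Φ L)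
    (𝓛' : ℤ → Submodule Φ L') (e : L ≃ₗ⁅Φ⁆ L') : Prop :=
  ∀ (i : ℤ) (x : L), x ∈ 𝓛 i ↔ e x ∈ 𝓛' i

end Gradings

/-! ### Semiprimeness of the algebras involved -/

theorem JordanPair.StronglyNondegenerate.tkk_semiprime {Φ : Type u} [CommRing Φ]
    [Invertible (2 : Φ)] {Vp : Type v₁} {Vm : Type v₂} [AddCommGroup Vp] [Module Φ Vp]
    [AddCommGroup Vm] [Module Φ Vm] {V : JordanPair Φ Vp Vm} (hV : V.StronglyNondegenerate) :
    LieSemiprime Φ V.TKK := by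
  intro I hI hII
  have h0 : ∀ a ∈ I, ∀ y : V.TKK, ⁅a, ⁅a, y⁆⁆ = 0 := fun a ha y => by
    have : ⁅a, ⁅a, y⁆⁆ ∈ ⁅I, I⁆ := LieSubmodule.lie_mem_lie ha (lie_mem_left Φ _ I a y ha)
    rw [hII] at this
    exact (LieSubmodule.mem_bot _).1 this
  have h1 : ∀ a ∈ I, a.plus = 0 := fun a ha => hV.plus _ (LinearMap.ext fun y => by
    have h := congrArg JordanPair.TKK.plus (h0 a ha (JordanPair.TKK.ofMinus V y))
    have h2 : V.innerDer 0 a.minus = 0 := by simp [JordanPair.innerDer]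
    simp only [JordanPair.TKK.lie_fst, JordanPair.TKK.lie_mid, JordanPair.TKK.ofMinus, map_zero,
      JordanPair.TKK.zero_fst, ZeroMemClass.coe_zero, Prod.fst_zero, LinearMap.zero_apply,
      zero_sub, mul_zero, zero_mul, zero_add, h2, sub_zero, JordanPair.TKK.innerDer_fst,
      V.Dp_self, neg_eq_zero] at h
    exact JordanPair.two_cancel h)
  have h2 : ∀ a ∈ I, a.minus = 0 := fun a ha => hV.minus _ (LinearMap.ext fun x => by
    have h := congrArg JordanPair.TKK.minus (h0 a ha (JordanPair.TKK.ofPlus V x))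
    have h2 : V.innerDer a.plus 0 = 0 := by simp [JordanPair.innerDer]
    simp only [JordanPair.TKK.lie_lst, JordanPair.TKK.lie_mid, JordanPair.TKK.ofPlus, map_zero,
      JordanPair.TKK.zero_lst, ZeroMemClass.coe_zero, Prod.snd_zero, LinearMap.zero_apply,
      zero_sub, mul_zero, zero_mul, zero_add, h2, sub_zero, JordanPair.TKK.innerDer_snd,
      Prod.snd_neg, LinearMap.neg_apply, neg_neg, neg_eq_zero] at h
    rw [show V.Dm a.minus x a.minus = (2 : Φ) • V.Qm a.minus x from V.op.Dp_self _ _] at h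
    exact JordanPair.two_cancel h)
  refine hI ((LieSubmodule.eq_bot_iff I).2 fun a ha =>
    JordanPair.TKK.ext' (h1 a ha) ?_ (h2 a ha))
  refine Prod.ext (LinearMap.ext fun x => ?_) (LinearMap.ext fun y => ?_)
  · have h := h1 _ (lie_mem_left Φ _ I a (JordanPair.TKK.ofPlus V x) ha)
    simpa [JordanPair.TKK.lie_fst, JordanPair.TKK.ofPlus, JordanPair.TKK.zero_mid] using h
  · have h := h2 _ (lie_mem_left Φ _ I a (JordanPair.TKK.ofMinus V y) ha)
    simpa [JordanPair.TKK.lie_lst, JordanPair.TKK.ofMinus, JordanPair.TKK.zero_mid] using h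

theorem IsAssociatedPair.stronglyNondegenerate {Φ : Type u} {L : Type v} [CommRing Φ] [LieRing L]
    [LieAlgebra Φ L] [Invertible (2 : Φ)] {𝓛 : ℤ → Submodule Φ L} (h𝓛 : IsThreeGrading 𝓛)
    (hL : LieStronglyNondegenerate L) {V : JordanPair Φ (𝓛 1) (𝓛 (-1))}
    (hV : IsAssociatedPair 𝓛 V) : V.StronglyNondegenerate := by
  have key : ∀ x : L, (∀ i, ∀ y ∈ 𝓛 i, ⁅x, ⁅x, y⁆⁆ = 0) → x = 0 := fun x hx => hL x fun y => by
    have hy : y ∈ ⨆ i, 𝓛 i := by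
      rw [h𝓛.isInternal.submodule_iSup_eq_top]
      exact Submodule.mem_top
    induction hy using Submodule.iSup_induction' with
    | mem i y hy => exact hx i y hy
    | zero => simp
    | add y z _ _ hy hz => rw [lie_add, lie_add, hy, hz, add_zero]
  have zero : ∀ i, i ≠ -1 → i ≠ 0 → i ≠ 1 → ∀ z ∈ 𝓛 i, z = 0 := fun i a b c z hz => by
    rw [h𝓛.eq_bot i a b c] at hz
    exact (Submodule.mem_bot Φ).1 hz
  constructor
  · intro x hx
    refine Subtype.ext (key x fun i y hy => ?_)
    by_cases hi : i = -1
    · subst hi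
      have h := hV.plus x ⟨y, hy⟩ x
      rw [V.Dp_self, hx] at h
      rw [← lie_skew, ← h]
      simp
    · have h1 := h𝓛.lie_mem 1 i x y x.2 hy
      have h2 := h𝓛.lie_mem 1 (1 + i) x _ x.2 h1
      by_cases h3 : i = -2 ∨ i = -3
      · rw [zero i hi (by omega) (by omega) y hy]
        simp
      · exact zero _ (by omega) (by omega) (by omega) _ h2
  · intro x hx
    refine Subtype.ext (key x fun i y hy => ?_)
    by_cases hi : i = 1
    · subst hi
      have h := hV.minus x ⟨y, hy⟩ x
      rw [show V.Dm x ⟨y, hy⟩ x = (2 : Φ) • V.Qm x ⟨y, hy⟩ from V.op.Dp_self _ _, hx] at h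
      rw [← lie_skew, ← h]
      simp
    · have h1 := h𝓛.lie_mem (-1) i x y x.2 hy
      have h2 := h𝓛.lie_mem (-1) (-1 + i) x _ x.2 h1
      by_cases h3 : i = 2 ∨ i = 3
      · rw [zero i (by omega) (by omega) hi y hy]
        simp
      · exact zero _ (by omega) (by omega) (by omega) _ h2

end

noncomputable section

/-! ### Jordan pairs from trilinear products -/

/-! An element q of Q_m(L) is known through its brackets with L: it is determined by [q, x] for x in
any essential ideal (`MaxQuot.ext_lie`). Conversely, any Lie algebra containing L, each of whose
elements maps some essential ideal of L into L, has a canonical homomorphism to Q_m(L)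
(`exists_lift`). Both parts rest on transporting this between V and TKK(V).

Grading. For L = TKK(V) every essential ideal contains a graded essential one, so a derivation
splits into parts of degrees -2, ..., 2. The point is that degree 2 vanishes
(`NondegThreeGraded.degree_two_lie`). For D of degree 2 on an ideal, T(a, b, c) = [[D a, b], c] is a
symmetric trilinear product on the part of degree -1, and each T(a, b, -) is a derivation of it.
This forces T(x, x, T(x, x, c)) = 0; the fundamental formula and strong nondegeneracy then give T(x,
x, x) = 0, polarization gives T = 0, and D = 0 follows. Hence Q_m(TKK(V)) is three-graded. Since 6
is invertible, the derivation property of the triple bracket already yields all Jordan pair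
identities, in every scalar extension (`QuadraticMap.jordanPairIdentities`,
`QuadraticMap.TripleDer.scalarExt`).

Quotients. A graded essential ideal of TKK(V) meets V in an ideal with zero annihilator
(`PairIdeal.ofLieIdeal_annEqZero`), so the components of degree 1 and -1 form a pair of 𝔐-quotients.
An ideal of V with zero annihilator generates an essential ideal of TKK(V)
(`PairIdeal.tkkEssential`). If U is a pair of 𝔐-quotients, a derivation of U vanishing on V is zero,
so TKK(V) embeds in TKK(U). The elements of U⁺ and U⁻ are absorbed by squares of such essential
ideals (`Absorbed.of_degree_one`), and they generate TKK(U). So TKK(U) maps to Q_m(TKK(V)), and U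
maps to the components of degree 1 and -1. Uniqueness comes from `Hom.eq_zero_of_annihilated`.

Part (ii). Strong nondegeneracy makes L_0 act faithfully on L_1 and L_{-1}, and a three-graded
algebra with [L_1, L_{-1}] = L_0 and faithful L_0 is the TKK algebra of its pair
(`IsThreeGrading.exists_tkk_equiv`). This applies to L, whence Q_m(L) ≅ Q_m(TKK(V)). It applies
again to Q_m(TKK(V)), whose pair is Q_m(V) by (i). -/

theorem smul_left_cancel_of_isUnit {R M : Type*} [CommRing R] [AddCommGroup M] [Module R M]
    {r : R} (hr : IsUnit r) {x : M} (h : r • x = 0) : x = 0 := hr.smul_eq_zero.1 h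

theorem isUnit_two_of_six {R : Type*} [CommRing R] (h6 : IsUnit (6 : R)) : IsUnit (2 : R) :=
  isUnit_of_mul_isUnit_left (y := 3) (by norm_num [h6])

theorem isUnit_three_of_six {R : Type*} [CommRing R] (h6 : IsUnit (6 : R)) : IsUnit (3 : R) :=
  isUnit_of_mul_isUnit_left (y := 2) (by norm_num [h6])

namespace QuadraticMap

variable {R M N : Type*} [CommRing R] [AddCommGroup M] [Module R M] [AddCommGroup N] [Module R N]

theorem triple_symm (q : QuadraticMap R M (N →ₗ[R] M)) (x : M) (y : N) (z : M) :
    q.triple x y z = q.triple z y x := by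
  simp only [triple_apply, add_comm z x]; abel

theorem triple_self (q : QuadraticMap R M (N →ₗ[R] M)) (x : M) (y : N) :
    q.triple x y x = (2 : R) • q x y := by
  rw [triple_apply, ← two_smul R x, QuadraticMap.map_smul, LinearMap.smul_apply]
  module

/-- The products `D_{x,y}` of `q` act as derivations. -/
def TripleDer (q : QuadraticMap R M (N →ₗ[R] M)) (q' : QuadraticMap R N (M →ₗ[R] N)) : Prop :=
  ∀ (x : M) (y : N) (u : M) (v : N) (z : M), q.triple x y (q.triple u v z) =
    q.triple (q.triple x y u) v z - q.triple u (q'.triple y x v) z + q.triple u v (q.triple x y z)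

section identities

variable {q : QuadraticMap R M (N →ₗ[R] M)} {q' : QuadraticMap R N (M →ₗ[R] N)}

/-- With A = {x, y, {x, z, x}}, B = {x, z, {x, y, x}} and C = {x, {y, x, z}, x}, the derivation
property gives A = 2B - C and, exchanging y and z, B = 2A - C. Hence 3A = 3C; this is where 1/3 is
needed. -/
theorem triple_triple_self (h6 : IsUnit (6 : R)) (h : TripleDer q q') (x : M) (y z : N) :
    q.triple x y (q.triple x z x) = q.triple x (q'.triple y x z) x := by
  have h1 := h x y x z x
  have h2 := h x z x y x
  rw [triple_symm q (q.triple x y x) z x] at h1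
  rw [triple_symm q (q.triple x z x) y x, triple_symm q' z x y] at h2
  rw [← sub_eq_zero]
  apply smul_left_cancel_of_isUnit (isUnit_three_of_six h6)
  linear_combination (norm := module) (-1 : R) • h1 - (2 : R) • h2

theorem triple_triple_left (h : TripleDer q q') (x : M) (y : N) (z : M) :
    q.triple (q.triple x y x) y z = q.triple x (q'.triple y x y) z := by
  have h1 := h x y x y z
  linear_combination (norm := module) -h1

/-- Expanding {a, z, {x, y, x}} with a = {x, y, x} gives 2{x, {y, x, {z, x, y}}, x} - {x, {z, a, y},
x}. The same value results from expanding {z, x, {y, x, y}} in the other component and applying {x,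
-, x} to it. -/
theorem triple_fundamental (h6 : IsUnit (6 : R)) (h : TripleDer q q') (h' : TripleDer q' q)
    (x : M) (y z : N) : q.triple (q.triple x y x) z (q.triple x y x) =
      q.triple x (q'.triple y (q.triple x z x) y) x := by
  have h1 := h (q.triple x y x) z x y x
  have h2 := triple_triple_self h6 h x z y
  have h3 := triple_triple_self h6 h x y (q'.triple z x y)
  have h4 := h' z x y x y
  have h5 := triple_triple_left h' y x z
  rw [triple_symm q (q.triple x y x) z x, h2,
    triple_symm q (q.triple x (q'.triple z x y) x) y x, h3] at h1
  have h6 := congrArg (fun w => q.triple x w x) h4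
  have h7 := congrArg (fun w => q.triple x w x) h5
  simp only [map_add, map_sub, LinearMap.add_apply, LinearMap.sub_apply] at h6 h7
  rw [triple_symm q' (q'.triple z x y) x y, triple_symm q' z x (q'.triple y x y), h7] at h6
  rw [triple_symm q' z (q.triple x y x) y] at h1
  linear_combination (norm := module) h1 - h6

theorem jordanPairIdentities (h6 : IsUnit (6 : R)) (h : TripleDer q q') (h' : TripleDer q' q) :
    JordanPairIdentities q q' where
  D_comp_Q x y := LinearMap.ext fun z => by
    have h1 := triple_triple_self h6 h x y z
    simp only [triple_self, map_smul, LinearMap.comp_apply] at h1 ⊢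
    exact (isUnit_two_of_six h6).smul_left_cancel.1 h1
  D_Q_left x y := LinearMap.ext fun z => by
    have h1 := triple_triple_left h x y z
    simp only [triple_self, map_smul, LinearMap.smul_apply] at h1 ⊢
    exact (isUnit_two_of_six h6).smul_left_cancel.1 h1
  Q_Q x y := LinearMap.ext fun z => by
    have h1 := triple_fundamental h6 h h' x y z
    simp only [triple_self, map_smul, LinearMap.smul_apply, LinearMap.comp_apply, smul_smul,
      ← mul_assoc] at h1 ⊢
    exact (((isUnit_two_of_six h6).mul (isUnit_two_of_six h6)).mul
      (isUnit_two_of_six h6)).smul_left_cancel.1 h1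

end identities

section scalarExt

variable [Invertible (2 : R)] (K : Type*) [CommRing K] [Algebra R K]

theorem scalarExt_triple_tmul (q : QuadraticMap R M (N →ₗ[R] M)) (a b c : K) (x : M) (y : N)
    (z : M) : (q.scalarExt K).triple (a ⊗ₜ x) (b ⊗ₜ y) (c ⊗ₜ z) =
      (a * b * c) ⊗ₜ[R] q.triple x y z := by
  have h : (q.scalarExt K).triple (1 ⊗ₜ x) (1 ⊗ₜ y) (1 ⊗ₜ z) = 1 ⊗ₜ[R] q.triple x y z := by
    simp only [triple_apply, ← TensorProduct.tmul_add, scalarExt_tmul, mul_one,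
      TensorProduct.tmul_sub]
  have ht (a : K) (x : M) : a ⊗ₜ[R] x = a • ((1 : K) ⊗ₜ[R] x) := by
    rw [TensorProduct.smul_tmul', smul_eq_mul, mul_one]
  have ht' (a : K) (x : N) : a ⊗ₜ[R] x = a • ((1 : K) ⊗ₜ[R] x) := by
    rw [TensorProduct.smul_tmul', smul_eq_mul, mul_one]
  rw [ht a x, ht' b y, ht c z]
  simp only [map_smul, LinearMap.smul_apply, h]
  rw [ht (a * b * c)]
  simp only [smul_smul]
  congr 1
  ring

/-- Unlike the quadratic identities, the derivation property is multilinear, so it passes to scalar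
extensions by checking pure tensors. -/
theorem TripleDer.scalarExt {q : QuadraticMap R M (N →ₗ[R] M)} {q' : QuadraticMap R N (M →ₗ[R] N)}
    (h : TripleDer q q') : TripleDer (q.scalarExt K) (q'.scalarExt K) := by
  intro x y u v z
  induction x using TensorProduct.induction_on with
  | zero => simp
  | add x x' hx hx' => simp only [map_add, LinearMap.add_apply, hx, hx']; abel
  | tmul a x =>
  induction y using TensorProduct.induction_on with
  | zero => simp
  | add x x' hx hx' => simp only [map_add, LinearMap.add_apply, hx, hx']; abel
  | tmul b y =>
  induction u using TensorProduct.induction_on with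
  | zero => simp
  | add x x' hx hx' => simp only [map_add, LinearMap.add_apply, hx, hx']; abel
  | tmul c u =>
  induction v using TensorProduct.induction_on with
  | zero => simp
  | add x x' hx hx' => simp only [map_add, LinearMap.add_apply, hx, hx']; abel
  | tmul d v =>
  induction z using TensorProduct.induction_on with
  | zero => simp
  | add x x' hx hx' => simp only [map_add, hx, hx']; abel
  | tmul e z =>
  simp only [scalarExt_triple_tmul, h x y u v z, TensorProduct.tmul_add, TensorProduct.tmul_sub]
  rw [show c * d * (a * b * e) = a * b * (c * d * e) by ring,
    show c * (b * a * d) * e = a * b * (c * d * e) by ring,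
    show a * b * c * d * e = a * b * (c * d * e) by ring]

end scalarExt

/-- The quadratic map `x ↦ ½ {x, -, x}` of a trilinear product. -/
def ofTriple [Invertible (2 : R)] (T : M →ₗ[R] N →ₗ[R] M →ₗ[R] M) :
    QuadraticMap R M (N →ₗ[R] M) :=
  LinearMap.BilinMap.toQuadraticMap (⅟(2 : R) • (LinearMap.lflip.toLinearMap ∘ₗ T))

theorem ofTriple_apply [Invertible (2 : R)] (T : M →ₗ[R] N →ₗ[R] M →ₗ[R] M) (x : M) (y : N) :
    ofTriple T x y = ⅟(2 : R) • T x y x := rfl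

theorem ofTriple_triple [Invertible (2 : R)] {T : M →ₗ[R] N →ₗ[R] M →ₗ[R] M}
    (hT : ∀ x y z, T x y z = T z y x) (x : M) (y : N) (z : M) :
    (ofTriple T).triple x y z = T x y z := by
  simp only [triple_apply, ofTriple_apply, map_add, LinearMap.add_apply, hT z y x]
  rw [← sub_eq_zero]
  apply smul_left_cancel_of_isUnit (isUnit_of_invertible (2 : R))
  simp only [smul_sub, smul_add, smul_smul, mul_invOf_self, one_smul]
  module

end QuadraticMap

/-- The Jordan pair of two symmetric trilinear products acting as derivations. -/
def JordanPair.ofTriples {Φ : Type u} [CommRing Φ] [Invertible (2 : Φ)] (h6 : IsUnit (6 : Φ))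
    {Vp : Type v₁} {Vm : Type v₂} [AddCommGroup Vp] [Module Φ Vp] [AddCommGroup Vm] [Module Φ Vm]
    (q : QuadraticMap Φ Vp (Vm →ₗ[Φ] Vp)) (q' : QuadraticMap Φ Vm (Vp →ₗ[Φ] Vm))
    (h : q.TripleDer q') (h' : q'.TripleDer q) : JordanPair Φ Vp Vm where
  Qp := q
  Qm := q'
  identities_plus K _ _ := QuadraticMap.jordanPairIdentities
    (by simpa only [map_ofNat] using h6.map (algebraMap Φ K)) (h.scalarExt K) (h'.scalarExt K)
  identities_minus K _ _ := QuadraticMap.jordanPairIdentities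
    (by simpa only [map_ofNat] using h6.map (algebraMap Φ K)) (h'.scalarExt K) (h.scalarExt K)

/-! ### Semiprime Lie algebras and their maximal algebras of quotients -/

namespace EssentialIdeal

variable {Φ : Type u} {L : Type v} [CommRing Φ] [LieRing L] [LieAlgebra Φ L]

/-- The centralizer of an ideal. -/
def centralizer (I : LieIdeal Φ L) : LieIdeal Φ L where
  carrier := {x | ∀ y ∈ I, ⁅x, y⁆ = 0}
  zero_mem' y _ := zero_lie y
  add_mem' {a b} ha hb y hy := by rw [add_lie, ha y hy, hb y hy, add_zero]
  smul_mem' r a ha y hy := by rw [smul_lie, ha y hy, smul_zero]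
  lie_mem {z a} ha y hy := by
    rw [lie_lie, ha y hy, lie_zero, ha _ (lie_mem_right Φ L I z y hy), sub_zero]

/-- The centralizer of I is an ideal, and its intersection with I has zero square. If the
centralizer were nonzero, this intersection would be nonzero by essentiality, against semiprimeness.
-/
theorem eq_zero_of_lie (h : LieSemiprime Φ L) (I : EssentialIdeal Φ L) {x : L}
    (hx : ∀ y ∈ I.1, ⁅x, y⁆ = 0) : x = 0 := by
  by_contra hx0
  have hC : centralizer I.1 ≠ ⊥ := fun hC => hx0 (by
    have : x ∈ centralizer I.1 := hx
    rw [hC] at this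
    exact (LieSubmodule.mem_bot x).1 this)
  refine h _ (I.2 _ hC) (LieSubmodule.lie_eq_bot_iff _ _ |>.2 fun a ha b hb => ?_)
  exact ha.2 b hb.1

end EssentialIdeal

namespace MaxQuot

variable {Φ : Type u} {L : Type v} [CommRing Φ] [LieRing L] [LieAlgebra Φ L]
  {h : LieSemiprime Φ L}

theorem exists_mk (q : MaxQuot h) : ∃ I d, q = mk h I d := DirectLimit.exists_eq_mk _ q

/-- Representatives of one class agree a priori only on a smaller essential ideal K. At any common
point x the difference of the two values centralizes K, by the Leibniz rule on [x, y] with y in K,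
so it is zero. -/
theorem eq_of_mk_eq {I J : EssentialIdeal Φ L} {d : PDer I} {e : PDer J}
    (hde : mk h I d = mk h J e) (x : L) (hI : x ∈ I.1) (hJ : x ∈ J.1) : d ⟨x, hI⟩ = e ⟨x, hJ⟩ := by
  obtain ⟨K, h1, h2, hK⟩ := Quotient.exact hde
  have hy (y : L) (hy : y ∈ K.1) : d ⟨y, h1 hy⟩ = e ⟨y, h2 hy⟩ :=
    LieDerivation.congr_fun hK ⟨y, hy⟩
  rw [← sub_eq_zero]
  refine K.eq_zero_of_lie h fun y hyK => ?_
  have a := d.map_lie ⟨x, hI⟩ ⟨y, h1 hyK⟩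
  have b := e.map_lie ⟨x, hJ⟩ ⟨y, h2 hyK⟩
  have c := hy ⁅x, y⁆ (lie_mem_right Φ L K.1 x y hyK)
  have c' : d ⁅(⟨x, hI⟩ : I.1), (⟨y, h1 hyK⟩ : I.1)⁆ = e ⁅(⟨x, hJ⟩ : J.1), (⟨y, h2 hyK⟩ : J.1)⁆ := c
  rw [a, b, hy y hyK] at c'
  rw [sub_lie, sub_eq_zero]
  exact add_right_cancel c'

variable (h)

/-- The canonical homomorphism `L → Q_m(L)`. -/
def ofHom : L →ₗ⁅Φ⁆ MaxQuot h where
  toFun := of h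
  map_add' x y := by
    rw [of, of, of, ← map_add]
    exact congrArg _ (LieDerivation.ext fun z => add_lie x y (z : L))
  map_smul' r x := by
    rw [of, of, RingHom.id_apply, ← map_smul]
    exact congrArg _ (LieDerivation.ext fun z => smul_lie r x (z : L))
  map_lie' {x y} := by
    change of h ⁅x, y⁆ = ⁅of h x, of h y⁆
    rw [of, of, of, lie_mk]
    refine mk_ext (EssentialIdeal.le_sq h _) fun z => ?_
    exact lie_lie x y (z : L)

variable {h}

theorem ofHom_apply (x : L) : ofHom h x = of h x := rfl

/-- This is [δ, ad x] = ad (δ x). It replaces computations with representatives in the direct limit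
by brackets with elements of L. -/
theorem lie_mk_of (I : EssentialIdeal Φ L) (d : PDer I) (x : I.1) :
    ⁅mk h I d, ofHom h x⁆ = ofHom h (d x) := by
  have h0 : (EssentialIdeal.top : EssentialIdeal Φ L) ≤ I := fun _ _ => LieSubmodule.mem_top _
  rw [ofHom_apply, ofHom_apply, of, of, ← mk_restrict h0, lie_mk]
  symm
  refine mk_ext (h0.trans (I.le_sq h)) fun y => ?_
  change ⁅d x, (y : L)⁆ = d ⁅x, ⟨y, I.le_sq h y.2⟩⁆ - ⁅(x : L), d ⟨y, I.le_sq h y.2⟩⁆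
  rw [d.map_lie, add_sub_cancel_right]

theorem ofHom_injective : Function.Injective (ofHom h) := by
  rw [injective_iff_map_eq_zero]
  intro x hx
  refine EssentialIdeal.top.eq_zero_of_lie h fun y _ => ?_
  rw [ofHom_apply, of, ← map_zero (mk h EssentialIdeal.top)] at hx
  exact eq_of_mk_eq hx y (LieSubmodule.mem_top _) (LieSubmodule.mem_top _)

/-- `I` absorbs `q`. -/
theorem exists_absorbs (q : MaxQuot h) : ∃ I : EssentialIdeal Φ L, ∀ x ∈ I.1,
    ∃ z, ⁅q, ofHom h x⁆ = ofHom h z := by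
  obtain ⟨I, d, rfl⟩ := exists_mk q
  exact ⟨I, fun x hx => ⟨_, lie_mk_of I d ⟨x, hx⟩⟩⟩

/-- The test ideal need not be a domain of definition of q: q can be represented on its intersection
with such a domain. -/
theorem eq_zero_of_lie (I : EssentialIdeal Φ L) {q : MaxQuot h}
    (hq : ∀ x ∈ I.1, ⁅q, ofHom h x⁆ = 0) : q = 0 := by
  obtain ⟨J, d, rfl⟩ := exists_mk q
  rw [← mk_restrict (h := h) (inf_le_right : I.1 ⊓ J.1 ≤ J.1) (J := I.inf J),
    ← map_zero (mk h (I.inf J))]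
  refine congrArg _ (LieDerivation.ext fun x => ofHom_injective (h := h) ?_)
  have h1 := lie_mk_of (h := h) J d ⟨x, x.2.2⟩
  have h2 := hq x x.2.1
  exact h1.symm.trans (h2.trans (map_zero (ofHom h)).symm)

theorem ext_lie (I : EssentialIdeal Φ L) {q r : MaxQuot h}
    (hq : ∀ x ∈ I.1, ⁅q, ofHom h x⁆ = ⁅r, ofHom h x⁆) : q = r := by
  rw [← sub_eq_zero]
  exact eq_zero_of_lie I fun x hx => by rw [sub_lie, hq x hx, sub_self]

end MaxQuot

/-! ### Extensions of a Lie algebra whose elements are absorbed -/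

section Absorption

variable {Φ : Type u} {L : Type v} [CommRing Φ] [LieRing L] [LieAlgebra Φ L]
  {M : Type w} [LieRing M] [LieAlgebra Φ M]

/-- `m` is absorbed by an essential ideal of `L`, mapped to `M` by `f`. -/
def Absorbed (f : L →ₗ⁅Φ⁆ M) (m : M) : Prop :=
  ∃ I : EssentialIdeal Φ L, ∀ x ∈ I.1, ∃ z, ⁅m, f x⁆ = f z

variable {f : L →ₗ⁅Φ⁆ M}

theorem Absorbed.add {m m' : M} (hm : Absorbed f m) (hm' : Absorbed f m') :
    Absorbed f (m + m') := by
  obtain ⟨I, hI⟩ := hm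
  obtain ⟨J, hJ⟩ := hm'
  refine ⟨I.inf J, fun x hx => ?_⟩
  obtain ⟨z, hz⟩ := hI x hx.1
  obtain ⟨z', hz'⟩ := hJ x hx.2
  exact ⟨z + z', by rw [add_lie, hz, hz', map_add]⟩

theorem Absorbed.smul {m : M} (r : Φ) (hm : Absorbed f m) : Absorbed f (r • m) := by
  obtain ⟨I, hI⟩ := hm
  refine ⟨I, fun x hx => ?_⟩
  obtain ⟨z, hz⟩ := hI x hx
  exact ⟨r • z, by rw [smul_lie, hz, map_smul]⟩

/-- The derivation `I → L` given by the action of an element of `M`. -/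
theorem exists_pder (hf : Function.Injective f) {m : M} (I : EssentialIdeal Φ L)
    (hI : ∀ x ∈ I.1, ∃ z, ⁅m, f x⁆ = f z) : ∃ d : PDer I, ∀ x : I.1, f (d x) = ⁅m, f x⁆ := by
  choose g hg using hI
  refine ⟨{ toFun := fun x => g x x.2, map_add' := ?_, map_smul' := ?_, leibniz' := ?_ }, ?_⟩
  · intro x y
    apply hf
    rw [map_add, ← hg, ← hg, ← hg, ← lie_add, ← map_add]
    rfl
  · intro r x
    apply hf
    rw [RingHom.id_apply, map_smul, ← hg, ← hg, ← lie_smul, ← map_smul]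
    rfl
  · intro x y
    apply hf
    change f (g ⁅(x : L), (y : L)⁆ _) = f (⁅(x : L), g y _⁆ - ⁅(y : L), g x _⁆)
    rw [map_sub, LieHom.map_lie, LieHom.map_lie, ← hg, ← hg, ← hg, LieHom.map_lie,
      leibniz_lie m (f x), ← lie_skew (f y)]
    abel
  · intro x
    exact (hg _ _).symm

/-- A derivation I → L maps I² back into I, so two of them can be composed on the square. This is
why (I ∩ J)², rather than I ∩ J, absorbs the bracket. -/
theorem Absorbed.lie (h : LieSemiprime Φ L) (hf : Function.Injective f) {m m' : M}
    (hm : Absorbed f m) (hm' : Absorbed f m') : Absorbed f ⁅m, m'⁆ := by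
  obtain ⟨I, hI⟩ := hm
  obtain ⟨J, hJ⟩ := hm'
  obtain ⟨d, hd⟩ := exists_pder hf (I.inf J) fun x hx => hI x hx.1
  obtain ⟨e, he⟩ := exists_pder hf (I.inf J) fun x hx => hJ x hx.2
  refine ⟨(I.inf J).sq h, fun x hx => ⟨PDer.comm h d e ⟨x, hx⟩, ?_⟩⟩
  rw [PDer.comm_apply, map_sub, hd, he, PDer.coe_onSq, PDer.coe_onSq, hd, he, lie_lie]

variable (h : LieSemiprime Φ L)

/-- If the elements of `M` are absorbed by essential ideals of `L`, then `M` maps to `Q_m(L)`. -/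
theorem exists_lift (hf : Function.Injective f) (hM : ∀ m, Absorbed f m) :
    ∃ φ : M →ₗ⁅Φ⁆ MaxQuot h, ∀ (m : M) (x z : L), ⁅m, f x⁆ = f z →
      ⁅φ m, MaxQuot.ofHom h x⁆ = MaxQuot.ofHom h z := by
  have key : ∀ m : M, ∃ q : MaxQuot h, ∀ x z : L, ⁅m, f x⁆ = f z →
      ⁅q, MaxQuot.ofHom h x⁆ = MaxQuot.ofHom h z := by
    intro m
    obtain ⟨I, hI⟩ := hM m
    obtain ⟨d, hd⟩ := exists_pder hf I hI
    -- The relation is required for every x that m sends into L, not only for x in I. For such x,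
    -- the equality is tested by bracketing with y in I, where [x, y] is again in I.
    refine ⟨MaxQuot.mk h I d, fun x z hxz => MaxQuot.ext_lie I fun y hy => ?_⟩
    have h1 := MaxQuot.lie_mk_of (h := h) I d ⟨y, hy⟩
    have h2 := MaxQuot.lie_mk_of (h := h) I d ⟨⁅x, y⁆, lie_mem_right Φ L I.1 x y hy⟩
    rw [lie_lie, ← LieHom.map_lie, h2, h1, ← LieHom.map_lie, ← LieHom.map_lie, ← map_sub]
    congr 1
    apply hf
    rw [map_sub, hd, LieHom.map_lie, LieHom.map_lie, hd, LieHom.map_lie, ← hxz, lie_lie]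
  choose φ hφ using key
  -- The chosen φ m is pinned down by its action on any one essential ideal, so linearity and
  -- compatibility with brackets can be checked on a convenient ideal.
  have uniqI : ∀ (m : M) (q : MaxQuot h) (I : EssentialIdeal Φ L), (∀ x ∈ I.1, ∃ z, ⁅m, f x⁆ = f z ∧
      ⁅q, MaxQuot.ofHom h x⁆ = MaxQuot.ofHom h z) → φ m = q := by
    intro m q I hq
    refine MaxQuot.ext_lie I fun x hx => ?_
    obtain ⟨z, hz, hz'⟩ := hq x hx
    rw [hφ m x z hz, hz']
  refine ⟨{ toFun := φ, map_add' := ?_, map_smul' := ?_, map_lie' := ?_ }, hφ⟩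
  · intro m m'
    obtain ⟨I, hI⟩ := hM m
    obtain ⟨J, hJ⟩ := hM m'
    refine uniqI _ _ (I.inf J) fun x hx => ?_
    obtain ⟨z, hz⟩ := hI x hx.1
    obtain ⟨z', hz'⟩ := hJ x hx.2
    exact ⟨z + z', by rw [add_lie, hz, hz', map_add],
      by rw [add_lie, hφ _ _ _ hz, hφ _ _ _ hz', map_add]⟩
  · intro r m
    obtain ⟨I, hI⟩ := hM m
    refine uniqI _ _ I fun x hx => ?_
    obtain ⟨z, hz⟩ := hI x hx
    exact ⟨r • z, by rw [smul_lie, hz, map_smul],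
      by rw [RingHom.id_apply, smul_lie, hφ _ _ _ hz, map_smul]⟩
  · intro m m'
    obtain ⟨I, hI⟩ := hM m
    obtain ⟨J, hJ⟩ := hM m'
    obtain ⟨d, hd⟩ := exists_pder hf (I.inf J) fun x hx => hI x hx.1
    obtain ⟨e, he⟩ := exists_pder hf (I.inf J) fun x hx => hJ x hx.2
    refine uniqI _ _ ((I.inf J).sq h) fun x hx => ⟨PDer.comm h d e ⟨x, hx⟩, ?_, ?_⟩
    · rw [PDer.comm_apply, map_sub, hd, he, PDer.coe_onSq, PDer.coe_onSq, hd, he, lie_lie]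
    · rw [lie_lie, hφ m' x _ (he ⟨x, (I.inf J).le_sq h hx⟩).symm,
        hφ m x _ (hd ⟨x, (I.inf J).le_sq h hx⟩).symm, PDer.comm_apply, map_sub]
      congr 1
      · exact hφ _ _ _ (hd (e.onSq h ⟨x, hx⟩)).symm
      · exact hφ _ _ _ (he (d.onSq h ⟨x, hx⟩)).symm

theorem lift_comp {φ : M →ₗ⁅Φ⁆ MaxQuot h} (hφ : ∀ (m : M) (x z : L), ⁅m, f x⁆ = f z →
    ⁅φ m, MaxQuot.ofHom h x⁆ = MaxQuot.ofHom h z) (x : L) : φ (f x) = MaxQuot.ofHom h x :=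
  MaxQuot.ext_lie EssentialIdeal.top fun y _ => by
    rw [hφ (f x) y ⁅x, y⁆ (LieHom.map_lie f x y).symm, LieHom.map_lie]

end Absorption

/-! ### Three-graded Lie algebras -/

section LieRing

variable {L : Type*} [LieRing L]

theorem lie_lie_comm_of_lie_eq_zero {x z : L} (h : ⁅x, z⁆ = 0) (y : L) :
    ⁅⁅x, y⁆, z⁆ = ⁅⁅z, y⁆, x⁆ := by
  rw [lie_lie, h, lie_zero, sub_zero, ← lie_skew x, ← lie_skew z y, neg_lie]

theorem lie_lie_lie_eq (g u v z : L) :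
    ⁅g, ⁅⁅u, v⁆, z⁆⁆ = ⁅⁅⁅g, u⁆, v⁆, z⁆ + ⁅⁅u, ⁅g, v⁆⁆, z⁆ + ⁅⁅u, v⁆, ⁅g, z⁆⁆ := by
  rw [leibniz_lie g, leibniz_lie g u, add_lie]

end LieRing

section

variable {Φ : Type u} {L : Type v} [CommRing Φ] [LieRing L] [LieAlgebra Φ L]

/-- A Lie algebra `L = P ⊕ Z ⊕ N`, graded with `P`, `Z`, `N` in degrees `1`, `0`, `-1`. -/
structure ThreeGraded (P Z N : Submodule Φ L) : Prop where
  exists_add : ∀ x, ∃ p ∈ P, ∃ z ∈ Z, ∃ n ∈ N, x = p + z + n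
  eq_zero : ∀ p ∈ P, ∀ z ∈ Z, ∀ n ∈ N, p + z + n = 0 → p = 0 ∧ z = 0 ∧ n = 0
  lie_PP : ∀ x ∈ P, ∀ y ∈ P, ⁅x, y⁆ = 0
  lie_NN : ∀ x ∈ N, ∀ y ∈ N, ⁅x, y⁆ = 0
  lie_PN : ∀ x ∈ P, ∀ y ∈ N, ⁅x, y⁆ ∈ Z
  lie_ZP : ∀ x ∈ Z, ∀ y ∈ P, ⁅x, y⁆ ∈ P
  lie_ZN : ∀ x ∈ Z, ∀ y ∈ N, ⁅x, y⁆ ∈ N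
  lie_ZZ : ∀ x ∈ Z, ∀ y ∈ Z, ⁅x, y⁆ ∈ Z

namespace ThreeGraded

variable {P Z N : Submodule Φ L}

theorem lie_mem_swap {A B C : Submodule Φ L} (h : ∀ x ∈ A, ∀ y ∈ B, ⁅x, y⁆ ∈ C) :
    ∀ x ∈ B, ∀ y ∈ A, ⁅x, y⁆ ∈ C := fun x hx y hy => by
  rw [← lie_skew]
  exact neg_mem (h y hy x hx)

theorem symm (h : ThreeGraded P Z N) : ThreeGraded N Z P where
  exists_add x := by
    obtain ⟨p, hp, z, hz, n, hn, rfl⟩ := h.exists_add x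
    exact ⟨n, hn, z, hz, p, hp, by abel⟩
  eq_zero n hn z hz p hp h0 := by
    obtain ⟨h1, h2, h3⟩ := h.eq_zero p hp z hz n hn (by rw [← h0]; abel)
    exact ⟨h3, h2, h1⟩
  lie_PP := h.lie_NN
  lie_NN := h.lie_PP
  lie_PN := lie_mem_swap h.lie_PN
  lie_ZP := h.lie_ZN
  lie_ZN := h.lie_ZP
  lie_ZZ := h.lie_ZZ

theorem triple_mem (h : ThreeGraded P Z N) {x y z : L} (hx : x ∈ P) (hy : y ∈ N) (hz : z ∈ P) :
    ⁅⁅x, y⁆, z⁆ ∈ P := h.lie_ZP _ (h.lie_PN x hx y hy) z hz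

theorem triple_comm (h : ThreeGraded P Z N) {x z : L} (hx : x ∈ P) (y : L) (hz : z ∈ P) :
    ⁅⁅x, y⁆, z⁆ = ⁅⁅z, y⁆, x⁆ := lie_lie_comm_of_lie_eq_zero (h.lie_PP x hx z hz) y

/-- The trilinear product `{x, y, z} = [[x, y], z]`. -/
def triple (h : ThreeGraded P Z N) : P →ₗ[Φ] N →ₗ[Φ] P →ₗ[Φ] P :=
  LinearMap.mk₂ Φ (fun x y => (LieAlgebra.ad Φ L ⁅(x : L), (y : L)⁆ : L →ₗ[Φ] L).restrict
      fun _ hz => h.triple_mem x.2 y.2 hz)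
    (fun x x' y => by
      ext z
      change ⁅⁅(x : L) + x', (y : L)⁆, (z : L)⁆ =
        ⁅⁅(x : L), (y : L)⁆, (z : L)⁆ + ⁅⁅(x' : L), (y : L)⁆, (z : L)⁆
      rw [add_lie, add_lie])
    (fun r x y => by
      ext z
      change ⁅⁅r • (x : L), (y : L)⁆, (z : L)⁆ = r • ⁅⁅(x : L), (y : L)⁆, (z : L)⁆
      rw [smul_lie, smul_lie])
    (fun x y y' => by
      ext z
      change ⁅⁅(x : L), (y : L) + y'⁆, (z : L)⁆ =
        ⁅⁅(x : L), (y : L)⁆, (z : L)⁆ + ⁅⁅(x : L), (y' : L)⁆, (z : L)⁆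
      rw [lie_add, add_lie])
    (fun r x y => by
      ext z
      change ⁅⁅(x : L), r • (y : L)⁆, (z : L)⁆ = r • ⁅⁅(x : L), (y : L)⁆, (z : L)⁆
      rw [lie_smul, smul_lie])

theorem triple_apply (h : ThreeGraded P Z N) (x : P) (y : N) (z : P) :
    (h.triple x y z : L) = ⁅⁅(x : L), (y : L)⁆, (z : L)⁆ := rfl

variable [Invertible (2 : Φ)]

/-- `Q_x y = ½ [[x, y], x]`. -/
def quad (h : ThreeGraded P Z N) : QuadraticMap Φ P (N →ₗ[Φ] P) := .ofTriple h.triple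

theorem quad_triple (h : ThreeGraded P Z N) (x : P) (y : N) (z : P) :
    (h.quad.triple x y z : L) = ⁅⁅(x : L), (y : L)⁆, (z : L)⁆ := by
  rw [quad, QuadraticMap.ofTriple_triple (T := h.triple)
    (fun x y z => Subtype.ext (h.triple_comm x.2 y z.2)), triple_apply]

theorem tripleDer (h : ThreeGraded P Z N) : h.quad.TripleDer h.symm.quad := by
  intro x y u v z
  ext
  simp only [quad_triple, Submodule.coe_add, Submodule.coe_sub]
  have : ⁅⁅(x : L), (y : L)⁆, (v : L)⁆ = -⁅⁅(y : L), (x : L)⁆, (v : L)⁆ := by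
    rw [← lie_skew (x : L), neg_lie]
  rw [lie_lie_lie_eq, this, lie_neg, neg_lie]
  abel

/-- The Jordan pair of a three-graded Lie algebra. -/
def pair (h : ThreeGraded P Z N) (h6 : IsUnit (6 : Φ)) : JordanPair Φ P N :=
  .ofTriples h6 h.quad h.symm.quad h.tripleDer h.symm.tripleDer

theorem pair_Dp (h : ThreeGraded P Z N) (h6 : IsUnit (6 : Φ)) (x : P) (y : N) (z : P) :
    ((h.pair h6).Dp x y z : L) = ⁅⁅(x : L), (y : L)⁆, (z : L)⁆ := h.quad_triple x y z

theorem pair_Dm (h : ThreeGraded P Z N) (h6 : IsUnit (6 : Φ)) (x : N) (y : P) (z : N) :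
    ((h.pair h6).Dm x y z : L) = ⁅⁅(x : L), (y : L)⁆, (z : L)⁆ := h.symm.quad_triple x y z

/-- The fundamental formula Q_{Q_x y} = Q_x Q_y Q_x in terms of brackets. It carries nondegeneracy
of the whole pair over to ideals. -/
theorem fundamental (h : ThreeGraded P Z N) (h6 : IsUnit (6 : Φ)) {x y z : L} (hx : x ∈ P)
    (hy : y ∈ N) (hz : z ∈ N) :
    ⁅⁅⁅⁅x, y⁆, x⁆, z⁆, ⁅⁅x, y⁆, x⁆⁆ = ⁅⁅x, ⁅⁅y, ⁅⁅x, z⁆, x⁆⁆, y⁆⁆, x⁆ := by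
  have := congrArg (Subtype.val) (QuadraticMap.triple_fundamental h6 h.tripleDer h.symm.tripleDer
    ⟨x, hx⟩ ⟨y, hy⟩ ⟨z, hz⟩)
  simpa only [quad_triple] using this

end ThreeGraded

/-- A three-graded Lie algebra `P ⊕ Z ⊕ N` whose Jordan pair `(P, N)` is strongly nondegenerate and
acted upon faithfully by `Z`. -/
structure NondegThreeGraded (P Z N : Submodule Φ L) : Prop extends ThreeGraded P Z N where
  nondeg_P : ∀ x ∈ P, (∀ y ∈ N, ⁅⁅x, y⁆, x⁆ = 0) → x = 0
  nondeg_N : ∀ x ∈ N, (∀ y ∈ P, ⁅⁅x, y⁆, x⁆ = 0) → x = 0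
  faithful : ∀ g ∈ Z, (∀ x ∈ P, ⁅g, x⁆ = 0) → (∀ y ∈ N, ⁅g, y⁆ = 0) → g = 0

/-! ### Nondegeneracy inside ideals of a three-graded algebra. -/

namespace NondegThreeGraded

variable {P Z N : Submodule Φ L}

theorem symm (h : NondegThreeGraded P Z N) : NondegThreeGraded N Z P where
  toThreeGraded := h.toThreeGraded.symm
  nondeg_P := h.nondeg_N
  nondeg_N := h.nondeg_P
  faithful g hg h1 h2 := h.faithful g hg h2 h1

variable (K : LieIdeal Φ L)

/-- For v, z in N one has Q_{Q_u v} z = Q_u (Q_v Q_u z) up to scalars, and Q_v Q_u z lies in K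
because u does. So Q_u v is an absolute zero divisor, hence zero for all v, and then u is zero. -/
theorem eq_zero_of_triple_self [Invertible (2 : Φ)] (h : NondegThreeGraded P Z N)
    (h6 : IsUnit (6 : Φ)) {u : L} (hu : u ∈ P) (huK : u ∈ K)
    (h0 : ∀ y ∈ K, y ∈ N → ⁅⁅u, y⁆, u⁆ = 0) : u = 0 := by
  refine h.nondeg_P u hu fun v hv => h.nondeg_P _ (h.triple_mem hu hv hu) fun z hz => ?_
  rw [h.fundamental h6 hu hv hz]
  refine h0 _ ?_ (h.toThreeGraded.symm.triple_mem hv (h.triple_mem hu hz hu) hv)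
  exact lie_mem_left Φ L K _ _ (lie_mem_right Φ L K _ _ (lie_mem_right Φ L K _ _ huK))

/-- Put F(a, b) = [[u, a], [[u, b], u]]. The hypothesis removes the middle term of the Leibniz
expansion, leaving F(a, b) = 2F(b, a); hence F = 4F and 3F = 0. Once F vanishes, so does {w, b, w}
for w = {u, a, u}, and `eq_zero_of_triple_self` gives first w = 0 and then u = 0. -/
theorem eq_zero_of_triple_mid [Invertible (2 : Φ)] (h : NondegThreeGraded P Z N)
    (h6 : IsUnit (6 : Φ)) {u : L} (hu : u ∈ P) (huK : u ∈ K)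
    (h0 : ∀ a ∈ K, a ∈ N → ∀ b ∈ K, b ∈ N → ⁅⁅u, a⁆, b⁆ = 0) : u = 0 := by
  have h2 : ∀ a ∈ K, a ∈ N → ∀ b ∈ K, b ∈ N →
      ⁅⁅u, a⁆, ⁅⁅u, b⁆, u⁆⁆ = (2 : Φ) • ⁅⁅u, b⁆, ⁅⁅u, a⁆, u⁆⁆ := fun a ha haN b hb hbN => by
    rw [lie_lie_lie_eq, h0 a ha haN b hb hbN, h.triple_comm (h.triple_mem hu haN hu) b hu, lie_zero,
      zero_lie]
    module
  have hF : ∀ a ∈ K, a ∈ N → ∀ b ∈ K, b ∈ N → ⁅⁅u, a⁆, ⁅⁅u, b⁆, u⁆⁆ = 0 :=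
      fun a ha haN b hb hbN => by
    have k1 := h2 a ha haN b hb hbN
    have k2 := h2 b hb hbN a ha haN
    apply smul_left_cancel_of_isUnit (isUnit_three_of_six h6)
    linear_combination (norm := module) (-1 : Φ) • k1 - (2 : Φ) • k2
  refine eq_zero_of_triple_self K h h6 hu huK fun a ha haN =>
    eq_zero_of_triple_self K h h6 (h.triple_mem hu haN hu) (lie_mem_right Φ L K _ _ huK)
      fun b hb hbN => ?_
  have h3 : ⁅⁅⁅⁅u, a⁆, u⁆, b⁆, u⁆ = 0 := by
    rw [h.triple_comm (h.triple_mem hu haN hu) b hu]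
    exact hF b hb hbN a ha haN
  have h4 : ⁅⁅⁅⁅u, a⁆, u⁆, b⁆, a⁆ = 0 := by
    rw [lie_lie ⁅u, a⁆ u b, h0 a ha haN b hb hbN, lie_zero, sub_zero, lie_lie,
      h0 b hb hbN a ha haN, h0 a ha haN a ha haN, lie_zero, lie_zero, sub_zero]
  rw [lie_lie_lie_eq ⁅⁅⁅u, a⁆, u⁆, b⁆ u a u, h3, h4]
  simp

/-- For v in P and a, b in K ∩ N, the Jacobi identity moves g outwards: [[[g, v], a], b] = [g, [[v,
a], b]] = 0. So [g, v] = 0 by `eq_zero_of_triple_mid`. The mirrored argument, now with g killing all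
of P, shows that g kills N, and faithfulness concludes. -/
theorem eq_zero_of_lie_zero_part [Invertible (2 : Φ)] (h : NondegThreeGraded P Z N)
    (h6 : IsUnit (6 : Φ)) {g : L} (hg : g ∈ Z) (hgK : g ∈ K)
    (h0 : ∀ y ∈ K, y ∈ N → ⁅g, y⁆ = 0) : g = 0 := by
  have hP : ∀ v ∈ P, ⁅g, v⁆ = 0 := fun v hv =>
    eq_zero_of_triple_mid K h h6 (h.lie_ZP g hg v hv) (lie_mem_left Φ L K _ _ hgK)
      fun a ha haN b hb hbN => by
        rw [lie_lie g, h0 a ha haN, lie_zero, sub_zero, lie_lie g, h0 b hb hbN, lie_zero,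
          sub_zero]
        exact h0 _ (lie_mem_right Φ L K _ _ hb) (h.lie_ZN _ (h.lie_PN v hv a haN) b hbN)
  refine h.faithful g hg hP fun v hv =>
    eq_zero_of_triple_mid K h.symm h6 (h.lie_ZN g hg v hv) (lie_mem_left Φ L K _ _ hgK)
      fun a ha haP b hb hbP => ?_
  rw [lie_lie g, hP a haP, lie_zero, sub_zero, lie_lie g, hP b hbP, lie_zero, sub_zero]
  exact hP _ (h.lie_ZP _ (h.symm.lie_PN v hv a haP) b hbP)

/-- Graded ideals of `P ⊕ Z ⊕ N`. -/
def _root_.LieIdeal.IsThreeGraded (K : LieIdeal Φ L) (P Z N : Submodule Φ L) : Prop :=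
  ∀ p ∈ P, ∀ z ∈ Z, ∀ n ∈ N, p + z + n ∈ K → p ∈ K ∧ z ∈ K ∧ n ∈ K

theorem _root_.LieIdeal.IsThreeGraded.symm {K : LieIdeal Φ L} (hK : K.IsThreeGraded P Z N) :
    K.IsThreeGraded N Z P := fun p hp z hz n hn h => by
  obtain ⟨h1, h2, h3⟩ := hK n hn z hz p hp (by rwa [show n + z + p = p + z + n by abel])
  exact ⟨h3, h2, h1⟩

variable {K}

theorem lie_eq_zero_of_graded (h : NondegThreeGraded P Z N) (hK : K.IsThreeGraded P Z N) {u : L}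
    (hP : ∀ y ∈ K, y ∈ P → ⁅u, y⁆ = 0) (hZ : ∀ y ∈ K, y ∈ Z → ⁅u, y⁆ = 0)
    (hN : ∀ y ∈ K, y ∈ N → ⁅u, y⁆ = 0) (y : L) (hy : y ∈ K) : ⁅u, y⁆ = 0 := by
  obtain ⟨p, hp, z, hz, n, hn, rfl⟩ := h.exists_add y
  obtain ⟨h1, h2, h3⟩ := hK p hp z hz n hn hy
  rw [lie_add, lie_add, hP p h1 hp, hZ z h2 hz, hN n h3 hn, add_zero, add_zero]

/-- For g in I ∩ Z, the element [u, g] lies in I ∩ P and commutes with I ∩ N, so it vanishes by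
nondegeneracy. Thus u centralizes the whole essential ideal. -/
theorem eq_zero_of_lie_neg_part [Invertible (2 : Φ)] (h : NondegThreeGraded P Z N)
    (hs : LieSemiprime Φ L) (h6 : IsUnit (6 : Φ)) (I : EssentialIdeal Φ L)
    (hI : I.1.IsThreeGraded P Z N) {u : L} (hu : u ∈ P) (h0 : ∀ y ∈ I.1, y ∈ N → ⁅u, y⁆ = 0) :
    u = 0 := by
  refine I.eq_zero_of_lie hs (h.lie_eq_zero_of_graded hI (fun y _ hy => h.lie_PP u hu y hy)
    (fun g hg hgZ => ?_) h0)
  refine eq_zero_of_triple_self I.1 h h6 (ThreeGraded.lie_mem_swap h.lie_ZP u hu g hgZ)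
    (lie_mem_right Φ L I.1 _ _ hg) fun y hy hyN => ?_
  rw [lie_lie u, h0 y hy hyN, lie_zero, sub_zero, h0 _ (lie_mem_right Φ L I.1 _ _ hy)
    (h.lie_ZN g hgZ y hyN), zero_lie]

end NondegThreeGraded
end

/-! ### Derivations of degree two -/

section

variable {Φ : Type u} {L : Type v} [CommRing Φ] [LieRing L] [LieAlgebra Φ L]

/-- Polarization with 1/6: expanding at x + y gives T(x,x,y) + T(x,y,y) = 0, replacing y by -y
separates the two terms, and a second polarization concludes. -/
theorem eq_zero_of_symmetric_trilinear {A M : Type*} [AddCommGroup A] [AddCommGroup M] [Module Φ M]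
    (h6 : IsUnit (6 : Φ)) (T : A → A → A → M)
    (hadd : ∀ x y a b, T (x + y) a b = T x a b + T y a b)
    (h12 : ∀ a b c, T a b c = T b a c) (h23 : ∀ a b c, T a b c = T a c b)
    (h : ∀ x, T x x x = 0) (x y z : A) : T x y z = 0 := by
  have hadd2 (a x y b) : T a (x + y) b = T a x b + T a y b := by
    rw [h12, hadd, h12 x, h12 y]
  have hadd3 (a b x y) : T a b (x + y) = T a b x + T a b y := by
    rw [h23, hadd2, h23 a x, h23 a y]
  have hneg (x a b) : T (-x) a b = -T x a b := by
    have h0 : T 0 a b = 0 := by simpa using hadd 0 0 a b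
    rw [eq_neg_iff_add_eq_zero, ← hadd, neg_add_cancel, h0]
  have k1 (x y) : T x x y + T x y y = 0 := by
    apply smul_left_cancel_of_isUnit (isUnit_three_of_six h6)
    have := h (x + y)
    simp only [hadd, hadd2, hadd3, h] at this
    rw [h12 y x x, h23 x y x, h12 y x y, h23 y y x, h12 y x y] at this
    rw [← this]
    module
  have k2 (x y) : T x x y = 0 := by
    have h1 := k1 x y
    have h2 := k1 x (-y)
    rw [h23 x x, h12 x, hneg, h12 x (-y), hneg, h23 y x (-y), h12 y (-y), hneg, neg_neg,
      h12 y x x, h23 x y x, h23 y y x, h12 y x y] at h2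
    apply smul_left_cancel_of_isUnit (isUnit_two_of_six h6)
    linear_combination (norm := module) h1 - h2
  have := k2 (x + y) z
  rw [hadd, hadd2, hadd2, k2, k2, h12 y x, zero_add, add_zero, ← two_smul Φ] at this
  exact smul_left_cancel_of_isUnit (isUnit_two_of_six h6) this

namespace NondegThreeGraded

variable {P Z N : Submodule Φ L} [Invertible (2 : Φ)]

/-- The heart of the vanishing in degree two. The product T(a, b, c) = [[D a, b], c] on K ∩ N is
symmetric, and the operators T(a, b, -) are derivations of it. Such a product is so degenerate that
the nondegenerate pair allows only T = 0; then [D x, y] kills K ∩ N and is zero. -/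
theorem degree_two_lie (h : NondegThreeGraded P Z N) (h6 : IsUnit (6 : Φ)) {I K : LieIdeal Φ L}
    (hKI : K ≤ I) {D : L → L} (hadd : ∀ x ∈ I, ∀ y ∈ I, D (x + y) = D x + D y)
    (hlie : ∀ x ∈ I, ∀ y ∈ I, D ⁅x, y⁆ = ⁅D x, y⁆ + ⁅x, D y⁆)
    (hN : ∀ x ∈ I, x ∈ N → D x ∈ P) (hZ : ∀ x ∈ I, x ∈ Z → D x = 0)
    {x y : L} (hx : x ∈ K) (hxN : x ∈ N) (hy : y ∈ K) (hyN : y ∈ N) : ⁅D x, y⁆ = 0 := by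
  obtain ⟨M, hM⟩ : ∃ M : Submodule Φ L, M = K.toSubmodule ⊓ N := ⟨_, rfl⟩
  have mI {a} (ha : a ∈ M) : a ∈ I := by rw [hM] at ha; exact hKI ha.1
  have mK {a} (ha : a ∈ M) : a ∈ K := by rw [hM] at ha; exact ha.1
  have mN {a} (ha : a ∈ M) : a ∈ N := by rw [hM] at ha; exact ha.2
  have mk {a} (ha : a ∈ K) (ha' : a ∈ N) : a ∈ M := by rw [hM]; exact ⟨ha, ha'⟩
  obtain ⟨T, hT⟩ : ∃ T : L → L → L → L, ∀ a b c, T a b c = ⁅⁅D a, b⁆, c⁆ :=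
    ⟨_, fun _ _ _ => rfl⟩
  have D0 : D 0 = 0 := by simpa using hadd 0 (zero_mem _) 0 (zero_mem _)
  -- N is abelian, so 0 = D [a, b] = [D a, b] + [a, D b].
  have s1 {a b} (ha : a ∈ M) (hb : b ∈ M) : ⁅D a, b⁆ = ⁅D b, a⁆ := by
    have := hlie a (mI ha) b (mI hb)
    rw [h.lie_NN a (mN ha) b (mN hb), D0, ← lie_skew a, ← sub_eq_add_neg] at this
    exact (sub_eq_zero.1 this.symm)
  have h12 {a b} (ha : a ∈ M) (hb : b ∈ M) (c) : T a b c = T b a c := by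
    rw [hT, hT, s1 ha hb]
  have h23 (a) {b c} (hb : b ∈ M) (hc : c ∈ M) : T a b c = T a c b := by
    rw [hT, hT, lie_lie, h.lie_NN b (mN hb) c (mN hc), lie_zero, zero_sub, lie_skew]
  have memZ {a b} (ha : a ∈ M) (hb : b ∈ M) : ⁅D a, b⁆ ∈ Z :=
    h.lie_PN _ (hN a (mI ha) (mN ha)) b (mN hb)
  have memK {a b} (hb : b ∈ M) : ⁅D a, b⁆ ∈ K := lie_mem_right Φ L K _ _ (mK hb)
  have memM {a b c} (ha : a ∈ M) (hb : b ∈ M) (hc : c ∈ M) : T a b c ∈ M := by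
    rw [hT]
    exact mk (lie_mem_right Φ L K _ _ (mK hc)) (h.lie_ZN _ (memZ ha hb) c (mN hc))
  -- The term with D [D a, b] disappears because [D a, b] has degree 0 and D kills degree 0.
  have DT {a b c} (ha : a ∈ M) (hb : b ∈ M) (hc : c ∈ M) : D (T a b c) = ⁅⁅D a, b⁆, D c⁆ := by
    rw [hT, hlie _ (hKI (memK hb)) c (mI hc), hZ _ (hKI (memK hb)) (memZ ha hb), zero_lie,
      zero_add]
  have eqv {a b c} (d e) (ha : a ∈ M) (hb : b ∈ M) (hc : c ∈ M) :
      T a b (T c d e) = T (T a b c) d e + T c (T a b d) e + T c d (T a b e) := by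
    rw [hT a b, hT c d e, lie_lie_lie_eq, hT (T a b c), DT ha hb hc]
    simp only [hT]
  -- In the derivation rule for T(x, x, -) applied to T(x, x, c), the term T(x, x, T(x, x, c))
  -- occurs on both sides and cancels, leaving 2T(T(x, x, x), x, c) = 0.
  have e1 {x c} (hx : x ∈ M) (hc : c ∈ M) : T (T x x x) x c = 0 := by
    have := eqv x c hx hx hx
    rw [h12 hx (memM hx hx hx)] at this
    apply smul_left_cancel_of_isUnit (isUnit_two_of_six h6)
    linear_combination (norm := module) -this
  -- Applying the derivation T(x, c, -) to T(x, x, x) gives T(x, c, T(x, x, x)) = 3T(x, x, T(x, x,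
  -- c)), and the left side vanishes by `e1`.
  have e2 {x c} (hx : x ∈ M) (hc : c ∈ M) : T x x (T x x c) = 0 := by
    have := eqv x x hx hc hx
    rw [h23 x hc (memM hx hx hx), h12 hx (memM hx hx hx), h23 _ hx hc |>.symm, e1 hx hc,
      h12 (memM hx hx hc) hx, h23 x (memM hx hx hc) hx] at this
    apply smul_left_cancel_of_isUnit (isUnit_three_of_six h6)
    linear_combination (norm := module) -this
  -- Up to sign T(x, x, x) is {x, D x, x}. For b in P put y = {x, b, x}. The fundamental formula
  -- turns the product of T(x, x, x) with b into {x, {D x, y, D x}, x}. Here {D x, y, D x} = D T(x,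
  -- y, x), so this product is T(x, x, T(x, x, y)) up to sign, which is zero by `e2`.
  have e3 {x} (hx : x ∈ M) : T x x x = 0 := by
    refine h.nondeg_N _ (mN (memM hx hx hx)) fun b hb => ?_
    have hy : ⁅⁅x, b⁆, x⁆ ∈ M := mk (lie_mem_right Φ L K _ _ (mK hx))
      (h.symm.triple_mem (mN hx) hb (mN hx))
    have hu := memM hx hy hx
    have k := h.symm.fundamental h6 (mN hx) (hN x (mI hx) (mN hx)) hb
    rw [← DT hx hy hx, ← lie_skew x (D x), ← lie_skew x (D (T _ _ _))] at k
    simp only [neg_lie, lie_neg, neg_neg] at k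
    rw [← hT x x x, ← hT _ x x, h12 hu hx, h23 x hu hx, h23 x hy hx, e2 hx hy, neg_zero] at k
    exact k
  have e4 {a b c} (ha : a ∈ M) (hb : b ∈ M) (hc : c ∈ M) : T a b c = 0 :=
    eq_zero_of_symmetric_trilinear (A := M) h6 (fun a b c => T a b c)
      (fun x y a b => by
        simp only [hT, Submodule.coe_add]
        rw [hadd _ (mI x.2) _ (mI y.2), add_lie, add_lie])
      (fun a b c => h12 a.2 b.2 c) (fun a b c => h23 a b.2 c.2) (fun x => e3 x.2)
      ⟨a, ha⟩ ⟨b, hb⟩ ⟨c, hc⟩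
  have hx' := mk hx hxN
  have hy' := mk hy hyN
  exact eq_zero_of_lie_zero_part K h h6 (memZ hx' hy') (memK hy') fun c hc hcN => by
    rw [← hT, e4 hx' hy' (mk hc hcN)]

end NondegThreeGraded

/-! ### The graded interior of an ideal -/

namespace ThreeGraded

variable {P Z N : Submodule Φ L}

theorem lie_homogeneous (h : ThreeGraded P Z N) {a b : L} (ha : a ∈ P ∨ a ∈ Z ∨ a ∈ N)
    (hb : b ∈ P ∨ b ∈ Z ∨ b ∈ N) : ⁅a, b⁆ ∈ P ∨ ⁅a, b⁆ ∈ Z ∨ ⁅a, b⁆ ∈ N := by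
  rcases ha with ha | ha | ha <;> rcases hb with hb | hb | hb
  · exact Or.inl (by rw [h.lie_PP a ha b hb]; exact zero_mem _)
  · exact Or.inl (lie_mem_swap h.lie_ZP a ha b hb)
  · exact Or.inr (Or.inl (h.lie_PN a ha b hb))
  · exact Or.inl (h.lie_ZP a ha b hb)
  · exact Or.inr (Or.inl (h.lie_ZZ a ha b hb))
  · exact Or.inr (Or.inr (h.lie_ZN a ha b hb))
  · exact Or.inr (Or.inl (lie_mem_swap h.lie_PN a ha b hb))
  · exact Or.inr (Or.inr (lie_mem_swap h.lie_ZN a ha b hb))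
  · exact Or.inl (by rw [h.lie_NN a ha b hb]; exact zero_mem _)

theorem induction_homogeneous (h : ThreeGraded P Z N) {C : L → Prop}
    (hom : ∀ x, x ∈ P ∨ x ∈ Z ∨ x ∈ N → C x) (add : ∀ x y, C x → C y → C (x + y)) (x : L) :
    C x := by
  obtain ⟨p, hp, z, hz, n, hn, rfl⟩ := h.exists_add x
  exact add _ _ (add _ _ (hom p (Or.inl hp)) (hom z (Or.inr (Or.inl hz))))
    (hom n (Or.inr (Or.inr hn)))

/-- The submodule spanned by the homogeneous elements of `K`. -/
def interiorSubmodule (K : LieIdeal Φ L) (P Z N : Submodule Φ L) : Submodule Φ L :=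
  (K.toSubmodule ⊓ P) ⊔ (K.toSubmodule ⊓ Z) ⊔ (K.toSubmodule ⊓ N)

theorem mem_interiorSubmodule {K : LieIdeal Φ L} {x : L} (hx : x ∈ K)
    (h : x ∈ P ∨ x ∈ Z ∨ x ∈ N) : x ∈ interiorSubmodule K P Z N := by
  rcases h with h | h | h
  · exact Submodule.mem_sup_left (Submodule.mem_sup_left ⟨hx, h⟩)
  · exact Submodule.mem_sup_left (Submodule.mem_sup_right ⟨hx, h⟩)
  · exact Submodule.mem_sup_right ⟨hx, h⟩

theorem exists_of_mem_interiorSubmodule {K : LieIdeal Φ L} {x : L}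
    (hx : x ∈ interiorSubmodule K P Z N) : ∃ p ∈ P, p ∈ K ∧ ∃ z ∈ Z, z ∈ K ∧ ∃ n ∈ N, n ∈ K ∧
      x = p + z + n := by
  obtain ⟨a, ha, n, hn, rfl⟩ := Submodule.mem_sup.1 hx
  obtain ⟨p, hp, z, hz, rfl⟩ := Submodule.mem_sup.1 ha
  exact ⟨p, hp.2, hp.1, z, hz.2, hz.1, n, hn.2, hn.1, rfl⟩

/-- The largest graded ideal contained in an ideal. -/
def interior (h : ThreeGraded P Z N) (K : LieIdeal Φ L) : LieIdeal Φ L where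
  toSubmodule := interiorSubmodule K P Z N
  lie_mem {w x} hx := by
    obtain ⟨p, hp, hpK, z, hz, hzK, n, hn, hnK, rfl⟩ := exists_of_mem_interiorSubmodule hx
    refine h.induction_homogeneous (C := fun w => ⁅w, p + z + n⁆ ∈ interiorSubmodule K P Z N)
      (fun w hw => ?_) (fun a b ha hb => by rw [add_lie]; exact add_mem ha hb) w
    rw [lie_add, lie_add]
    refine add_mem (add_mem ?_ ?_) ?_
    · exact mem_interiorSubmodule (lie_mem_right Φ L K _ _ hpK) (h.lie_homogeneous hw (Or.inl hp))
    · exact mem_interiorSubmodule (lie_mem_right Φ L K _ _ hzK)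
        (h.lie_homogeneous hw (Or.inr (Or.inl hz)))
    · exact mem_interiorSubmodule (lie_mem_right Φ L K _ _ hnK)
        (h.lie_homogeneous hw (Or.inr (Or.inr hn)))

theorem interior_le (h : ThreeGraded P Z N) (K : LieIdeal Φ L) : h.interior K ≤ K := by
  intro x hx
  obtain ⟨p, hp, hpK, z, hz, hzK, n, hn, hnK, rfl⟩ := exists_of_mem_interiorSubmodule hx
  exact add_mem (add_mem hpK hzK) hnK

theorem isThreeGraded_of_le_interior (h : ThreeGraded P Z N) {K : LieIdeal Φ L}
    (hK : K ≤ h.interior K) : K.IsThreeGraded P Z N := by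
  intro p hp z hz n hn hx
  obtain ⟨p', hp', hpK, z', hz', hzK, n', hn', hnK, he⟩ := exists_of_mem_interiorSubmodule (hK hx)
  obtain ⟨h1, h2, h3⟩ := h.eq_zero _ (sub_mem hp hp') _ (sub_mem hz hz') _ (sub_mem hn hn')
    (by rw [← sub_eq_zero] at he; rw [← he]; abel)
  rw [sub_eq_zero.1 h1, sub_eq_zero.1 h2, sub_eq_zero.1 h3]
  exact ⟨hpK, hzK, hnK⟩

theorem interior_isThreeGraded (h : ThreeGraded P Z N) (K : LieIdeal Φ L) :
    (h.interior K).IsThreeGraded P Z N := by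
  refine h.isThreeGraded_of_le_interior fun x hx => ?_
  obtain ⟨p, hp, hpK, z, hz, hzK, n, hn, hnK, rfl⟩ := exists_of_mem_interiorSubmodule hx
  have mem {a : L} (ha : a ∈ K) (h' : a ∈ P ∨ a ∈ Z ∨ a ∈ N) : a ∈ h.interior (h.interior K) :=
    mem_interiorSubmodule (show a ∈ h.interior K from mem_interiorSubmodule ha h') h'
  exact add_mem (add_mem (mem hpK (Or.inl hp)) (mem hzK (Or.inr (Or.inl hz))))
    (mem hnK (Or.inr (Or.inr hn)))

theorem sq_isThreeGraded (h : ThreeGraded P Z N) {I : LieIdeal Φ L}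
    (hI : I.IsThreeGraded P Z N) : (⁅I, I⁆ : LieIdeal Φ L).IsThreeGraded P Z N := by
  refine h.isThreeGraded_of_le_interior (LieSubmodule.lie_le_iff _ _ _ |>.2 fun x hx y hy => ?_)
  have key {a b : L} (ha : a ∈ I) (hb : b ∈ I) (ha' : a ∈ P ∨ a ∈ Z ∨ a ∈ N)
      (hb' : b ∈ P ∨ b ∈ Z ∨ b ∈ N) : ⁅a, b⁆ ∈ h.interior ⁅I, I⁆ :=
    mem_interiorSubmodule (LieSubmodule.lie_mem_lie ha hb) (h.lie_homogeneous ha' hb')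
  obtain ⟨p, hp, z, hz, n, hn, rfl⟩ := h.exists_add x
  obtain ⟨p', hp', z', hz', n', hn', rfl⟩ := h.exists_add y
  obtain ⟨h1, h2, h3⟩ := hI p hp z hz n hn hx
  obtain ⟨h1', h2', h3'⟩ := hI p' hp' z' hz' n' hn' hy
  simp only [add_lie, lie_add]
  refine add_mem (add_mem (add_mem (add_mem ?_ ?_) ?_) (add_mem (add_mem ?_ ?_) ?_))
    (add_mem (add_mem ?_ ?_) ?_) <;>
    refine key (by assumption) (by assumption) (by tauto) (by tauto)

theorem inf_isThreeGraded {I J : LieIdeal Φ L} (hI : I.IsThreeGraded P Z N)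
    (hJ : J.IsThreeGraded P Z N) : (I ⊓ J).IsThreeGraded P Z N := fun p hp z hz n hn hx => by
  obtain ⟨h1, h2, h3⟩ := hI p hp z hz n hn hx.1
  obtain ⟨h1', h2', h3'⟩ := hJ p hp z hz n hn hx.2
  exact ⟨⟨h1, h1'⟩, ⟨h2, h2'⟩, ⟨h3, h3'⟩⟩

end ThreeGraded

/-! ### Graded essential ideals and the vanishing of derivations of degree two. -/

namespace NondegThreeGraded

variable {P Z N : Submodule Φ L} [Invertible (2 : Φ)]

/-- If p + z + n is in K and a, b are in P, then bracketing with a and b leaves [[n, a], b], an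
element of K ∩ P. If K ∩ P = 0, then n = 0 by `eq_zero_of_triple_mid`. Symmetrically p = 0, and the
remaining z is zero by faithfulness. This is what makes the graded interior of an essential ideal
essential. -/
theorem exists_homogeneous (h : NondegThreeGraded P Z N) (h6 : IsUnit (6 : Φ)) {K : LieIdeal Φ L}
    (hK : K ≠ ⊥) : (∃ x ∈ K, x ∈ P ∧ x ≠ 0) ∨ ∃ x ∈ K, x ∈ N ∧ x ≠ 0 := by
  by_contra! hc
  obtain ⟨hP, hN⟩ := hc
  refine hK ((LieSubmodule.eq_bot_iff K).2 fun x hx => ?_)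
  have key {P Z N : Submodule Φ L} (h : NondegThreeGraded P Z N) (hP : ∀ x ∈ K, x ∈ P → x = 0)
      {p z n : L} (hp : p ∈ P) (hz : z ∈ Z) (hn : n ∈ N) (hx : p + z + n ∈ K) : n = 0 := by
    refine eq_zero_of_triple_mid ⊤ h.symm h6 hn (LieSubmodule.mem_top _) fun a _ ha b _ hb => ?_
    have h1 : ⁅⁅p + z + n, a⁆, b⁆ = ⁅⁅n, a⁆, b⁆ := by
      rw [add_lie _ n, add_lie p, h.lie_PP p hp a ha, zero_add, add_lie,
        h.lie_PP _ (h.lie_ZP z hz a ha) b hb, zero_add]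
    rw [← h1]
    refine hP _ (lie_mem_left Φ L K _ _ (lie_mem_left Φ L K _ _ hx)) ?_
    rw [h1]
    exact h.lie_ZP _ (ThreeGraded.lie_mem_swap h.lie_PN n hn a ha) b hb
  obtain ⟨p, hp, z, hz, n, hn, rfl⟩ := h.exists_add x
  have hn0 := key h hP hp hz hn hx
  have hp0 := key h.symm hN hn hz hp (by rwa [show n + z + p = p + z + n by abel])
  rw [hn0, hp0, zero_add, add_zero] at hx ⊢
  exact h.faithful z hz (fun a ha => hP _ (lie_mem_left Φ L K _ _ hx) (h.lie_ZP z hz a ha))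
    (fun a ha => hN _ (lie_mem_left Φ L K _ _ hx) (h.lie_ZN z hz a ha))

/-- Essential ideals contain graded essential ideals. -/
def interior (h : NondegThreeGraded P Z N) (h6 : IsUnit (6 : Φ)) (I : EssentialIdeal Φ L) :
    EssentialIdeal Φ L :=
  ⟨h.toThreeGraded.interior I.1, fun J hJ h0 => by
    have key (x : L) (hx : x ∈ I.1 ⊓ J) (hP : x ∈ P ∨ x ∈ Z ∨ x ∈ N) : x = 0 := by
      have : x ∈ h.toThreeGraded.interior I.1 ⊓ J :=
        ⟨ThreeGraded.mem_interiorSubmodule hx.1 hP, hx.2⟩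
      rw [h0] at this
      exact (LieSubmodule.mem_bot x).1 this
    rcases h.exists_homogeneous h6 (I.2 J hJ) with ⟨x, hx, hP, hx0⟩ | ⟨x, hx, hN, hx0⟩
    · exact hx0 (key x hx (Or.inl hP))
    · exact hx0 (key x hx (Or.inr (Or.inr hN)))⟩

theorem le_interior (h : NondegThreeGraded P Z N) (h6 : IsUnit (6 : Φ)) (I : EssentialIdeal Φ L) :
    I ≤ h.interior h6 I := h.toThreeGraded.interior_le I.1

/-- On I² only the part in N matters. There d n lies in P and commutes with I² ∩ N by
`degree_two_lie`, so `eq_zero_of_lie_neg_part` applies. -/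
theorem degree_two_eq_zero (h : NondegThreeGraded P Z N) (h6 : IsUnit (6 : Φ))
    (hs : LieSemiprime Φ L) {I : EssentialIdeal Φ L} (hI : I.1.IsThreeGraded P Z N) (d : PDer I)
    (hN : ∀ x : I.1, (x : L) ∈ N → d x ∈ P) (hZ : ∀ x : I.1, (x : L) ∈ Z → d x = 0)
    (hP : ∀ x : I.1, (x : L) ∈ P → d x = 0) : MaxQuot.mk hs I d = 0 := by
  classical
  -- The value 0 outside I is irrelevant; a total map spares membership proofs in the computation
  -- with D.
  obtain ⟨D, hD⟩ : ∃ D : L → L, ∀ x (hx : x ∈ I.1), D x = d ⟨x, hx⟩ :=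
    ⟨fun x => if hx : x ∈ I.1 then d ⟨x, hx⟩ else 0, fun x hx => dif_pos hx⟩
  have hK : (I.sq hs).1.IsThreeGraded P Z N := h.toThreeGraded.sq_isThreeGraded hI
  rw [← MaxQuot.mk_restrict (I.le_sq hs), ← map_zero (MaxQuot.mk hs (I.sq hs))]
  refine congrArg _ (LieDerivation.ext fun x => ?_)
  obtain ⟨x, hx⟩ := x
  rw [PDer.restrict_apply]
  change d ⟨x, I.le_sq hs hx⟩ = 0
  obtain ⟨p, hp, z, hz, n, hn, rfl⟩ := h.exists_add x
  obtain ⟨h1, h2, h3⟩ := hK p hp z hz n hn hx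
  have he : d ⟨p + z + n, I.le_sq hs hx⟩ = d ⟨p, I.le_sq hs h1⟩ + d ⟨z, I.le_sq hs h2⟩ +
      d ⟨n, I.le_sq hs h3⟩ := by
    rw [← map_add, ← map_add]; rfl
  rw [he, hP _ hp, hZ _ hz, zero_add, zero_add]
  refine h.eq_zero_of_lie_neg_part hs h6 (I.sq hs) hK (hN _ hn) fun y hy hyN => ?_
  rw [← hD]
  refine h.degree_two_lie h6 (I.le_sq hs) (D := D) ?_ ?_ ?_ ?_ h3 hn hy hyN
  · intro x hx y hy
    rw [hD x hx, hD y hy, hD _ (add_mem hx hy), ← map_add]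
    rfl
  · intro x hx y hy
    rw [hD x hx, hD y hy, hD _ (lie_mem_right Φ L I.1 x y hy)]
    exact d.map_lie ⟨x, hx⟩ ⟨y, hy⟩
  · intro x hx hxN
    rw [hD x hx]
    exact hN _ hxN
  · intro x hx hxZ
    rw [hD x hx]
    exact hZ _ hxZ

end NondegThreeGraded
end

/-! ### `ℤ`-indexed three-gradings -/

section

variable {Φ : Type u} {L : Type v} [CommRing Φ] [LieRing L] [LieAlgebra Φ L]
  {𝓛 : ℤ → Submodule Φ L}

theorem eq_or_eq_bot (hbot : ∀ i, i ≠ -1 → i ≠ 0 → i ≠ 1 → 𝓛 i = ⊥) (i : ℤ) :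
    i = 1 ∨ i = 0 ∨ i = -1 ∨ 𝓛 i = ⊥ := by
  by_cases h1 : i = 1
  · exact Or.inl h1
  by_cases h2 : i = 0
  · exact Or.inr (Or.inl h2)
  by_cases h3 : i = -1
  · exact Or.inr (Or.inr (Or.inl h3))
  · exact Or.inr (Or.inr (Or.inr (hbot i h3 h2 h1)))

namespace ThreeGraded

theorem lie_mem (h : ThreeGraded (𝓛 1) (𝓛 0) (𝓛 (-1)))
    (hbot : ∀ i, i ≠ -1 → i ≠ 0 → i ≠ 1 → 𝓛 i = ⊥) (i j : ℤ) (x y : L) (hx : x ∈ 𝓛 i)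
    (hy : y ∈ 𝓛 j) : ⁅x, y⁆ ∈ 𝓛 (i + j) := by
  rcases eq_or_eq_bot hbot i with rfl | rfl | rfl | hi
  · rcases eq_or_eq_bot hbot j with rfl | rfl | rfl | hj
    · rw [h.lie_PP x hx y hy]; exact zero_mem _
    · exact lie_mem_swap h.lie_ZP x hx y hy
    · exact h.lie_PN x hx y hy
    · rw [hj, Submodule.mem_bot] at hy; rw [hy, lie_zero]; exact zero_mem _
  · rcases eq_or_eq_bot hbot j with rfl | rfl | rfl | hj
    · exact h.lie_ZP x hx y hy
    · exact h.lie_ZZ x hx y hy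
    · exact h.lie_ZN x hx y hy
    · rw [hj, Submodule.mem_bot] at hy; rw [hy, lie_zero]; exact zero_mem _
  · rcases eq_or_eq_bot hbot j with rfl | rfl | rfl | hj
    · exact lie_mem_swap h.lie_PN x hx y hy
    · exact lie_mem_swap h.lie_ZN x hx y hy
    · rw [h.lie_NN x hx y hy]; exact zero_mem _
    · rw [hj, Submodule.mem_bot] at hy; rw [hy, lie_zero]; exact zero_mem _
  · rw [hi, Submodule.mem_bot] at hx; rw [hx, zero_lie]; exact zero_mem _

theorem isInternal (h : ThreeGraded (𝓛 1) (𝓛 0) (𝓛 (-1)))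
    (hbot : ∀ i, i ≠ -1 → i ≠ 0 → i ≠ 1 → 𝓛 i = ⊥) : DirectSum.IsInternal 𝓛 := by
  classical
  constructor
  · rw [injective_iff_map_eq_zero]
    intro v hv
    have hz : ∀ i, i ≠ -1 → i ≠ 0 → i ≠ 1 → v i = 0 := fun i a b c => by
      exact Subtype.ext ((Submodule.mem_bot Φ).1 ((hbot i a b c).le (v i).2))
    have hsum : v = DirectSum.of (fun i => 𝓛 i) 1 (v 1) + DirectSum.of (fun i => 𝓛 i) 0 (v 0) +
        DirectSum.of (fun i => 𝓛 i) (-1) (v (-1)) := by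
      refine DFinsupp.ext fun i => ?_
      rw [DirectSum.add_apply, DirectSum.add_apply]
      by_cases h1 : i = 1
      · subst h1
        rw [DirectSum.of_eq_same, DirectSum.of_eq_of_ne _ _ _ (by decide),
          DirectSum.of_eq_of_ne _ _ _ (by decide), add_zero, add_zero]
      by_cases h2 : i = 0
      · subst h2
        rw [DirectSum.of_eq_same, DirectSum.of_eq_of_ne _ _ _ (by decide),
          DirectSum.of_eq_of_ne _ _ _ (by decide), add_zero, zero_add]
      by_cases h3 : i = -1
      · subst h3
        rw [DirectSum.of_eq_same, DirectSum.of_eq_of_ne _ _ _ (by decide),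
          DirectSum.of_eq_of_ne _ _ _ (by decide), add_zero, zero_add]
      rw [DirectSum.of_eq_of_ne _ _ _ h1, DirectSum.of_eq_of_ne _ _ _ h2,
        DirectSum.of_eq_of_ne _ _ _ h3, add_zero, add_zero]
      exact hz i h3 h2 h1
    rw [hsum, map_add, map_add, DirectSum.coeAddMonoidHom_of, DirectSum.coeAddMonoidHom_of,
      DirectSum.coeAddMonoidHom_of] at hv
    obtain ⟨h1, h2, h3⟩ := h.eq_zero _ (v 1).2 _ (v 0).2 _ (v (-1)).2 hv
    rw [hsum, Subtype.ext (a1 := v 1) (a2 := 0) h1, Subtype.ext (a1 := v 0) (a2 := 0) h2,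
      Subtype.ext (a1 := v (-1)) (a2 := 0) h3, map_zero, map_zero, map_zero, add_zero, add_zero]
  · intro x
    obtain ⟨p, hp, z, hz, n, hn, rfl⟩ := h.exists_add x
    refine ⟨DirectSum.of (fun i => 𝓛 i) 1 ⟨p, hp⟩ + DirectSum.of (fun i => 𝓛 i) 0 ⟨z, hz⟩ +
        DirectSum.of (fun i => 𝓛 i) (-1) ⟨n, hn⟩, ?_⟩
    rw [map_add, map_add, DirectSum.coeAddMonoidHom_of, DirectSum.coeAddMonoidHom_of,
      DirectSum.coeAddMonoidHom_of]

theorem isThreeGrading (h : ThreeGraded (𝓛 1) (𝓛 0) (𝓛 (-1)))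
    (hbot : ∀ i, i ≠ -1 → i ≠ 0 → i ≠ 1 → 𝓛 i = ⊥) : IsThreeGrading 𝓛 where
  isInternal := h.isInternal hbot
  lie_mem := h.lie_mem hbot
  eq_bot := hbot

end ThreeGraded

namespace IsThreeGrading

theorem threeGraded (h : IsThreeGrading 𝓛) : ThreeGraded (𝓛 1) (𝓛 0) (𝓛 (-1)) where
  exists_add x := by
    have hx : x ∈ ⨆ i, 𝓛 i := by
      rw [h.isInternal.submodule_iSup_eq_top]
      exact Submodule.mem_top
    induction hx using Submodule.iSup_induction' with
    | mem i x hx =>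
      rcases eq_or_eq_bot h.eq_bot i with rfl | rfl | rfl | hi
      · exact ⟨x, hx, 0, zero_mem _, 0, zero_mem _, by simp⟩
      · exact ⟨0, zero_mem _, x, hx, 0, zero_mem _, by simp⟩
      · exact ⟨0, zero_mem _, 0, zero_mem _, x, hx, by simp⟩
      · rw [hi, Submodule.mem_bot] at hx
        exact ⟨0, zero_mem _, 0, zero_mem _, 0, zero_mem _, by simp [hx]⟩
    | zero => exact ⟨0, zero_mem _, 0, zero_mem _, 0, zero_mem _, by simp⟩
    | add x y _ _ hx hy =>
      obtain ⟨p, hp, z, hz, n, hn, rfl⟩ := hx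
      obtain ⟨p', hp', z', hz', n', hn', rfl⟩ := hy
      exact ⟨_, add_mem hp hp', _, add_mem hz hz', _, add_mem hn hn', by abel⟩
  eq_zero p hp z hz n hn h0 := by
    classical
    have hinj : Function.Injective (DirectSum.coeAddMonoidHom 𝓛) := h.isInternal.1
    have h1 : DirectSum.of (fun i => 𝓛 i) 1 ⟨p, hp⟩ + DirectSum.of (fun i => 𝓛 i) 0 ⟨z, hz⟩ +
        DirectSum.of (fun i => 𝓛 i) (-1) ⟨n, hn⟩ = 0 := hinj (by
      rw [map_add, map_add, DirectSum.coeAddMonoidHom_of, DirectSum.coeAddMonoidHom_of,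
        DirectSum.coeAddMonoidHom_of, map_zero]
      exact h0)
    have h2 (i : ℤ) := congrArg (fun v : DirectSum ℤ fun i => 𝓛 i => (v i : L)) h1
    refine ⟨?_, ?_, ?_⟩
    · have := h2 1
      rwa [DirectSum.add_apply, DirectSum.add_apply, DirectSum.of_eq_same,
        DirectSum.of_eq_of_ne _ _ _ (by decide), DirectSum.of_eq_of_ne _ _ _ (by decide),
        add_zero, add_zero] at this
    · have := h2 0
      rwa [DirectSum.add_apply, DirectSum.add_apply, DirectSum.of_eq_same,
        DirectSum.of_eq_of_ne _ _ _ (by decide), DirectSum.of_eq_of_ne _ _ _ (by decide),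
        add_zero, zero_add] at this
    · have := h2 (-1)
      rwa [DirectSum.add_apply, DirectSum.add_apply, DirectSum.of_eq_same,
        DirectSum.of_eq_of_ne _ _ _ (by decide), DirectSum.of_eq_of_ne _ _ _ (by decide),
        add_zero, zero_add] at this
  lie_PP x hx y hy := by
    have := h.lie_mem 1 1 x y hx hy
    rwa [h.eq_bot _ (by decide) (by decide) (by decide), Submodule.mem_bot] at this
  lie_NN x hx y hy := by
    have := h.lie_mem (-1) (-1) x y hx hy
    rwa [h.eq_bot _ (by decide) (by decide) (by decide), Submodule.mem_bot] at this
  lie_PN x hx y hy := by simpa using h.lie_mem 1 (-1) x y hx hy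
  lie_ZP x hx y hy := by simpa using h.lie_mem 0 1 x y hx hy
  lie_ZN x hx y hy := by simpa using h.lie_mem 0 (-1) x y hx hy
  lie_ZZ x hx y hy := by simpa using h.lie_mem 0 0 x y hx hy

/-- The projection onto the component of degree `i`. -/
def proj (h : IsThreeGrading 𝓛) (i : ℤ) : L →ₗ[Φ] L :=
  (𝓛 i).subtype ∘ₗ DirectSum.component Φ ℤ (fun i => 𝓛 i) i ∘ₗ
    (LinearEquiv.ofBijective (DirectSum.coeLinearMap 𝓛) h.isInternal).symm.toLinearMap

theorem proj_mem (h : IsThreeGrading 𝓛) (i : ℤ) (x : L) : h.proj i x ∈ 𝓛 i := Subtype.property _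

theorem symm_apply_of_mem (h : IsThreeGrading 𝓛) {i : ℤ} {x : L} (hx : x ∈ 𝓛 i) :
    (LinearEquiv.ofBijective (DirectSum.coeLinearMap 𝓛) h.isInternal).symm x =
      DirectSum.lof Φ ℤ (fun i => 𝓛 i) i ⟨x, hx⟩ := by
  rw [LinearEquiv.symm_apply_eq]
  exact (DirectSum.coeLinearMap_lof 𝓛 i ⟨x, hx⟩).symm

theorem proj_of_mem (h : IsThreeGrading 𝓛) {i : ℤ} {x : L} (hx : x ∈ 𝓛 i) : h.proj i x = x := by
  rw [proj, LinearMap.comp_apply, LinearMap.comp_apply, LinearEquiv.coe_coe,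
    h.symm_apply_of_mem hx, DirectSum.component.lof_self]
  rfl

theorem proj_of_ne (h : IsThreeGrading 𝓛) {i j : ℤ} (hij : i ≠ j) {x : L} (hx : x ∈ 𝓛 i) :
    h.proj j x = 0 := by
  rw [proj, LinearMap.comp_apply, LinearMap.comp_apply, LinearEquiv.coe_coe,
    h.symm_apply_of_mem hx, DirectSum.component.of, dif_neg hij]
  rfl

theorem proj_sum (h : IsThreeGrading 𝓛) (x : L) : h.proj 1 x + h.proj 0 x + h.proj (-1) x = x := by
  obtain ⟨p, hp, z, hz, n, hn, rfl⟩ := h.threeGraded.exists_add x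
  simp only [map_add, h.proj_of_mem hp, h.proj_of_mem hz, h.proj_of_mem hn]
  rw [h.proj_of_ne (by decide) hz, h.proj_of_ne (by decide) hn, h.proj_of_ne (by decide) hp,
    h.proj_of_ne (by decide) hn, h.proj_of_ne (by decide) hp, h.proj_of_ne (by decide) hz]
  abel

/-- A map between algebras supported in degrees -1, 0, 1 has parts of degrees -2, ..., 2 only. For
each source degree k, two of the five shifted projections vanish. -/
theorem proj_sum_shift (h : IsThreeGrading 𝓛) {k : ℤ} (hk : k = 1 ∨ k = 0 ∨ k = -1) (x : L) :
    h.proj (2 + k) x + h.proj (1 + k) x + h.proj (0 + k) x + h.proj (-1 + k) x +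
      h.proj (-2 + k) x = x := by
  have h0 (i : ℤ) (h1 : i ≠ -1) (h2 : i ≠ 0) (h3 : i ≠ 1) : h.proj i x = 0 := by
    have := h.proj_mem i x
    rwa [h.eq_bot i h1 h2 h3, Submodule.mem_bot] at this
  conv_rhs => rw [← h.proj_sum x]
  rcases hk with rfl | rfl | rfl
  · rw [h0 (2 + 1) (by decide) (by decide) (by decide), h0 (1 + 1) (by decide) (by decide)
      (by decide)]
    norm_num
  · rw [h0 (2 + 0) (by decide) (by decide) (by decide), h0 (-2 + 0) (by decide) (by decide)
      (by decide)]
    norm_num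
  · rw [h0 (-1 + -1) (by decide) (by decide) (by decide), h0 (-2 + -1) (by decide) (by decide)
      (by decide)]
    norm_num

theorem proj_lie (h : IsThreeGrading 𝓛) {k : ℤ} {y : L} (hy : y ∈ 𝓛 k) (i : ℤ) (x : L) :
    h.proj (i + k) ⁅x, y⁆ = ⁅h.proj i x, y⁆ := by
  have key {j : ℤ} {x : L} (hx : x ∈ 𝓛 j) : h.proj (i + k) ⁅x, y⁆ = ⁅h.proj i x, y⁆ := by
    by_cases hij : j = i
    · subst hij
      rw [h.proj_of_mem hx, h.proj_of_mem (h.lie_mem _ _ _ _ hx hy)]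
    · rw [h.proj_of_ne hij hx, h.proj_of_ne (by omega) (h.lie_mem _ _ _ _ hx hy), zero_lie]
  obtain ⟨p, hp, z, hz, n, hn, rfl⟩ := h.threeGraded.exists_add x
  simp only [add_lie, map_add, key hp, key hz, key hn]

theorem _root_.IsGradedIdeal.isThreeGraded {I : LieIdeal Φ L} (hI : IsGradedIdeal 𝓛 I) :
    I.IsThreeGraded (𝓛 1) (𝓛 0) (𝓛 (-1)) := by
  intro p hp z hz n hn hx
  have := hI (Finsupp.single 1 p + Finsupp.single 0 z + Finsupp.single (-1) n) ?_ ?_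
  · have h1 := this 1
    have h2 := this 0
    have h3 := this (-1)
    simp only [Finsupp.add_apply, Finsupp.single_apply] at h1 h2 h3
    norm_num at h1 h2 h3
    exact ⟨h1, h2, h3⟩
  · intro j
    rw [Finsupp.add_apply, Finsupp.add_apply, Finsupp.single_apply, Finsupp.single_apply,
      Finsupp.single_apply]
    refine add_mem (add_mem ?_ ?_) ?_ <;> split_ifs with hj <;>
      first | exact zero_mem _ | (subst hj; assumption)
  · rw [Finsupp.sum_add_index' (fun _ => rfl) (fun _ _ _ => rfl),
      Finsupp.sum_add_index' (fun _ => rfl) (fun _ _ _ => rfl), Finsupp.sum_single_index rfl,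
      Finsupp.sum_single_index rfl, Finsupp.sum_single_index rfl]
    exact hx

theorem isGradedIdeal_of_isThreeGraded (h : IsThreeGrading 𝓛) {I : LieIdeal Φ L}
    (hI : I.IsThreeGraded (𝓛 1) (𝓛 0) (𝓛 (-1))) : IsGradedIdeal 𝓛 I := by
  intro y hy hs
  have hz : ∀ i, i ≠ -1 → i ≠ 0 → i ≠ 1 → y i = 0 := fun i a b c => by
    have := hy i
    rwa [h.eq_bot i a b c, Submodule.mem_bot] at this
  have hsum : (y.sum fun _ a => a) = y 1 + y 0 + y (-1) := by
    rw [Finsupp.sum_of_support_subset y (s := {1, 0, -1}) (fun i hi => by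
      by_contra hc
      simp only [Finset.mem_insert, Finset.mem_singleton, not_or] at hc
      exact Finsupp.mem_support_iff.1 hi (hz i hc.2.2 hc.2.1 hc.1)) _ (fun _ _ => rfl)]
    rw [Finset.sum_insert (by decide), Finset.sum_insert (by decide), Finset.sum_singleton,
      add_assoc]
  rw [hsum] at hs
  obtain ⟨h1, h2, h3⟩ := hI _ (hy 1) _ (hy 0) _ (hy (-1)) hs
  intro j
  by_cases a : j = 1
  · subst a; exact h1
  by_cases b : j = 0
  · subst b; exact h2
  by_cases c : j = -1
  · subst c; exact h3
  · rw [hz j c b a]; exact zero_mem _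

theorem proj_mem_ideal {I : LieIdeal Φ L} (h : IsThreeGrading 𝓛)
    (hI : I.IsThreeGraded (𝓛 1) (𝓛 0) (𝓛 (-1))) {x : L}
    (hx : x ∈ I) (j : ℤ) : h.proj j x ∈ I := by
  obtain ⟨h1, h2, h3⟩ := hI _ (h.proj_mem 1 x) _ (h.proj_mem 0 x) _ (h.proj_mem (-1) x)
    (by rwa [h.proj_sum])
  rcases eq_or_eq_bot h.eq_bot j with rfl | rfl | rfl | hj
  · exact h1
  · exact h2
  · exact h3
  · have := h.proj_mem j x
    rw [hj, Submodule.mem_bot] at this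
    rw [this]
    exact zero_mem _

/-- The elements of a graded ideal are sums of its homogeneous elements. -/
theorem induction_ideal (h : IsThreeGrading 𝓛) {I : LieIdeal Φ L}
    (hI : I.IsThreeGraded (𝓛 1) (𝓛 0) (𝓛 (-1)))
    {C : I → Prop} (hom : ∀ k : ℤ, k = 1 ∨ k = 0 ∨ k = -1 → ∀ x : I, (x : L) ∈ 𝓛 k → C x)
    (add : ∀ x y, C x → C y → C (x + y)) (x : I) : C x := by
  have hx := h.proj_sum (x : L)
  have : x = ⟨h.proj 1 x, h.proj_mem_ideal hI x.2 1⟩ + ⟨h.proj 0 x, h.proj_mem_ideal hI x.2 0⟩ +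
      ⟨h.proj (-1) x, h.proj_mem_ideal hI x.2 (-1)⟩ := Subtype.ext hx.symm
  rw [this]
  exact add _ _ (add _ _ (hom 1 (Or.inl rfl) _ (h.proj_mem 1 _))
    (hom 0 (Or.inr (Or.inl rfl)) _ (h.proj_mem 0 _)))
    (hom (-1) (Or.inr (Or.inr rfl)) _ (h.proj_mem (-1) _))

/-- The degree `i` part of a derivation defined on a graded ideal. -/
theorem exists_degree_part (h : IsThreeGrading 𝓛) {I : EssentialIdeal Φ L}
    (hI : I.1.IsThreeGraded (𝓛 1) (𝓛 0) (𝓛 (-1))) (d : PDer I) (i : ℤ) :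
    ∃ e : PDer I, ∀ k : ℤ, ∀ x : I.1, (x : L) ∈ 𝓛 k → e x = h.proj (i + k) (d x) := by
  let π (j : ℤ) : I.1 →ₗ[Φ] I.1 := (h.proj j).restrict fun x hx => h.proj_mem_ideal hI hx j
  let E : I.1 →ₗ[Φ] L := h.proj (i + 1) ∘ₗ (d : I.1 →ₗ[Φ] L) ∘ₗ π 1 +
    h.proj (i + 0) ∘ₗ (d : I.1 →ₗ[Φ] L) ∘ₗ π 0 +
    h.proj (i + -1) ∘ₗ (d : I.1 →ₗ[Φ] L) ∘ₗ π (-1)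
  have π_same {k : ℤ} {x : I.1} (hx : (x : L) ∈ 𝓛 k) : π k x = x :=
    Subtype.ext (h.proj_of_mem hx)
  have π_ne {k j : ℤ} (hkj : k ≠ j) {x : I.1} (hx : (x : L) ∈ 𝓛 k) : π j x = 0 :=
    Subtype.ext (h.proj_of_ne hkj hx)
  have hE (k : ℤ) (x : I.1) (hx : (x : L) ∈ 𝓛 k) : E x = h.proj (i + k) (d x) := by
    change h.proj (i + 1) (d (π 1 x)) + h.proj (i + 0) (d (π 0 x)) +
      h.proj (i + -1) (d (π (-1) x)) = _
    rcases eq_or_eq_bot h.eq_bot k with rfl | rfl | rfl | hk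
    · rw [π_same hx, π_ne (by decide) hx, π_ne (by decide) hx]
      simp
    · rw [π_same hx, π_ne (by decide) hx, π_ne (by decide) hx]
      simp
    · rw [π_same hx, π_ne (by decide) hx, π_ne (by decide) hx]
      simp
    · rw [hk, Submodule.mem_bot] at hx
      rw [Subtype.ext (a1 := x) (a2 := 0) hx]
      simp
  -- Both sides are additive in each variable, so the Leibniz rule is checked on homogeneous x and
  -- y, where projecting a bracket with a homogeneous element only shifts the degree of the
  -- projection.
  have hlie (x y : I.1) : E ⁅x, y⁆ = ⁅(x : L), E y⁆ - ⁅(y : L), E x⁆ := by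
    refine h.induction_ideal hI (C := fun x => E ⁅x, y⁆ = ⁅(x : L), E y⁆ - ⁅(y : L), E x⁆)
      (fun k _ x hx => ?_) (fun a b ha hb => ?_) x
    · refine h.induction_ideal hI (C := fun y => E ⁅x, y⁆ = ⁅(x : L), E y⁆ - ⁅(y : L), E x⁆)
        (fun l _ y hy => ?_) (fun a b ha hb => ?_) y
      · rw [hE (k + l) ⁅x, y⁆ (h.lie_mem k l x y hx hy), hE k x hx, hE l y hy, d.map_lie, map_add,
          ← lie_skew (y : L), sub_neg_eq_add, ← add_assoc, h.proj_lie hy, ← lie_skew (x : L),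
          map_neg, add_assoc i k l, add_comm k l, ← add_assoc, h.proj_lie hx, lie_skew, add_comm]
      · rw [lie_add, map_add, ha, hb, map_add, Submodule.coe_add, lie_add, add_lie]
        abel
    · rw [add_lie, map_add, ha, hb, map_add, Submodule.coe_add, lie_add, add_lie]
      abel
  exact ⟨{ toLinearMap := E, leibniz' := hlie }, hE⟩

end IsThreeGrading
end

/-! ### The grading of the maximal algebra of quotients -/

section

variable {Φ : Type u} {L : Type v} [CommRing Φ] [LieRing L] [LieAlgebra Φ L]
  {𝓛 : ℤ → Submodule Φ L} {hs : LieSemiprime Φ L}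

namespace MaxQuot

theorem exists_of_mem_grading {i : ℤ} {q : MaxQuot hs} (hq : q ∈ grading hs 𝓛 i) :
    ∃ I : EssentialIdeal Φ L, IsGradedIdeal 𝓛 I.1 ∧ ∀ k : ℤ, ∀ x ∈ I.1, x ∈ 𝓛 k →
      ∃ z ∈ 𝓛 (i + k), ⁅q, ofHom hs x⁆ = ofHom hs z := by
  obtain ⟨I, d, hI, hd, rfl⟩ := hq
  exact ⟨I, hI, fun k x hx hk => ⟨_, hd k ⟨x, hx⟩ hk, lie_mk_of I d ⟨x, hx⟩⟩⟩

theorem ofHom_mem_grading (h : IsThreeGrading 𝓛) {i : ℤ} {x : L} (hx : x ∈ 𝓛 i) :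
    ofHom hs x ∈ grading hs 𝓛 i :=
  ⟨EssentialIdeal.top, PDer.ad x, fun _ _ _ _ => LieSubmodule.mem_top _,
    fun j y hy => h.lie_mem i j x y hx hy, rfl⟩

theorem lie_mem_grading (h : IsThreeGrading 𝓛) (i j : ℤ) (q r : MaxQuot hs)
    (hq : q ∈ grading hs 𝓛 i) (hr : r ∈ grading hs 𝓛 j) : ⁅q, r⁆ ∈ grading hs 𝓛 (i + j) := by
  obtain ⟨I, d, hI, hd, rfl⟩ := hq
  obtain ⟨J, e, hJ, he, rfl⟩ := hr
  have hK := ThreeGraded.inf_isThreeGraded hI.isThreeGraded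
    hJ.isThreeGraded
  have h1 : I ≤ I.inf J := (inf_le_left : I.1 ⊓ J.1 ≤ I.1)
  have h2 : J ≤ I.inf J := (inf_le_right : I.1 ⊓ J.1 ≤ J.1)
  rw [← mk_restrict h1, ← mk_restrict h2, lie_mk]
  refine ⟨_, _, h.isGradedIdeal_of_isThreeGraded (h.threeGraded.sq_isThreeGraded hK), ?_, rfl⟩
  intro k x hx
  rw [PDer.comm_apply]
  refine sub_mem ?_ ?_
  · rw [add_assoc]
    exact hd (j + k) _ (he k _ hx)
  · rw [add_comm i, add_assoc]
    exact he (i + k) _ (hd k _ hx)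

variable [Invertible (2 : Φ)]

theorem exists_graded_mk (hn : NondegThreeGraded (𝓛 1) (𝓛 0) (𝓛 (-1))) (h6 : IsUnit (6 : Φ))
    (I : EssentialIdeal Φ L) (q : MaxQuot hs) : ∃ (J : EssentialIdeal Φ L) (d : PDer J),
    I ≤ J ∧ J.1.IsThreeGraded (𝓛 1) (𝓛 0) (𝓛 (-1)) ∧ q = mk hs J d := by
  obtain ⟨J, d, rfl⟩ := exists_mk q
  have h0 : J ≤ I.inf J := (inf_le_right : I.1 ⊓ J.1 ≤ J.1)
  have h1 : I ≤ I.inf J := (inf_le_left : I.1 ⊓ J.1 ≤ I.1)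
  exact ⟨hn.interior h6 (I.inf J), _, h1.trans (hn.le_interior h6 _),
    hn.toThreeGraded.interior_isThreeGraded _,
    (mk_restrict (h0.trans (hn.le_interior h6 (I.inf J))) d).symm⟩

/-- Membership in degree i is read off from brackets with the homogeneous elements of an arbitrary
essential ideal; a graded domain is found inside it. -/
theorem mem_grading_of (h : IsThreeGrading 𝓛) (hn : NondegThreeGraded (𝓛 1) (𝓛 0) (𝓛 (-1)))
    (h6 : IsUnit (6 : Φ)) {i : ℤ} {q : MaxQuot hs} (I : EssentialIdeal Φ L)
    (hq : ∀ k : ℤ, ∀ x ∈ I.1, x ∈ 𝓛 k → ∃ z ∈ 𝓛 (i + k), ⁅q, ofHom hs x⁆ = ofHom hs z) :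
    q ∈ grading hs 𝓛 i := by
  obtain ⟨J, d, hIJ, hJ, rfl⟩ := exists_graded_mk hn h6 I q
  refine ⟨J, d, h.isGradedIdeal_of_isThreeGraded hJ, fun k x hx => ?_, rfl⟩
  obtain ⟨z, hz, he⟩ := hq k x (hIJ x.2) hx
  rw [lie_mk_of] at he
  rwa [ofHom_injective he]

/-- In degrees beyond ±2 every component of L is sent out of range. In degree 2 only L_{-1} → L_1
survives, in degree -2 only L_1 → L_{-1}, and both are excluded by `degree_two_eq_zero`. -/
theorem grading_eq_bot (h : IsThreeGrading 𝓛) (hn : NondegThreeGraded (𝓛 1) (𝓛 0) (𝓛 (-1)))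
    (h6 : IsUnit (6 : Φ)) (i : ℤ) (h1 : i ≠ -1) (h2 : i ≠ 0) (h3 : i ≠ 1) :
    grading hs 𝓛 i = ⊥ := by
  rw [eq_bot_iff]
  rintro _ ⟨I, d, hI, hd, rfl⟩
  rw [Submodule.mem_bot]
  have hI' := hI.isThreeGraded
  have key (k : ℤ) (hk : i + k ≠ -1 ∧ i + k ≠ 0 ∧ i + k ≠ 1) (x : I.1) (hx : (x : L) ∈ 𝓛 k) :
      d x = 0 := by
    have := hd k x hx
    rwa [h.eq_bot _ hk.1 hk.2.1 hk.2.2, Submodule.mem_bot] at this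
  by_cases h4 : i = 2
  · subst h4
    exact hn.degree_two_eq_zero h6 hs hI' d (fun x hx => hd (-1) x hx)
      (fun x hx => key 0 (by decide) x hx) (fun x hx => key 1 (by decide) x hx)
  by_cases h5 : i = -2
  · subst h5
    exact hn.symm.degree_two_eq_zero h6 hs hI'.symm d (fun x hx => hd 1 x hx)
      (fun x hx => key 0 (by decide) x hx) (fun x hx => key (-1) (by decide) x hx)
  rw [← map_zero (mk hs I)]
  refine congrArg _ (LieDerivation.ext fun x => ?_)
  change d x = 0
  refine h.induction_ideal hI' (C := fun x => d x = 0) (fun k hk x hx => key k (by omega) x hx)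
    (fun x y hx hy => by rw [map_add, hx, hy, add_zero]) x

theorem isThreeGrading (h : IsThreeGrading 𝓛) (hn : NondegThreeGraded (𝓛 1) (𝓛 0) (𝓛 (-1)))
    (h6 : IsUnit (6 : Φ)) : IsThreeGrading (grading hs 𝓛) := by
  have hbot := grading_eq_bot (hs := hs) h hn h6
  refine ThreeGraded.isThreeGrading ?_ hbot
  have hlie := lie_mem_grading (hs := hs) h
  refine ⟨?_, ?_, ?_, ?_, ?_, ?_, ?_, ?_⟩
  · intro q
    obtain ⟨I, d, -, hI, rfl⟩ := exists_graded_mk hn h6 EssentialIdeal.top q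
    choose e he using h.exists_degree_part hI d
    have mem (i : ℤ) : mk hs I (e i) ∈ grading hs 𝓛 i :=
      ⟨I, e i, h.isGradedIdeal_of_isThreeGraded hI,
        fun k x hx => by rw [he i k x hx]; exact h.proj_mem _ _, rfl⟩
    have hz (i : ℤ) (h1 : i ≠ -1) (h2 : i ≠ 0) (h3 : i ≠ 1) : mk hs I (e i) = 0 := by
      have := mem i
      rwa [hbot i h1 h2 h3, Submodule.mem_bot] at this
    refine ⟨_, mem 1, _, mem 0, _, mem (-1), ?_⟩
    -- The parts of degrees 2 and -2 are needed to recover d as a derivation, although their classes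
    -- vanish.
    have hsum : d = e 2 + e 1 + e 0 + e (-1) + e (-2) := LieDerivation.ext fun x => by
      refine h.induction_ideal hI (C := fun x => d x = (e 2 + e 1 + e 0 + e (-1) + e (-2)) x)
        (fun k hk x hx => ?_) (fun x y hx hy => by rw [map_add, map_add, hx, hy]) x
      simp only [LieDerivation.add_apply, he _ k x hx]
      exact (h.proj_sum_shift hk (d x)).symm
    rw [hsum, map_add, map_add, map_add, map_add, hz 2 (by decide) (by decide) (by decide),
      hz (-2) (by decide) (by decide) (by decide), zero_add, add_zero]
  · intro p hp z hz n hn' h0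
    obtain ⟨I, hI, hp⟩ := exists_of_mem_grading hp
    obtain ⟨J, hJ, hz⟩ := exists_of_mem_grading hz
    obtain ⟨K, hK, hn'⟩ := exists_of_mem_grading hn'
    have hg := ThreeGraded.inf_isThreeGraded (ThreeGraded.inf_isThreeGraded
      hI.isThreeGraded hJ.isThreeGraded)
      hK.isThreeGraded
    -- On a homogeneous x of degree k, the three values lie in the distinct degrees 1 + k, k, -1 + k
    -- of L. Their sum is zero, so each of them is.
    have key (x : ((I.inf J).inf K).1) : ⁅p, ofHom hs x⁆ = 0 ∧ ⁅z, ofHom hs x⁆ = 0 ∧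
        ⁅n, ofHom hs x⁆ = 0 := by
      refine h.induction_ideal hg (C := fun x => ⁅p, ofHom hs x⁆ = 0 ∧ ⁅z, ofHom hs x⁆ = 0 ∧
        ⁅n, ofHom hs x⁆ = 0) (fun k _ x hx => ?_) (fun x y hx hy => ?_) x
      · obtain ⟨a, ha, ha'⟩ := hp k x x.2.1.1 hx
        obtain ⟨b, hb, hb'⟩ := hz k x x.2.1.2 hx
        obtain ⟨c, hc, hc'⟩ := hn' k x x.2.2 hx
        have h1 : a + b + c = 0 := by
          apply ofHom_injective (h := hs)
          rw [map_add, map_add, ← ha', ← hb', ← hc', ← add_lie, ← add_lie, h0, zero_lie, map_zero]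
        have e1 := congrArg (h.proj (1 + k)) h1
        have e2 := congrArg (h.proj (0 + k)) h1
        have e3 := congrArg (h.proj (-1 + k)) h1
        simp only [map_add, h.proj_of_mem ha, h.proj_of_mem hb, h.proj_of_mem hc,
          map_zero] at e1 e2 e3
        rw [h.proj_of_ne (by omega) hb, h.proj_of_ne (by omega) hc, add_zero, add_zero] at e1
        rw [h.proj_of_ne (by omega) ha, h.proj_of_ne (by omega) hc, zero_add, add_zero] at e2
        rw [h.proj_of_ne (by omega) ha, h.proj_of_ne (by omega) hb, zero_add, zero_add] at e3
        rw [ha', hb', hc', e1, e2, e3, map_zero]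
        exact ⟨rfl, rfl, rfl⟩
      · rw [Submodule.coe_add, map_add, lie_add, lie_add, lie_add, hx.1, hx.2.1, hx.2.2, hy.1,
          hy.2.1, hy.2.2, add_zero]
        exact ⟨rfl, rfl, rfl⟩
    exact ⟨eq_zero_of_lie _ fun x hx => (key ⟨x, hx⟩).1,
      eq_zero_of_lie _ fun x hx => (key ⟨x, hx⟩).2.1,
      eq_zero_of_lie _ fun x hx => (key ⟨x, hx⟩).2.2⟩
  · intro x hx y hy
    have := hlie 1 1 x y hx hy
    rwa [hbot _ (by decide) (by decide) (by decide), Submodule.mem_bot] at this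
  · intro x hx y hy
    have := hlie (-1) (-1) x y hx hy
    rwa [hbot _ (by decide) (by decide) (by decide), Submodule.mem_bot] at this
  · intro x hx y hy
    simpa using hlie 1 (-1) x y hx hy
  · intro x hx y hy
    simpa using hlie 0 1 x y hx hy
  · intro x hx y hy
    simpa using hlie 0 (-1) x y hx hy
  · intro x hx y hy
    simpa using hlie 0 0 x y hx hy

end MaxQuot

end

/-! ### The grading of the Tits-Kantor-Koecher algebra -/

namespace JordanPair

variable {Φ : Type u} [CommRing Φ] [Invertible (2 : Φ)]
  {Vp : Type v₁} {Vm : Type v₂} [AddCommGroup Vp] [Module Φ Vp] [AddCommGroup Vm] [Module Φ Vm]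
  {V : JordanPair Φ Vp Vm}

namespace TKK

/-- The inclusion of `IDer V` into `TKK(V)`. -/
def ofDer (V : JordanPair Φ Vp Vm) (g : V.IDer) : V.TKK := ⟨0, g, 0⟩

theorem innerDer_zero_left (y : Vm) : V.innerDer 0 y = 0 := by simp [innerDer]

theorem innerDer_zero_right (x : Vp) : V.innerDer x 0 = 0 := by simp [innerDer]

/-- The inclusion of `V⁺` into `TKK(V)` as a linear map. -/
def ofPlusₗ (V : JordanPair Φ Vp Vm) : Vp →ₗ[Φ] V.TKK where
  toFun := ofPlus V
  map_add' _ _ := ext' rfl (add_zero _).symm (add_zero _).symm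
  map_smul' _ _ := ext' rfl (smul_zero _).symm (smul_zero _).symm

/-- The inclusion of `V⁻` into `TKK(V)` as a linear map. -/
def ofMinusₗ (V : JordanPair Φ Vp Vm) : Vm →ₗ[Φ] V.TKK where
  toFun := ofMinus V
  map_add' _ _ := ext' (add_zero _).symm (add_zero _).symm rfl
  map_smul' _ _ := ext' (smul_zero _).symm (smul_zero _).symm rfl

/-- The inclusion of `IDer V` into `TKK(V)` as a linear map. -/
def ofDerₗ (V : JordanPair Φ Vp Vm) : V.IDer →ₗ[Φ] V.TKK where
  toFun := ofDer V
  map_add' _ _ := ext' (add_zero _).symm rfl (add_zero _).symm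
  map_smul' _ _ := ext' (smul_zero _).symm rfl (smul_zero _).symm

theorem eq_add (a : V.TKK) : a = ofPlus V a.plus + ofDer V a.der + ofMinus V a.minus := by
  refine ext' ?_ ?_ ?_ <;> simp [add_fst, add_mid, add_lst, ofPlus, ofDer, ofMinus]

theorem mem_grading_one {a : V.TKK} : a ∈ grading V 1 ↔ ∃ x, a = ofPlus V x := by
  constructor
  · rintro ⟨-, h2, h3⟩
    exact ⟨a.plus, TKK.ext rfl (h2 (by decide)) (h3 (by decide))⟩
  · rintro ⟨x, rfl⟩
    exact ⟨fun h => absurd rfl h, fun _ => rfl, fun _ => rfl⟩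

theorem mem_grading_zero {a : V.TKK} : a ∈ grading V 0 ↔ ∃ x, a = ofDer V x := by
  constructor
  · rintro ⟨h1, -, h3⟩
    exact ⟨a.der, TKK.ext (h1 (by decide)) rfl (h3 (by decide))⟩
  · rintro ⟨x, rfl⟩
    exact ⟨fun _ => rfl, fun h => absurd rfl h, fun _ => rfl⟩

theorem mem_grading_neg_one {a : V.TKK} : a ∈ grading V (-1) ↔ ∃ x, a = ofMinus V x := by
  constructor
  · rintro ⟨h1, h2, -⟩
    exact ⟨a.minus, TKK.ext (h1 (by decide)) (h2 (by decide)) rfl⟩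
  · rintro ⟨x, rfl⟩
    exact ⟨fun _ => rfl, fun _ => rfl, fun h => absurd rfl h⟩

theorem grading_eq_bot (i : ℤ) (h1 : i ≠ -1) (h2 : i ≠ 0) (h3 : i ≠ 1) : grading V i = ⊥ := by
  rw [eq_bot_iff]
  intro a ha
  exact TKK.ext (ha.1 h3) (ha.2.1 h2) (ha.2.2 h1)

theorem lie_plus_plus (x y : Vp) : ⁅ofPlus V x, ofPlus V y⁆ = 0 := by
  refine ext' ?_ ?_ ?_ <;> simp [lie_fst, lie_mid, lie_lst, ofPlus, zero_fst, zero_mid, zero_lst,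
    innerDer_zero_right]

theorem lie_minus_minus (x y : Vm) : ⁅ofMinus V x, ofMinus V y⁆ = 0 := by
  refine ext' ?_ ?_ ?_ <;> simp [lie_fst, lie_mid, lie_lst, ofMinus, zero_fst, zero_mid, zero_lst,
    innerDer_zero_left]

theorem lie_plus_minus (x : Vp) (y : Vm) :
    ⁅ofPlus V x, ofMinus V y⁆ = ofDer V (V.inner x y) := by
  refine ext' ?_ ?_ ?_ <;> simp [lie_fst, lie_mid, lie_lst, ofPlus, ofMinus, ofDer,
    innerDer_zero_left, inner]

theorem lie_der_plus (g : V.IDer) (x : Vp) : ⁅ofDer V g, ofPlus V x⁆ = ofPlus V (g.1.1 x) := by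
  refine ext' ?_ ?_ ?_ <;> simp [lie_fst, lie_mid, lie_lst, ofPlus, ofDer,
    innerDer_zero_right]

theorem lie_der_minus (g : V.IDer) (x : Vm) : ⁅ofDer V g, ofMinus V x⁆ = ofMinus V (g.1.2 x) := by
  refine ext' ?_ ?_ ?_ <;> simp [lie_fst, lie_mid, lie_lst, ofMinus, ofDer,
    innerDer_zero_left, innerDer_zero_right]

theorem lie_der_der (g g' : V.IDer) : ⁅ofDer V g, ofDer V g'⁆ ∈ grading V 0 := by
  refine ⟨fun _ => ?_, fun h => absurd rfl h, fun _ => ?_⟩ <;> simp [lie_fst, lie_lst, ofDer]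

theorem lie_triple_plus (x : Vp) (y : Vm) (z : Vp) :
    ⁅⁅ofPlus V x, ofMinus V y⁆, ofPlus V z⁆ = ofPlus V (V.Dp x y z) := by
  rw [lie_plus_minus, lie_der_plus]
  rfl

theorem lie_triple_minus (x : Vm) (y : Vp) (z : Vm) :
    ⁅⁅ofMinus V x, ofPlus V y⁆, ofMinus V z⁆ = ofMinus V (V.Dm x y z) := by
  rw [← lie_skew (ofMinus V x), neg_lie, lie_plus_minus, lie_der_minus]
  change -ofMinusₗ V _ = ofMinusₗ V _
  rw [← map_neg]
  exact congrArg (ofMinus V) (neg_neg _)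

theorem ofPlus_injective : Function.Injective (ofPlus V) := fun _ _ h => congrArg TKK.plus h

theorem ofMinus_injective : Function.Injective (ofMinus V) := fun _ _ h => congrArg TKK.minus h

theorem threeGraded (V : JordanPair Φ Vp Vm) :
    ThreeGraded (grading V 1) (grading V 0) (grading V (-1)) where
  exists_add a := ⟨_, mem_grading_one.2 ⟨_, rfl⟩, _, mem_grading_zero.2 ⟨_, rfl⟩, _,
    mem_grading_neg_one.2 ⟨_, rfl⟩, eq_add a⟩
  eq_zero := by
    intro p hp z hz n hn h0
    obtain ⟨x, rfl⟩ := mem_grading_one.1 hp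
    obtain ⟨g, rfl⟩ := mem_grading_zero.1 hz
    obtain ⟨y, rfl⟩ := mem_grading_neg_one.1 hn
    have h1 := congrArg TKK.plus h0
    have h2 := congrArg (fun a : V.TKK => a.der.1) h0
    have h3 := congrArg TKK.minus h0
    simp only [add_fst, add_mid, add_lst, ofPlus, ofDer, ofMinus, add_zero, zero_add,
      ZeroMemClass.coe_zero, zero_fst, zero_mid, zero_lst] at h1 h2 h3
    subst h1 h3
    rw [Subtype.ext (a1 := g) (a2 := 0) h2]
    exact ⟨rfl, rfl, rfl⟩
  lie_PP a ha b hb := by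
    obtain ⟨x, rfl⟩ := mem_grading_one.1 ha
    obtain ⟨y, rfl⟩ := mem_grading_one.1 hb
    exact lie_plus_plus x y
  lie_NN a ha b hb := by
    obtain ⟨x, rfl⟩ := mem_grading_neg_one.1 ha
    obtain ⟨y, rfl⟩ := mem_grading_neg_one.1 hb
    exact lie_minus_minus x y
  lie_PN a ha b hb := by
    obtain ⟨x, rfl⟩ := mem_grading_one.1 ha
    obtain ⟨y, rfl⟩ := mem_grading_neg_one.1 hb
    exact mem_grading_zero.2 ⟨_, lie_plus_minus x y⟩
  lie_ZP a ha b hb := by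
    obtain ⟨x, rfl⟩ := mem_grading_zero.1 ha
    obtain ⟨y, rfl⟩ := mem_grading_one.1 hb
    exact mem_grading_one.2 ⟨_, lie_der_plus x y⟩
  lie_ZN a ha b hb := by
    obtain ⟨x, rfl⟩ := mem_grading_zero.1 ha
    obtain ⟨y, rfl⟩ := mem_grading_neg_one.1 hb
    exact mem_grading_neg_one.2 ⟨_, lie_der_minus x y⟩
  lie_ZZ a ha b hb := by
    obtain ⟨x, rfl⟩ := mem_grading_zero.1 ha
    obtain ⟨y, rfl⟩ := mem_grading_zero.1 hb
    exact lie_der_der x y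

theorem isThreeGrading (V : JordanPair Φ Vp Vm) : IsThreeGrading (grading V) :=
  (threeGraded V).isThreeGrading grading_eq_bot

theorem eq_zero_of_lie_der (g : V.IDer) (h1 : ∀ x, ⁅ofDer V g, ofPlus V x⁆ = 0)
    (h2 : ∀ y, ⁅ofDer V g, ofMinus V y⁆ = 0) : g = 0 := by
  refine Subtype.ext (Prod.ext (LinearMap.ext fun x => ?_) (LinearMap.ext fun y => ?_))
  · have := h1 x
    rw [lie_der_plus] at this
    exact congrArg TKK.plus this
  · have := h2 y
    rw [lie_der_minus] at this
    exact congrArg TKK.minus this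

theorem nondegThreeGraded (hV : V.StronglyNondegenerate) :
    NondegThreeGraded (grading V 1) (grading V 0) (grading V (-1)) where
  toThreeGraded := threeGraded V
  nondeg_P a ha h := by
    obtain ⟨x, rfl⟩ := mem_grading_one.1 ha
    refine (congrArg (ofPlus V) (hV.plus x (LinearMap.ext fun y => ?_))).trans rfl
    have := h _ (mem_grading_neg_one.2 ⟨y, rfl⟩)
    rw [lie_triple_plus, V.Dp_self] at this
    exact two_cancel (congrArg TKK.plus this)
  nondeg_N a ha h := by
    obtain ⟨x, rfl⟩ := mem_grading_neg_one.1 ha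
    refine (congrArg (ofMinus V) (hV.minus x (LinearMap.ext fun y => ?_))).trans rfl
    have := h _ (mem_grading_one.2 ⟨y, rfl⟩)
    rw [lie_triple_minus, show V.Dm x y x = (2 : Φ) • V.Qm x y from V.op.Dp_self _ _] at this
    exact two_cancel (congrArg TKK.minus this)
  faithful a ha h1 h2 := by
    obtain ⟨g, rfl⟩ := mem_grading_zero.1 ha
    exact (congrArg (ofDer V) (eq_zero_of_lie_der g (fun x => h1 _ (mem_grading_one.2 ⟨x, rfl⟩))
      (fun y => h2 _ (mem_grading_neg_one.2 ⟨y, rfl⟩)))).trans rfl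

end TKK

end JordanPair

/-! ### Pairs of quotients -/

namespace JordanPair

variable {Φ : Type u} [CommRing Φ] [Invertible (2 : Φ)]
  {Vp : Type v₁} {Vm : Type v₂} [AddCommGroup Vp] [Module Φ Vp] [AddCommGroup Vm] [Module Φ Vm]
  {Wp : Type w₁} {Wm : Type w₂} [AddCommGroup Wp] [Module Φ Wp] [AddCommGroup Wm] [Module Φ Wm]
  {V : JordanPair Φ Vp Vm} {W : JordanPair Φ Wp Wm}

namespace Hom

theorem map_Dp (f : V.Hom W) (x : Vp) (y : Vm) (z : Vp) :
    f.plus (V.Dp x y z) = W.Dp (f.plus x) (f.minus y) (f.plus z) := by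
  simp only [Dp, QuadraticMap.triple_apply, map_sub, f.map_Qp, map_add]

theorem map_Dm (f : V.Hom W) (x : Vm) (y : Vp) (z : Vm) :
    f.minus (V.Dm x y z) = W.Dm (f.minus x) (f.plus y) (f.minus z) := f.op.map_Dp x y z

/-- A pair of linear maps compatible with the trilinear products is a homomorphism. -/
def ofTriple (p : Vp →ₗ[Φ] Wp) (m : Vm →ₗ[Φ] Wm)
    (hp : ∀ x y, p (V.Dp x y x) = W.Dp (p x) (m y) (p x))
    (hm : ∀ x y, m (V.Dm x y x) = W.Dm (m x) (p y) (m x)) : V.Hom W where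
  plus := p
  minus := m
  map_Qp x y := by
    have := hp x y
    rw [Dp_self, Dp_self, map_smul] at this
    exact (isUnit_of_invertible (2 : Φ)).smul_left_cancel.1 this
  map_Qm x y := by
    have := hm x y
    rw [show V.Dm x y x = _ from V.op.Dp_self x y, show W.Dm (m x) (p y) (m x) = _ from
      W.op.Dp_self _ _, map_smul] at this
    exact (isUnit_of_invertible (2 : Φ)).smul_left_cancel.1 this

theorem ext {f g : V.Hom W} (hp : ∀ x, f.plus x = g.plus x) (hm : ∀ y, f.minus y = g.minus y) :
    f = g := by
  cases f
  cases g
  congr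
  · exact LinearMap.ext hp
  · exact LinearMap.ext hm

end Hom

namespace PairIdeal

/-- The same ideal, in the opposite pair. -/
def op (I : V.PairIdeal) : V.op.PairIdeal where
  plus := I.minus
  minus := I.plus
  Qp_left := I.Qm_left
  Qp_right := I.Qm_right
  Dp_mem := I.Dm_mem
  Qm_left := I.Qp_left
  Qm_right := I.Qp_right
  Dm_mem := I.Dp_mem

theorem Dp_left (I : V.PairIdeal) {x : Vp} (hx : x ∈ I.plus) (y : Vm) (z : Vp) :
    V.Dp x y z ∈ I.plus := by
  rw [V.Dp_symm]
  exact I.Dp_mem z y x hx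

theorem Dp_mid (I : V.PairIdeal) (x : Vp) {y : Vm} (hy : y ∈ I.minus) (z : Vp) :
    V.Dp x y z ∈ I.plus := by
  rw [Dp, QuadraticMap.triple_apply]
  exact sub_mem (sub_mem (I.Qp_right _ y hy) (I.Qp_right _ y hy)) (I.Qp_right _ y hy)

theorem Dm_left (I : V.PairIdeal) {x : Vm} (hx : x ∈ I.minus) (y : Vp) (z : Vm) :
    V.Dm x y z ∈ I.minus := I.op.Dp_left hx y z

theorem Dm_mid (I : V.PairIdeal) (x : Vm) {y : Vp} (hy : y ∈ I.plus) (z : Vm) :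
    V.Dm x y z ∈ I.minus := I.op.Dp_mid x hy z

end PairIdeal

/-- The ideal J need not be the one absorbing p. If p ≠ 0, its absorbing ideal provides a nonzero
product z of p with elements of V, lying in V. The derivation identities move J next to p, so z lies
in Ann_V(J) = 0, a contradiction. -/
theorem Hom.eq_zero_of_annihilated {ι : V.Hom W} (hι : ι.AbsorbsPlus) (hinj : ι.Injective)
    {J : V.PairIdeal} (hJ : J.AnnEqZero) {p : Wp}
    (h1 : ∀ y ∈ J.minus, ∀ v : Vp, W.Dp p (ι.minus y) (ι.plus v) = 0)
    (h2 : ∀ w : Vm, ∀ x ∈ J.plus, W.Dp p (ι.minus w) (ι.plus x) = 0)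
    (h3 : ∀ y ∈ J.minus, ∀ w : Vm, W.Dm (ι.minus y) p (ι.minus w) = 0) : p = 0 := by
  by_contra hp
  have h3' : ∀ y ∈ J.minus, ∀ w : Vm, W.Dm (ι.minus w) p (ι.minus y) = 0 := fun y hy w => by
    rw [W.Dm_symm, h3 y hy]
  obtain ⟨I, -, a1, a2, a3, hne⟩ := hι p hp
  have caseP (y : Vm) (v z : Vp) (hz : ι.plus z = W.Dp p (ι.minus y) (ι.plus v)) :
      W.Dp p (ι.minus y) (ι.plus v) = 0 := by
    have hz' : W.Dp (ι.plus v) (ι.minus y) p = ι.plus z := by rw [W.Dp_symm, hz]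
    have : z ∈ V.annPlus J.plus J.minus := by
      refine ⟨fun j hj v' => hinj.1 ?_, fun v' x hx => hinj.1 ?_, fun v' j hj => hinj.2 ?_⟩
      · have h := W.Dp_Dp (ι.plus v) p (ι.plus v') (ι.minus y) (ι.minus j)
        rw [h1 j hj, map_zero, hz', ← ι.map_Dp, ← ι.map_Dm, ← ι.map_Dp,
          h1 _ (J.Dm_mem y v j hj), h1 j hj, sub_zero, add_zero] at h
        rw [map_zero, ← h]
      · have h := W.Dp_Dp (ι.plus v) p (ι.plus x) (ι.minus y) (ι.minus v')
        rw [h2 v' x hx, map_zero, hz', ← ι.map_Dp, ← ι.map_Dm, ← ι.map_Dp,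
          h2 _ x hx, h2 v' _ (J.Dp_mem v y x hx), sub_zero, add_zero] at h
        rw [map_zero, ← h]
      · have h := W.Dm_Dm (ι.minus y) (ι.minus v') (ι.minus j) (ι.plus v) p
        rw [h3' j hj, map_zero, hz', ← ι.map_Dm, ← ι.map_Dm, ← ι.map_Dm,
          h3' j hj, h3' _ (J.Dm_mem y v j hj), zero_sub, add_zero] at h
        rw [map_zero, ← neg_eq_zero, ← h]
    rw [hJ.1, Set.mem_singleton_iff] at this
    rw [← hz, this, map_zero]
  have caseM (y w z : Vm) (hz : ι.minus z = W.Dm (ι.minus y) p (ι.minus w)) :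
      W.Dm (ι.minus y) p (ι.minus w) = 0 := by
    have : z ∈ V.annMinus J.plus J.minus := by
      refine ⟨fun j hj v' => hinj.2 ?_, fun v' j hj => hinj.2 ?_, fun v' j hj => hinj.1 ?_⟩
      · change ι.minus (V.Dm z j v') = _
        rw [V.Dm_symm, ι.map_Dm, hz, W.Dm_Dm, ← ι.map_Dm, h3 _ (J.Dm_mid v' hj y),
          W.Dp_symm _ _ p, h2 v' j hj, ← ι.map_Dm, h3' _ (J.Dm_mid v' hj w)]
        simp
      · change ι.minus (V.Dm z v' j) = _
        rw [V.Dm_symm, ι.map_Dm, hz, W.Dm_Dm, ← ι.map_Dm, h3 _ (J.Dm_left hj v' y),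
          W.Dp_symm _ _ p, h1 j hj, ← ι.map_Dm, h3' _ (J.Dm_left hj v' w)]
        simp
      · change ι.plus (V.Dp v' z j) = _
        -- For z = {y, p, w} the first identity reduces {v', z, j} to {j, y, {p, w, v'}}. The second
        -- expands this into three terms, each of which contains p multiplied with an element of J.
        have k1 := W.Dp_Dp p (ι.plus v') (ι.plus j) (ι.minus w) (ι.minus y)
        rw [← ι.map_Dp, h2 w _ (J.Dp_mem v' y j hj), W.Dm_symm (ι.minus w), ← hz, ← ι.map_Dp,
          h2 w j hj, map_zero, add_zero, W.Dp_symm _ _ (ι.plus j)] at k1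
        have k2 := W.Dp_Dp (ι.plus j) p (ι.plus v') (ι.minus y) (ι.minus w)
        rw [W.Dp_symm (ι.plus j) _ p, h2 y j hj, ← ι.map_Dm, h1 _ (J.Dm_mid y hj w), ← ι.map_Dp,
          h2 w _ (J.Dp_left hj y v')] at k2
        rw [k2, map_zero, LinearMap.zero_apply, LinearMap.zero_apply, sub_zero, zero_add,
          zero_sub, eq_comm, neg_eq_zero] at k1
        rw [k1, map_zero]
    rw [hJ.2, Set.mem_singleton_iff] at this
    rw [← hz, this, map_zero]
  rcases hne with ⟨y, hy, v, hne⟩ | ⟨w, x, hx, hne⟩ | ⟨y, hy, w, hne⟩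
  · obtain ⟨z, hz⟩ := a1 y hy v
    exact hne (caseP y v z hz)
  · obtain ⟨z, hz⟩ := a2 w x hx
    exact hne (caseP w x z hz)
  · obtain ⟨z, hz⟩ := a3 y hy w
    exact hne (caseM y w z hz)

theorem PairIdeal.AnnEqZero.op {J : V.PairIdeal} (hJ : J.AnnEqZero) : J.op.AnnEqZero :=
  ⟨hJ.2, hJ.1⟩

section

variable {Up : Type a₁} {Um : Type a₂} [AddCommGroup Up] [Module Φ Up] [AddCommGroup Um]
  [Module Φ Um] {U : JordanPair Φ Up Um}

/-- The products of q with the ideal J absorbing it lie in V, where f and g agree. So f q - g q is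
annihilated by J. -/
theorem Hom.plus_eq_of_comp {ι : V.Hom W} (hι : ι.AbsorbsPlus) (hinj : ι.Injective) {j : V.Hom U}
    (hj : j.AbsorbsPlus) {f g : U.Hom W} (hfp : ∀ x, f.plus (j.plus x) = ι.plus x)
    (hfm : ∀ y, f.minus (j.minus y) = ι.minus y) (hgp : ∀ x, g.plus (j.plus x) = ι.plus x)
    (hgm : ∀ y, g.minus (j.minus y) = ι.minus y) (q : Up) : f.plus q = g.plus q := by
  by_cases hq : q = 0
  · rw [hq, map_zero, map_zero]
  obtain ⟨J, hJ, a1, a2, a3, -⟩ := hj q hq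
  rw [← sub_eq_zero]
  refine ι.eq_zero_of_annihilated hι hinj hJ (fun y hy v => ?_) (fun w x hx => ?_)
    (fun y hy w => ?_)
  · obtain ⟨z, hz⟩ := a1 y hy v
    rw [map_sub, LinearMap.sub_apply, LinearMap.sub_apply, sub_eq_zero]
    rw [← hfp, ← hfm, ← f.map_Dp, ← hz, hfp, hfp, hfm, ← hgp, ← hgm, ← hgp v, ← g.map_Dp, ← hz]
  · obtain ⟨z, hz⟩ := a2 w x hx
    rw [map_sub, LinearMap.sub_apply, LinearMap.sub_apply, sub_eq_zero]
    rw [← hfp, ← hfm, ← f.map_Dp, ← hz, hfp, hfp, hfm, ← hgp, ← hgm, ← hgp x, ← g.map_Dp, ← hz]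
  · obtain ⟨z, hz⟩ := a3 y hy w
    rw [map_sub, LinearMap.sub_apply, sub_eq_zero]
    rw [← hfm y, ← hfm w, ← f.map_Dm, ← hz, hfm, hfm, hfm, ← hgm, ← hgm y, ← hgm w, ← g.map_Dm,
      ← hz]

theorem Hom.eq_of_comp {ι : V.Hom W} (hι : ι.IsMQuotient) {j : V.Hom U} (hj : j.IsMQuotient)
    {f g : U.Hom W} (hfp : ∀ x, f.plus (j.plus x) = ι.plus x)
    (hfm : ∀ y, f.minus (j.minus y) = ι.minus y) (hgp : ∀ x, g.plus (j.plus x) = ι.plus x)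
    (hgm : ∀ y, g.minus (j.minus y) = ι.minus y) : f = g :=
  Hom.ext (Hom.plus_eq_of_comp hι.absorbs_plus hι.injective hj.absorbs_plus hfp hfm hgp hgm)
    (Hom.plus_eq_of_comp (f := f.op) (g := g.op) hι.absorbs_minus ⟨hι.injective.2, hι.injective.1⟩
      hj.absorbs_minus hfm hfp hgm hgp)

end

theorem IsDerivation.op {d : Module.End Φ Vp × Module.End Φ Vm} (hd : V.IsDerivation d) :
    V.op.IsDerivation d.swap := ⟨hd.minus, hd.plus⟩

/-- When d vanishes on V and the product of q with elements of J and V lies in V, applying d shows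
that d q has zero product with them. -/
theorem IsDerivation.fst_eq_zero {ι : V.Hom W} (hι : ι.AbsorbsPlus) (hinj : ι.Injective)
    {d : Module.End Φ Wp × Module.End Φ Wm} (hd : W.IsDerivation d)
    (hp : ∀ x, d.1 (ι.plus x) = 0) (hm : ∀ y, d.2 (ι.minus y) = 0) (q : Wp) : d.1 q = 0 := by
  by_cases hq : q = 0
  · rw [hq, map_zero]
  obtain ⟨J, hJ, a1, a2, a3, -⟩ := hι q hq
  refine ι.eq_zero_of_annihilated hι hinj hJ (fun y hy v => ?_) (fun w x hx => ?_)
    (fun y hy w => ?_)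
  · obtain ⟨z, hz⟩ := a1 y hy v
    have := hd.plus q (ι.minus y) (ι.plus v)
    rw [← hz, hp, hp, hm] at this
    simpa using this.symm
  · obtain ⟨z, hz⟩ := a2 w x hx
    have := hd.plus q (ι.minus w) (ι.plus x)
    rw [← hz, hp, hp, hm] at this
    simpa using this.symm
  · obtain ⟨z, hz⟩ := a3 y hy w
    have := hd.minus (ι.minus y) q (ι.minus w)
    rw [← hz, hm, hm, hm] at this
    simpa using this.symm

theorem IsDerivation.eq_zero {ι : V.Hom W} (hι : ι.IsMQuotient)
    {d : Module.End Φ Wp × Module.End Φ Wm} (hd : W.IsDerivation d)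
    (hp : ∀ x, d.1 (ι.plus x) = 0) (hm : ∀ y, d.2 (ι.minus y) = 0) : d = 0 :=
  Prod.ext (LinearMap.ext (hd.fst_eq_zero hι.absorbs_plus hι.injective hp hm))
    (LinearMap.ext (hd.op.fst_eq_zero (ι := ι.op) hι.absorbs_minus
      ⟨hι.injective.2, hι.injective.1⟩ hm hp))

theorem IsDerivation.sub {d e : Module.End Φ Vp × Module.End Φ Vm} (hd : V.IsDerivation d)
    (he : V.IsDerivation e) : V.IsDerivation (d - e) := by
  constructor <;> intro a b c
  · simp only [Prod.fst_sub, Prod.snd_sub, LinearMap.sub_apply, map_sub, hd.plus, he.plus]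
    abel
  · simp only [Prod.fst_sub, Prod.snd_sub, LinearMap.sub_apply, map_sub, hd.minus, he.minus]
    abel

theorem IDer.ext_of_comp {ι : V.Hom W} (hι : ι.IsMQuotient) {d e : W.IDer}
    (hp : ∀ x, d.1.1 (ι.plus x) = e.1.1 (ι.plus x))
    (hm : ∀ y, d.1.2 (ι.minus y) = e.1.2 (ι.minus y)) : d = e := by
  refine Subtype.ext (sub_eq_zero.1 (IsDerivation.eq_zero hι
    ((W.isDerivation_of_mem d.2).sub (W.isDerivation_of_mem e.2)) (fun x => ?_) (fun y => ?_)))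
  · rw [Prod.fst_sub, LinearMap.sub_apply, hp, sub_self]
  · rw [Prod.snd_sub, LinearMap.sub_apply, hm, sub_self]

/-- A sum of δ(x, y) with entries in V also defines an inner derivation of W. That it depends only
on the derivation of V, and not on the chosen sum, is `IDer.ext_of_comp`. -/
theorem Hom.exists_ider (ι : V.Hom W) (g : V.IDer) : ∃ e : W.IDer,
    (∀ x, e.1.1 (ι.plus x) = ι.plus (g.1.1 x)) ∧ ∀ y, e.1.2 (ι.minus y) = ι.minus (g.1.2 y) := by
  obtain ⟨g, hg⟩ := g
  induction hg using Submodule.span_induction with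
  | mem d h =>
    obtain ⟨x, y, rfl⟩ := h
    refine ⟨W.inner (ι.plus x) (ι.minus y), fun z => (ι.map_Dp x y z).symm, fun z => ?_⟩
    change -W.Dm _ _ _ = ι.minus (-V.Dm y x z)
    rw [map_neg, ι.map_Dm]
  | zero => exact ⟨0, fun x => (map_zero ι.plus).symm, fun x => (map_zero ι.minus).symm⟩
  | add d e _ _ hd he =>
    obtain ⟨d', h1, h2⟩ := hd
    obtain ⟨e', h1', h2'⟩ := he
    refine ⟨d' + e', fun x => ?_, fun y => ?_⟩
    · change d'.1.1 _ + e'.1.1 _ = ι.plus (d.1 x + e.1 x)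
      rw [h1, h1', map_add]
    · change d'.1.2 _ + e'.1.2 _ = ι.minus (d.2 y + e.2 y)
      rw [h2, h2', map_add]
  | smul r d _ hd =>
    obtain ⟨d', h1, h2⟩ := hd
    refine ⟨r • d', fun x => ?_, fun y => ?_⟩
    · change r • d'.1.1 _ = ι.plus (r • d.1 x)
      rw [h1, map_smul]
    · change r • d'.1.2 _ = ι.minus (r • d.2 y)
      rw [h2, map_smul]

/-- The embedding of `TKK(V)` in `TKK(W)`, for a pair `W` of `𝔐`-quotients of `V`. -/
theorem Hom.exists_tkk {ι : V.Hom W} (hι : ι.IsMQuotient) : ∃ f : V.TKK →ₗ⁅Φ⁆ W.TKK,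
    Function.Injective f ∧ (∀ a, (f a).plus = ι.plus a.plus) ∧
      (∀ a, (f a).minus = ι.minus a.minus) ∧ (∀ a, (f a).der = 0 → a.der = 0) ∧
      ∀ a, a.der = 0 → (f a).der = 0 := by
  -- The extension of a derivation is unique, so an arbitrary choice is automatically linear and
  -- compatible with brackets.
  choose E hE1 hE2 using ι.exists_ider
  have hEz (g : V.IDer) (h : E g = 0) : g = 0 := by
    refine Subtype.ext (Prod.ext (LinearMap.ext fun x => hι.injective.1 ?_)
      (LinearMap.ext fun y => hι.injective.2 ?_))
    · rw [← hE1, h]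
      exact (map_zero ι.plus).symm
    · rw [← hE2, h]
      exact (map_zero ι.minus).symm
  let f : V.TKK →ₗ⁅Φ⁆ W.TKK :=
    { toFun := fun a => ⟨ι.plus a.plus, E a.der, ι.minus a.minus⟩
      map_add' := fun a b => TKK.ext (map_add ι.plus a.plus b.plus) (IDer.ext_of_comp hι
        (fun x => by
          rw [hE1]
          change ι.plus (a.der.1.1 x + b.der.1.1 x) = (E a.der).1.1 _ + (E b.der).1.1 _
          rw [hE1, hE1, map_add])
        (fun y => by
          rw [hE2]
          change ι.minus (a.der.1.2 y + b.der.1.2 y) = (E a.der).1.2 _ + (E b.der).1.2 _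
          rw [hE2, hE2, map_add])) (map_add ι.minus a.minus b.minus)
      map_smul' := fun r a => TKK.ext (map_smul ι.plus r a.plus) (IDer.ext_of_comp hι
        (fun x => by
          rw [hE1]
          change ι.plus (r • a.der.1.1 x) = r • (E a.der).1.1 _
          rw [hE1, map_smul])
        (fun y => by
          rw [hE2]
          change ι.minus (r • a.der.1.2 y) = r • (E a.der).1.2 _
          rw [hE2, map_smul])) (map_smul ι.minus r a.minus)
      map_lie' := fun {a b} => by
        refine TKK.ext ?_ (IDer.ext_of_comp hι (fun x => ?_) (fun y => ?_)) ?_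
        · change ι.plus (a.der.1.1 b.plus - b.der.1.1 a.plus) =
            (E a.der).1.1 (ι.plus b.plus) - (E b.der).1.1 (ι.plus a.plus)
          rw [map_sub, hE1, hE1]
        · rw [hE1]
          simp only [TKK.lie_mid, Prod.fst_sub, Prod.fst_add, Prod.fst_mul, LinearMap.sub_apply,
            LinearMap.add_apply, Module.End.mul_apply, TKK.innerDer_fst, hE1, map_sub, map_add,
            ι.map_Dp]
        · rw [hE2]
          simp only [TKK.lie_mid, Prod.snd_sub, Prod.snd_add, Prod.snd_mul, LinearMap.sub_apply,
            LinearMap.add_apply, Module.End.mul_apply, TKK.innerDer_snd, hE2, map_sub, map_add,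
            map_neg, ι.map_Dm]
        · change ι.minus (a.der.1.2 b.minus - b.der.1.2 a.minus) =
            (E a.der).1.2 (ι.minus b.minus) - (E b.der).1.2 (ι.minus a.minus)
          rw [map_sub, hE2, hE2] }
  refine ⟨f, ?_, fun _ => rfl, fun _ => rfl, fun a => hEz a.der, fun a ha => ?_⟩
  · rw [injective_iff_map_eq_zero]
    intro a ha
    refine TKK.ext (hι.injective.1 ?_) (hEz _ (congrArg TKK.der ha)) (hι.injective.2 ?_)
    · exact (congrArg TKK.plus ha).trans (map_zero ι.plus).symm
    · exact (congrArg TKK.minus ha).trans (map_zero ι.minus).symm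
  · change E a.der = 0
    rw [ha]
    refine IDer.ext_of_comp hι (fun x => ?_) (fun y => ?_)
    · rw [hE1]
      exact map_zero ι.plus
    · rw [hE2]
      exact map_zero ι.minus

end JordanPair

/-! ### Absorption of the elements of an overalgebra -/

section

variable {Φ : Type u} {L : Type v} [CommRing Φ] [LieRing L] [LieAlgebra Φ L]
  {M : Type w} [LieRing M] [LieAlgebra Φ M]

/-- The subalgebra of the elements of `L` which `m` maps into `L`. -/
def absorbedSubalgebra (f : L →ₗ⁅Φ⁆ M) (m : M) : LieSubalgebra Φ L where
  carrier := {x | ∃ z, ⁅m, f x⁆ = f z}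
  zero_mem' := ⟨0, by rw [map_zero, lie_zero]⟩
  add_mem' := by
    rintro x y ⟨a, ha⟩ ⟨b, hb⟩
    exact ⟨a + b, by rw [map_add, lie_add, ha, hb, map_add]⟩
  smul_mem' := by
    rintro r x ⟨a, ha⟩
    exact ⟨r • a, by rw [map_smul, lie_smul, ha, map_smul]⟩
  lie_mem' := by
    rintro x y ⟨a, ha⟩ ⟨b, hb⟩
    exact ⟨⁅a, y⁆ + ⁅x, b⁆, by
      rw [LieHom.map_lie, leibniz_lie, ha, hb, map_add, LieHom.map_lie, LieHom.map_lie]⟩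

theorem mem_absorbedSubalgebra {f : L →ₗ⁅Φ⁆ M} {m : M} {x : L} :
    x ∈ absorbedSubalgebra f m ↔ ∃ z, ⁅m, f x⁆ = f z := Iff.rfl

variable {P Z N : Submodule Φ L}

/-- Membership of [m, y] in L is not available for y in E ∩ N; only its brackets with P and N are
known to lie in L. Therefore E itself may fail to absorb m. In E² the part of degree -1 comes from
brackets [y, g] with y in E ∩ N and g in E ∩ Z, and these are handled by the Leibniz rule. -/
theorem Absorbed.of_degree_one (h : ThreeGraded P Z N) (hs : LieSemiprime Φ L)
    (hgen : ∀ B : LieSubalgebra Φ L, (∀ x ∈ P, x ∈ B) → (∀ x ∈ N, x ∈ B) → ∀ x, x ∈ B)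
    (E : EssentialIdeal Φ L) (hE : E.1.IsThreeGraded P Z N)
    (hEZ : ∀ B : Submodule Φ L, (∀ x ∈ E.1, x ∈ P → ∀ w ∈ N, ⁅x, w⁆ ∈ B) →
      (∀ v ∈ P, ∀ y ∈ E.1, y ∈ N → ⁅v, y⁆ ∈ B) → ∀ g ∈ E.1, g ∈ Z → g ∈ B)
    (f : L →ₗ⁅Φ⁆ M) (m : M) (hm : ∀ p ∈ P, ⁅m, f p⁆ = 0)
    (h1 : ∀ y ∈ E.1, y ∈ N → ∀ v ∈ P, ∃ z, ⁅⁅m, f y⁆, f v⁆ = f z)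
    (h2 : ∀ w ∈ N, ∀ x ∈ E.1, x ∈ P → ∃ z, ⁅⁅m, f w⁆, f x⁆ = f z)
    (h3 : ∀ y ∈ E.1, y ∈ N → ∀ w ∈ N, ∃ z, ⁅⁅f y, m⁆, f w⁆ = f z) : Absorbed f m := by
  have hP : ∀ p ∈ P, p ∈ absorbedSubalgebra f m := fun p hp => ⟨0, by rw [hm p hp, map_zero]⟩
  have hZ : ∀ g ∈ E.1, g ∈ Z → g ∈ absorbedSubalgebra f m := by
    refine hEZ (absorbedSubalgebra f m).toSubmodule (fun x hx hxP w hw => ?_)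
      (fun v hv y hy hyN => ?_)
    · obtain ⟨z, hz⟩ := h2 w hw x hx hxP
      refine ⟨-z, ?_⟩
      rw [LieHom.map_lie, leibniz_lie, hm x hxP, zero_lie, zero_add, ← lie_skew, hz, map_neg]
    · obtain ⟨z, hz⟩ := h1 y hy hyN v hv
      refine ⟨-z, ?_⟩
      rw [LieHom.map_lie, leibniz_lie, hm v hv, zero_lie, zero_add, ← lie_skew, hz, map_neg]
  have hNZ : ∀ y ∈ E.1, y ∈ N → ∀ g ∈ E.1, g ∈ Z → ⁅y, g⁆ ∈ absorbedSubalgebra f m := by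
    intro y hy hyN g hg hgZ
    -- The elements which [m, y] sends into L form a subalgebra. It contains P and N, which generate
    -- L.
    have hD : g ∈ absorbedSubalgebra f ⁅m, f y⁆ := hgen _ (fun v hv => h1 y hy hyN v hv)
      (fun w hw => by
        obtain ⟨z, hz⟩ := h3 y hy hyN w hw
        exact ⟨-z, by rw [← lie_skew m, neg_lie, hz, map_neg]⟩) g
    obtain ⟨a, ha⟩ := hD
    obtain ⟨b, hb⟩ := hZ g hg hgZ
    exact ⟨a + ⁅y, b⁆, by rw [LieHom.map_lie, leibniz_lie, ha, hb, map_add, LieHom.map_lie]⟩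
  refine ⟨E.sq hs, fun x hx => mem_absorbedSubalgebra.1 ?_⟩
  change x ∈ (⁅E.1, E.1⁆ : LieIdeal Φ L).toSubmodule at hx
  rw [LieSubmodule.lieIdeal_oper_eq_linear_span'] at hx
  refine (Submodule.span_le (p := (absorbedSubalgebra f m).toSubmodule)).2 ?_ hx
  rintro _ ⟨a, ha, b, hb, rfl⟩
  change ⁅a, b⁆ ∈ absorbedSubalgebra f m
  obtain ⟨p, hp, z, hz, n, hn, rfl⟩ := h.exists_add a
  obtain ⟨p', hp', z', hz', n', hn', rfl⟩ := h.exists_add b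
  obtain ⟨kp, kz, kn⟩ := hE p hp z hz n hn ha
  obtain ⟨kp', kz', kn'⟩ := hE p' hp' z' hz' n' hn' hb
  have e : ⁅p + z + n, p' + z' + n'⁆ = ⁅p + z, p' + z'⁆ + ⁅p + z, n'⁆ + ⁅n, p' + z'⁆ := by
    rw [add_lie (p + z), lie_add (p + z), lie_add n, h.lie_NN n hn n' hn', add_zero]
  have key {p z n : L} (hp : p ∈ P) (hz : z ∈ Z) (hn : n ∈ N) (kz : z ∈ E.1) (kn : n ∈ E.1) :
      ⁅n, p + z⁆ ∈ absorbedSubalgebra f m := by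
    rw [lie_add]
    exact add_mem (hZ _ (lie_mem_left Φ L E.1 _ _ kn) (ThreeGraded.lie_mem_swap h.lie_PN n hn p hp))
      (hNZ n kn hn z kz hz)
  rw [e]
  refine add_mem (add_mem ?_ ?_) (key hp' hz' hn kz' kn)
  · exact (absorbedSubalgebra f m).lie_mem (add_mem (hP p hp) (hZ z kz hz))
      (add_mem (hP p' hp') (hZ z' kz' hz'))
  · rw [← lie_skew]
    exact neg_mem (key hp hz hn' kz kn')

/-- If the listed triple products vanish, then [q, y] is an element of Z acting as zero on P and N,
so it is zero for y in I ∩ N. For g in I ∩ Z, the element [q, g] of P then commutes with I ∩ N and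
vanishes too. -/
theorem MaxQuot.eq_zero_of_degree_one [Invertible (2 : Φ)] (h : NondegThreeGraded P Z N)
    (h6 : IsUnit (6 : Φ)) {hs : LieSemiprime Φ L} (I : EssentialIdeal Φ L)
    (hI : I.1.IsThreeGraded P Z N) {q : MaxQuot hs}
    (hP : ∀ x ∈ I.1, x ∈ P → ⁅q, ofHom hs x⁆ = 0)
    (hZ : ∀ x ∈ I.1, x ∈ Z → ∃ z ∈ P, ⁅q, ofHom hs x⁆ = ofHom hs z)
    (hN : ∀ x ∈ I.1, x ∈ N → ∃ z ∈ Z, ⁅q, ofHom hs x⁆ = ofHom hs z)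
    (h1 : ∀ y ∈ I.1, y ∈ N → ∀ v ∈ P, ⁅⁅q, ofHom hs y⁆, ofHom hs v⁆ = 0)
    (h2 : ∀ y ∈ I.1, y ∈ N → ∀ w ∈ N, ⁅⁅ofHom hs y, q⁆, ofHom hs w⁆ = 0) : q = 0 := by
  have hN0 : ∀ y ∈ I.1, y ∈ N → ⁅q, ofHom hs y⁆ = 0 := by
    intro y hy hyN
    obtain ⟨z, hz, he⟩ := hN y hy hyN
    have : z = 0 := h.faithful z hz (fun v hv => ofHom_injective (h := hs) (by
        rw [LieHom.map_lie, ← he, h1 y hy hyN v hv, map_zero]))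
      (fun w hw => ofHom_injective (h := hs) (by
        rw [LieHom.map_lie, ← he, ← lie_skew q, neg_lie, h2 y hy hyN w hw, map_zero, neg_zero]))
    rw [he, this, map_zero]
  have hZ0 : ∀ g ∈ I.1, g ∈ Z → ⁅q, ofHom hs g⁆ = 0 := by
    intro g hg hgZ
    obtain ⟨z, hz, he⟩ := hZ g hg hgZ
    have : z = 0 := h.eq_zero_of_lie_neg_part hs h6 I hI hz fun y hy hyN =>
      ofHom_injective (h := hs) (by
        rw [LieHom.map_lie, ← he, lie_lie, ← LieHom.map_lie, hN0 y hy hyN,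
          hN0 _ (lie_mem_right Φ L I.1 _ _ hy) (h.lie_ZN g hgZ y hyN), lie_zero, sub_zero,
          map_zero])
    rw [he, this, map_zero]
  refine eq_zero_of_lie I fun x hx => ?_
  obtain ⟨p, hp, z, hz, n, hn, rfl⟩ := h.exists_add x
  obtain ⟨k1, k2, k3⟩ := hI p hp z hz n hn hx
  rw [map_add, map_add, lie_add, lie_add, hP p k1 hp, hZ0 z k2 hz, hN0 n k3 hn, add_zero, add_zero]

end

/-! ### Ideals of a Jordan pair and of its Tits-Kantor-Koecher algebra -/

namespace JordanPair

variable {Φ : Type u} [CommRing Φ] [Invertible (2 : Φ)]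
  {Vp : Type v₁} {Vm : Type v₂} [AddCommGroup Vp] [Module Φ Vp] [AddCommGroup Vm] [Module Φ Vm]
  {V : JordanPair Φ Vp Vm}

theorem half_mem {M : Type*} [AddCommGroup M] [Module Φ M] {S : Submodule Φ M} {x : M}
    (h : (2 : Φ) • x ∈ S) : x ∈ S := by
  have := S.smul_mem (⅟(2 : Φ)) h
  rwa [smul_smul, invOf_mul_self, one_smul] at this

/-- The inner derivations in the ideal of `TKK(V)` generated by an ideal of `V`. -/
def PairIdeal.ider (J : V.PairIdeal) : Submodule Φ (Module.End Φ Vp × Module.End Φ Vm) :=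
  Submodule.span Φ {d | ∃ x y, (x ∈ J.plus ∨ y ∈ J.minus) ∧ V.innerDer x y = d}

theorem PairIdeal.innerDer_mem_ider (J : V.PairIdeal) {x : Vp} {y : Vm}
    (h : x ∈ J.plus ∨ y ∈ J.minus) : V.innerDer x y ∈ J.ider :=
  Submodule.subset_span ⟨x, y, h, rfl⟩

theorem PairIdeal.ider_map (J : V.PairIdeal) {d : Module.End Φ Vp × Module.End Φ Vm}
    (hd : d ∈ J.ider) : (∀ x, d.1 x ∈ J.plus) ∧ ∀ y, d.2 y ∈ J.minus := by
  induction hd using Submodule.span_induction with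
  | mem d h =>
    obtain ⟨x, y, h | h, rfl⟩ := h
    · exact ⟨fun z => J.Dp_left h y z, fun z => neg_mem (J.Dm_mid y h z)⟩
    · exact ⟨fun z => J.Dp_mid x h z, fun z => neg_mem (J.Dm_left h x z)⟩
  | zero => exact ⟨fun _ => zero_mem _, fun _ => zero_mem _⟩
  | add d e _ _ hd he =>
    exact ⟨fun x => add_mem (hd.1 x) (he.1 x), fun x => add_mem (hd.2 x) (he.2 x)⟩
  | smul r d _ hd => exact ⟨fun x => Submodule.smul_mem _ r (hd.1 x),
      fun x => Submodule.smul_mem _ r (hd.2 x)⟩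

theorem PairIdeal.map_mem_of_ider (J : V.PairIdeal) {d : Module.End Φ Vp × Module.End Φ Vm}
    (hd : d ∈ V.IDer) : (∀ x ∈ J.plus, d.1 x ∈ J.plus) ∧ ∀ y ∈ J.minus, d.2 y ∈ J.minus := by
  induction hd using Submodule.span_induction with
  | mem d h =>
    obtain ⟨x, y, rfl⟩ := h
    exact ⟨fun z hz => J.Dp_mem x y z hz, fun z hz => neg_mem (J.Dm_mem y x z hz)⟩
  | zero => exact ⟨fun _ _ => zero_mem _, fun _ _ => zero_mem _⟩
  | add d e _ _ hd he => exact ⟨fun x hx => add_mem (hd.1 x hx) (he.1 x hx),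
      fun x hx => add_mem (hd.2 x hx) (he.2 x hx)⟩
  | smul r d _ hd => exact ⟨fun x hx => Submodule.smul_mem _ r (hd.1 x hx),
      fun x hx => Submodule.smul_mem _ r (hd.2 x hx)⟩

theorem PairIdeal.commutator_mem_ider (J : V.PairIdeal)
    {d e : Module.End Φ Vp × Module.End Φ Vm} (hd : d ∈ V.IDer) (he : e ∈ J.ider) :
    d * e - e * d ∈ J.ider := by
  have hd' := V.isDerivation_of_mem hd
  have hm := J.map_mem_of_ider hd
  induction he using Submodule.span_induction with
  | mem e h =>
    obtain ⟨x, y, h, rfl⟩ := h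
    rw [V.commutator_innerDer hd']
    exact add_mem (J.innerDer_mem_ider (h.imp_left (hm.1 x)))
      (J.innerDer_mem_ider (h.imp_right (hm.2 y)))
  | zero => simp
  | add e f _ _ he hf =>
    have : d * (e + f) - (e + f) * d = (d * e - e * d) + (d * f - f * d) := by
      noncomm_ring
    rw [this]
    exact add_mem he hf
  | smul r e _ he =>
    have : d * (r • e) - (r • e) * d = r • (d * e - e * d) := by
      rw [mul_smul_comm, smul_mul_assoc, smul_sub]
    rw [this]
    exact Submodule.smul_mem _ _ he

/-- The ideal of `TKK(V)` generated by an ideal of `V`. -/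
def PairIdeal.tkk (J : V.PairIdeal) : LieIdeal Φ V.TKK where
  carrier := {a | a.plus ∈ J.plus ∧ a.der.1 ∈ J.ider ∧ a.minus ∈ J.minus}
  zero_mem' := ⟨zero_mem _, zero_mem _, zero_mem _⟩
  add_mem' ha hb := ⟨add_mem ha.1 hb.1, add_mem ha.2.1 hb.2.1, add_mem ha.2.2 hb.2.2⟩
  smul_mem' r _ ha := ⟨Submodule.smul_mem _ r ha.1, Submodule.smul_mem _ r ha.2.1,
    Submodule.smul_mem _ r ha.2.2⟩
  lie_mem {b a} ha := by
    obtain ⟨h1, h2, h3⟩ := ha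
    refine ⟨?_, ?_, ?_⟩
    · exact sub_mem ((J.map_mem_of_ider b.der.2).1 _ h1) ((J.ider_map h2).1 _)
    · exact sub_mem (add_mem (J.commutator_mem_ider b.der.2 h2)
        (J.innerDer_mem_ider (Or.inr h3))) (J.innerDer_mem_ider (Or.inl h1))
    · exact sub_mem ((J.map_mem_of_ider b.der.2).2 _ h3) ((J.ider_map h2).2 _)

theorem PairIdeal.mem_tkk {J : V.PairIdeal} {a : V.TKK} :
    a ∈ J.tkk ↔ a.plus ∈ J.plus ∧ a.der.1 ∈ J.ider ∧ a.minus ∈ J.minus := Iff.rfl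

theorem PairIdeal.tkk_isThreeGraded (J : V.PairIdeal) :
    J.tkk.IsThreeGraded (TKK.grading V 1) (TKK.grading V 0) (TKK.grading V (-1)) := by
  intro p hp z hz n hn h
  obtain ⟨x, rfl⟩ := TKK.mem_grading_one.1 hp
  obtain ⟨g, rfl⟩ := TKK.mem_grading_zero.1 hz
  obtain ⟨y, rfl⟩ := TKK.mem_grading_neg_one.1 hn
  simp only [mem_tkk, TKK.add_fst, TKK.add_mid, TKK.add_lst, TKK.ofPlus, TKK.ofDer, TKK.ofMinus,
    add_zero, zero_add, ZeroMemClass.coe_zero, zero_mem, true_and, and_true] at h ⊢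
  exact h

/-- An ideal of `V` with zero annihilator generates an essential ideal of `TKK(V)`. -/
def PairIdeal.tkkEssential (h6 : IsUnit (6 : Φ)) (hV : V.StronglyNondegenerate) (J : V.PairIdeal)
    (hJ : J.AnnEqZero) : EssentialIdeal Φ V.TKK :=
  ⟨J.tkk, fun K hK h0 => by
    -- If the two ideals meet in zero they commute. A nonzero homogeneous element of K then lies in
    -- V⁺ or V⁻ and annihilates J.
    have key (a b : V.TKK) (ha : a ∈ J.tkk) (hb : b ∈ K) : ⁅b, a⁆ = 0 := by
      have : ⁅b, a⁆ ∈ J.tkk ⊓ K := ⟨lie_mem_right Φ _ J.tkk _ _ ha, lie_mem_left Φ _ K _ _ hb⟩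
      rw [h0] at this
      exact (LieSubmodule.mem_bot _).1 this
    have hp (x : Vp) (hx : x ∈ J.plus) : TKK.ofPlus V x ∈ J.tkk := ⟨hx, zero_mem _, zero_mem _⟩
    have hm (y : Vm) (hy : y ∈ J.minus) : TKK.ofMinus V y ∈ J.tkk :=
      ⟨zero_mem _, zero_mem _, hy⟩
    rcases (TKK.nondegThreeGraded hV).exists_homogeneous h6 hK with
      ⟨z, hzK, hz, hne⟩ | ⟨z, hzK, hz, hne⟩
    · obtain ⟨z, rfl⟩ := TKK.mem_grading_one.1 hz
      have : z ∈ V.annPlus J.plus J.minus := by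
        refine ⟨fun y hy v => TKK.ofPlus_injective (V := V) ?_,
          fun w x hx => TKK.ofPlus_injective (V := V) ?_,
          fun w y hy => TKK.ofMinus_injective (V := V) ?_⟩
        · rw [← TKK.lie_triple_plus, key _ _ (hm y hy) hzK, zero_lie]
          rfl
        · rw [← TKK.lie_triple_plus, key _ _ (hp x hx) (lie_mem_left Φ _ K _ _ hzK)]
          rfl
        · rw [← TKK.lie_triple_minus, key _ _ (hm y hy) (lie_mem_right Φ _ K _ _ hzK)]
          rfl
      rw [hJ.1, Set.mem_singleton_iff] at this
      exact hne (by rw [this]; rfl)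
    · obtain ⟨z, rfl⟩ := TKK.mem_grading_neg_one.1 hz
      have : z ∈ V.annMinus J.plus J.minus := by
        refine ⟨fun y hy v => TKK.ofMinus_injective (V := V) ?_,
          fun w x hx => TKK.ofMinus_injective (V := V) ?_,
          fun w y hy => TKK.ofPlus_injective (V := V) ?_⟩
        · exact (TKK.lie_triple_minus _ _ _).symm.trans
            (by rw [key _ _ (hp y hy) hzK, zero_lie]; rfl)
        · exact (TKK.lie_triple_minus _ _ _).symm.trans
            (by rw [key _ _ (hm x hx) (lie_mem_left Φ _ K _ _ hzK)]; rfl)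
        · exact (TKK.lie_triple_plus _ _ _).symm.trans
            (by rw [key _ _ (hp y hy) (lie_mem_right Φ _ K _ _ hzK)]; rfl)
      rw [hJ.2, Set.mem_singleton_iff] at this
      exact hne (by rw [this]; rfl)⟩

/-- Carries span arguments from pairs of endomorphisms to TKK(V). It serves both IDer(V) and the
inner derivations attached to an ideal. -/
theorem TKK.ofDer_mem_of_span {S : Set (Module.End Φ Vp × Module.End Φ Vm)} {B : Submodule Φ V.TKK}
    (hS : ∀ d ∈ S, ∃ x y, V.innerDer x y = d ∧ ⁅ofPlus V x, ofMinus V y⁆ ∈ B) (g : V.IDer)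
    (hg : g.1 ∈ Submodule.span Φ S) : ofDer V g ∈ B := by
  have key : ∀ d ∈ Submodule.span Φ S, ∃ hd : d ∈ V.IDer, ofDer V ⟨d, hd⟩ ∈ B := by
    intro d hd
    induction hd using Submodule.span_induction with
    | mem d hd =>
      obtain ⟨x, y, rfl, h⟩ := hS d hd
      refine ⟨V.innerDer_mem x y, ?_⟩
      rwa [lie_plus_minus] at h
    | zero => exact ⟨zero_mem _, B.zero_mem⟩
    | add d e _ _ hd he =>
      obtain ⟨hd, hd'⟩ := hd
      obtain ⟨he, he'⟩ := he
      refine ⟨add_mem hd he, ?_⟩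
      have := B.add_mem hd' he'
      rwa [show ofDer V ⟨d, hd⟩ + ofDer V ⟨e, he⟩ = ofDer V ⟨d + e, add_mem hd he⟩ from
        (map_add (ofDerₗ V) _ _).symm] at this
    | smul r d _ hd =>
      obtain ⟨hd, hd'⟩ := hd
      refine ⟨Submodule.smul_mem _ r hd, ?_⟩
      have := B.smul_mem r hd'
      rwa [show r • ofDer V ⟨d, hd⟩ = ofDer V ⟨r • d, Submodule.smul_mem _ r hd⟩ from
        (map_smul (ofDerₗ V) _ _).symm] at this
  exact (key g.1 hg).2

theorem TKK.mem_of_generators (B : LieSubalgebra Φ V.TKK) (hp : ∀ x, ofPlus V x ∈ B)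
    (hm : ∀ y, ofMinus V y ∈ B) (a : V.TKK) : a ∈ B := by
  rw [eq_add a]
  refine add_mem (add_mem (hp _) ?_) (hm _)
  refine ofDer_mem_of_span (B := B.toSubmodule) (fun d hd => ?_) a.der a.der.2
  obtain ⟨x, y, rfl⟩ := hd
  exact ⟨x, y, rfl, B.lie_mem (hp x) (hm y)⟩

end JordanPair

/-! ### The pair of `𝔐`-quotients in the maximal algebra of quotients -/

section

variable {Φ : Type u} {L : Type v} [CommRing Φ] [LieRing L] [LieAlgebra Φ L]
  {P Z N : Submodule Φ L}

/-- Since [q, x] = 0 for x in I ∩ P, the product [[q, w], x] equals [q, [w, x]] with [w, x] in I ∩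
Z. The other inclusions use [q, y] in Z, and nontriviality is `eq_zero_of_degree_one`. -/
theorem MaxQuot.absorbs_degree_one [Invertible (2 : Φ)] (h : NondegThreeGraded P Z N)
    (h6 : IsUnit (6 : Φ)) {hs : LieSemiprime Φ L} (I : EssentialIdeal Φ L)
    (hI : I.1.IsThreeGraded P Z N) {q : MaxQuot hs} (hP : ∀ x ∈ I.1, x ∈ P → ⁅q, ofHom hs x⁆ = 0)
    (hZ : ∀ x ∈ I.1, x ∈ Z → ∃ z ∈ P, ⁅q, ofHom hs x⁆ = ofHom hs z)
    (hN : ∀ x ∈ I.1, x ∈ N → ∃ z ∈ Z, ⁅q, ofHom hs x⁆ = ofHom hs z) :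
    (∀ y ∈ I.1, y ∈ N → ∀ v ∈ P, ∃ z ∈ P, ⁅⁅q, ofHom hs y⁆, ofHom hs v⁆ = ofHom hs z) ∧
    (∀ w ∈ N, ∀ x ∈ I.1, x ∈ P → ∃ z ∈ P, ⁅⁅q, ofHom hs w⁆, ofHom hs x⁆ = ofHom hs z) ∧
    (∀ y ∈ I.1, y ∈ N → ∀ w ∈ N, ∃ z ∈ N, ⁅⁅ofHom hs y, q⁆, ofHom hs w⁆ = ofHom hs z) ∧
    (q ≠ 0 → (∃ y ∈ I.1, y ∈ N ∧ ∃ v ∈ P, ⁅⁅q, ofHom hs y⁆, ofHom hs v⁆ ≠ 0) ∨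
      ∃ y ∈ I.1, y ∈ N ∧ ∃ w ∈ N, ⁅⁅ofHom hs y, q⁆, ofHom hs w⁆ ≠ 0) := by
  refine ⟨fun y hy hyN v hv => ?_, fun w hw x hx hxP => ?_, fun y hy hyN w hw => ?_,
    fun hq => ?_⟩
  · obtain ⟨z, hz, he⟩ := hN y hy hyN
    exact ⟨_, h.lie_ZP z hz v hv, by rw [he, LieHom.map_lie]⟩
  · obtain ⟨z, hz, he⟩ := hZ _ (lie_mem_right Φ L I.1 w x hx)
      (ThreeGraded.lie_mem_swap h.lie_PN w hw x hxP)
    exact ⟨z, hz, by rw [lie_lie, hP x hx hxP, lie_zero, sub_zero, ← LieHom.map_lie, he]⟩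
  · obtain ⟨z, hz, he⟩ := hN y hy hyN
    exact ⟨_, neg_mem (h.lie_ZN z hz w hw), by
      rw [← lie_skew (ofHom hs y), he, neg_lie, map_neg, LieHom.map_lie]⟩
  · by_contra! hc
    exact hq (eq_zero_of_degree_one h h6 I hI hP hZ hN hc.1 hc.2)

variable {𝓛 : ℤ → Submodule Φ L} {hs : LieSemiprime Φ L}

theorem MaxQuot.exists_of_mem_grading_one (h : IsThreeGrading 𝓛) {q : MaxQuot hs}
    (hq : q ∈ grading hs 𝓛 1) : ∃ I : EssentialIdeal Φ L,
      I.1.IsThreeGraded (𝓛 1) (𝓛 0) (𝓛 (-1)) ∧ (∀ x ∈ I.1, x ∈ 𝓛 1 → ⁅q, ofHom hs x⁆ = 0) ∧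
      (∀ x ∈ I.1, x ∈ 𝓛 0 → ∃ z ∈ 𝓛 1, ⁅q, ofHom hs x⁆ = ofHom hs z) ∧
      (∀ x ∈ I.1, x ∈ 𝓛 (-1) → ∃ z ∈ 𝓛 0, ⁅q, ofHom hs x⁆ = ofHom hs z) := by
  obtain ⟨I, hI, hqI⟩ := exists_of_mem_grading hq
  refine ⟨I, hI.isThreeGraded, fun x hx hx1 => ?_, hqI 0, hqI (-1)⟩
  obtain ⟨z, hz, he⟩ := hqI 1 x hx hx1
  rw [h.eq_bot _ (by decide) (by decide) (by decide), Submodule.mem_bot] at hz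
  rw [he, hz, map_zero]

theorem MaxQuot.exists_of_mem_grading_neg_one (h : IsThreeGrading 𝓛) {q : MaxQuot hs}
    (hq : q ∈ grading hs 𝓛 (-1)) : ∃ I : EssentialIdeal Φ L,
      I.1.IsThreeGraded (𝓛 1) (𝓛 0) (𝓛 (-1)) ∧
      (∀ x ∈ I.1, x ∈ 𝓛 (-1) → ⁅q, ofHom hs x⁆ = 0) ∧
      (∀ x ∈ I.1, x ∈ 𝓛 0 → ∃ z ∈ 𝓛 (-1), ⁅q, ofHom hs x⁆ = ofHom hs z) ∧
      (∀ x ∈ I.1, x ∈ 𝓛 1 → ∃ z ∈ 𝓛 0, ⁅q, ofHom hs x⁆ = ofHom hs z) := by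
  obtain ⟨I, hI, hqI⟩ := exists_of_mem_grading hq
  refine ⟨I, hI.isThreeGraded, fun x hx hx1 => ?_, hqI 0, hqI 1⟩
  obtain ⟨z, hz, he⟩ := hqI (-1) x hx hx1
  rw [h.eq_bot _ (by decide) (by decide) (by decide), Submodule.mem_bot] at hz
  rw [he, hz, map_zero]

end

namespace JordanPair

variable {Φ : Type u} [CommRing Φ] [Invertible (2 : Φ)]
  {Vp : Type v₁} {Vm : Type v₂} [AddCommGroup Vp] [Module Φ Vp] [AddCommGroup Vm] [Module Φ Vm]
  {Wp : Type w₁} {Wm : Type w₂} [AddCommGroup Wp] [Module Φ Wp] [AddCommGroup Wm] [Module Φ Wm]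
  {Up : Type a₁} {Um : Type a₂} [AddCommGroup Up] [Module Φ Up] [AddCommGroup Um] [Module Φ Um]
  {V : JordanPair Φ Vp Vm} {W : JordanPair Φ Wp Wm} {U : JordanPair Φ Up Um}

theorem Qp_Qp (V : JordanPair Φ Vp Vm) (x : Vp) (y z : Vm) :
    V.Qp (V.Qp x y) z = V.Qp x (V.Qm y (V.Qp x z)) := by
  have h := LinearMap.congr_fun ((V.identities_plus Φ).Q_Q (1 ⊗ₜ x) (1 ⊗ₜ y)) (1 ⊗ₜ z)
  simp only [LinearMap.comp_apply, QuadraticMap.scalarExt_tmul, mul_one] at h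
  exact tmul_inj h

/-- For x in I⁺ the fundamental formula gives Q_{Q_x y} z = Q_x (Q_y Q_x z) with Q_y Q_x z in I⁻, so
this is zero. Strong nondegeneracy is then used for Q_x y and for x. -/
theorem StronglyNondegenerate.isSemiprime (hV : V.StronglyNondegenerate) : V.IsSemiprime := by
  refine fun I h1 h2 => ⟨(Submodule.eq_bot_iff _).2 fun x hx => hV.plus x (LinearMap.ext fun y =>
    hV.plus _ (LinearMap.ext fun z => ?_)), (Submodule.eq_bot_iff _).2 fun y hy =>
    hV.minus y (LinearMap.ext fun x => hV.minus _ (LinearMap.ext fun z => ?_))⟩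
  · rw [Qp_Qp, h1 x hx _ (I.Qm_right y _ (I.Qp_left x hx z))]
    rfl
  · rw [show V.Qm (V.Qm y x) z = _ from V.op.Qp_Qp y x z]
    exact h2 y hy _ (I.Qp_right x _ (I.Qm_left y hy z))

/-- The ideal of `V` obtained by intersecting an ideal of `TKK(V)` with `V⁺` and `V⁻`. -/
def PairIdeal.ofLieIdeal (I : LieIdeal Φ V.TKK) : V.PairIdeal where
  plus := I.toSubmodule.comap (TKK.ofPlusₗ V)
  minus := I.toSubmodule.comap (TKK.ofMinusₗ V)
  Qp_left x hx y := half_mem (S := I.toSubmodule.comap (TKK.ofPlusₗ V)) (by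
    rw [← V.Dp_self]
    change TKK.ofPlus V _ ∈ I
    rw [← TKK.lie_triple_plus]
    exact lie_mem_right Φ _ I _ _ hx)
  Qp_right x y hy := half_mem (S := I.toSubmodule.comap (TKK.ofPlusₗ V)) (by
    rw [← V.Dp_self]
    change TKK.ofPlus V _ ∈ I
    rw [← TKK.lie_triple_plus]
    exact lie_mem_left Φ _ I _ _ (lie_mem_right Φ _ I _ _ hy))
  Dp_mem x y z hz := by
    change TKK.ofPlus V _ ∈ I
    rw [← TKK.lie_triple_plus]
    exact lie_mem_right Φ _ I _ _ hz
  Qm_left y hy x := half_mem (S := I.toSubmodule.comap (TKK.ofMinusₗ V)) (by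
    rw [← show V.Dm y x y = (2 : Φ) • V.Qm y x from V.op.Dp_self y x]
    change TKK.ofMinus V _ ∈ I
    rw [← TKK.lie_triple_minus]
    exact lie_mem_right Φ _ I _ _ hy)
  Qm_right y x hx := half_mem (S := I.toSubmodule.comap (TKK.ofMinusₗ V)) (by
    rw [← show V.Dm y x y = (2 : Φ) • V.Qm y x from V.op.Dp_self y x]
    change TKK.ofMinus V _ ∈ I
    rw [← TKK.lie_triple_minus]
    exact lie_mem_left Φ _ I _ _ (lie_mem_right Φ _ I _ _ hx))
  Dm_mem y x z hz := by
    change TKK.ofMinus V _ ∈ I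
    rw [← TKK.lie_triple_minus]
    exact lie_mem_right Φ _ I _ _ hz

theorem TKK.lie_plus_minus_eq_zero {x : Vp} {y : Vm} (h1 : ∀ v, V.Dp x y v = 0)
    (h2 : ∀ w, V.Dm w x y = 0) : ⁅ofPlus V x, ofMinus V y⁆ = 0 := by
  rw [lie_plus_minus, eq_zero_of_lie_der (V.inner x y)]
  · rfl
  · intro v
    rw [lie_der_plus]
    exact congrArg (ofPlus V) (h1 v)
  · intro w
    rw [lie_der_minus]
    refine congrArg (ofMinus V) (neg_eq_zero.2 ?_)
    rw [V.Dm_symm, h2]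

/-- For z in the annihilator and y in the opposite component of the ideal, the annihilator
conditions say that δ(z, y) = 0, that is, [z, y] = 0 in TKK(V). Then `eq_zero_of_lie_neg_part`
applies. -/
theorem PairIdeal.ofLieIdeal_annEqZero (h6 : IsUnit (6 : Φ)) (hV : V.StronglyNondegenerate)
    (I : EssentialIdeal Φ V.TKK)
    (hI : I.1.IsThreeGraded (TKK.grading V 1) (TKK.grading V 0) (TKK.grading V (-1))) :
    (ofLieIdeal I.1).AnnEqZero := by
  have hn := TKK.nondegThreeGraded hV
  refine ⟨Set.eq_singleton_iff_unique_mem.2 ⟨?_, fun z hz => ?_⟩,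
    Set.eq_singleton_iff_unique_mem.2 ⟨?_, fun z hz => ?_⟩⟩
  · exact ⟨fun y _ v => by simp, fun y x _ => by simp, fun w y _ => by simp⟩
  · refine TKK.ofPlus_injective (V := V) (hn.eq_zero_of_lie_neg_part hV.tkk_semiprime h6 I hI
      (TKK.mem_grading_one.2 ⟨z, rfl⟩) fun y hy hyN => ?_)
    obtain ⟨y, rfl⟩ := TKK.mem_grading_neg_one.1 hyN
    exact TKK.lie_plus_minus_eq_zero (hz.1 y hy) fun w => hz.2.2 w y hy
  · exact ⟨fun y _ v => by simp, fun y x _ => by simp, fun w y _ => by simp⟩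
  · refine TKK.ofMinus_injective (V := V) (hn.symm.eq_zero_of_lie_neg_part hV.tkk_semiprime h6 I
      hI.symm (TKK.mem_grading_neg_one.2 ⟨z, rfl⟩) fun x hx hxP => ?_)
    obtain ⟨x, rfl⟩ := TKK.mem_grading_one.1 hxP
    rw [← lie_skew, TKK.lie_plus_minus_eq_zero, neg_zero]
    · intro v
      rw [V.Dp_symm]
      exact hz.2.2 v x hx
    · intro w
      rw [V.Dm_symm]
      exact hz.1 x hx w

/-- A homomorphism over `V` from a pair of `𝔐`-quotients to an extension of `V` is injective. -/
theorem Hom.injective_of_comp {ι : V.Hom W} (hι : ι.Injective) {j : V.Hom U} (hj : j.IsMQuotient)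
    {f : U.Hom W} (hfp : ∀ x, f.plus (j.plus x) = ι.plus x)
    (hfm : ∀ y, f.minus (j.minus y) = ι.minus y) : f.Injective := by
  have zp (z : Vp) (hz : f.plus (j.plus z) = 0) : j.plus z = 0 := by
    rw [hfp] at hz
    rw [hι.1 (hz.trans (map_zero ι.plus).symm), map_zero]
  have zm (z : Vm) (hz : f.minus (j.minus z) = 0) : j.minus z = 0 := by
    rw [hfm] at hz
    rw [hι.2 (hz.trans (map_zero ι.minus).symm), map_zero]
  refine ⟨(injective_iff_map_eq_zero _).2 fun q hq => ?_,
    (injective_iff_map_eq_zero _).2 fun q hq => ?_⟩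
  -- A nonzero product of q with elements of V lies in V, where f is injective, yet f sends it to a
  -- product with f q = 0.
  · by_contra hne
    obtain ⟨J, -, a1, a2, a3, ⟨y, hy, v, h⟩ | ⟨w, x, hx, h⟩ | ⟨y, hy, w, h⟩⟩ :=
      hj.absorbs_plus q hne
    · obtain ⟨z, hz⟩ := a1 y hy v
      exact h (by rw [← hz, zp z (by rw [hz, f.map_Dp, hq]; simp)])
    · obtain ⟨z, hz⟩ := a2 w x hx
      exact h (by rw [← hz, zp z (by rw [hz, f.map_Dp, hq]; simp)])
    · obtain ⟨z, hz⟩ := a3 y hy w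
      exact h (by rw [← hz, zm z (by rw [hz, f.map_Dm, hq]; simp)])
  · by_contra hne
    obtain ⟨J, -, a1, a2, a3, ⟨y, hy, v, h⟩ | ⟨w, x, hx, h⟩ | ⟨y, hy, w, h⟩⟩ :=
      hj.absorbs_minus q hne
    · obtain ⟨z, hz⟩ := a1 y hy v
      exact h (hz.symm.trans (zm z ((congrArg f.minus hz).trans
        ((f.map_Dm _ _ _).trans (by rw [hq]; simp)))))
    · obtain ⟨z, hz⟩ := a2 w x hx
      exact h (hz.symm.trans (zm z ((congrArg f.minus hz).trans
        ((f.map_Dm _ _ _).trans (by rw [hq]; simp)))))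
    · obtain ⟨z, hz⟩ := a3 y hy w
      exact h (hz.symm.trans (zp z ((congrArg f.plus hz).trans
        ((f.map_Dp _ _ _).trans (by rw [hq]; simp)))))

/-! ### The components of degree 1 and -1 of Q_m(TKK(V)) as a pair of 𝔐-quotients. -/

namespace TKK

theorem maxQuot_isThreeGrading (h6 : IsUnit (6 : Φ)) (hV : V.StronglyNondegenerate) :
    IsThreeGrading (MaxQuot.grading hV.tkk_semiprime (grading V)) :=
  MaxQuot.isThreeGrading (isThreeGrading V) (nondegThreeGraded hV) h6

/-- The Jordan pair of the components of degree `1` and `-1` of `Q_m(TKK(V))`. -/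
def quotPair (h6 : IsUnit (6 : Φ)) (hV : V.StronglyNondegenerate) :
    JordanPair Φ (MaxQuot.grading hV.tkk_semiprime (grading V) 1)
      (MaxQuot.grading hV.tkk_semiprime (grading V) (-1)) :=
  (maxQuot_isThreeGrading h6 hV).threeGraded.pair h6

theorem quotPair_isAssociatedPair (h6 : IsUnit (6 : Φ)) (hV : V.StronglyNondegenerate) :
    IsAssociatedPair (MaxQuot.grading hV.tkk_semiprime (grading V)) (quotPair h6 hV) where
  plus := (maxQuot_isThreeGrading h6 hV).threeGraded.pair_Dp h6
  minus := (maxQuot_isThreeGrading h6 hV).threeGraded.pair_Dm h6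

theorem quotPair_Dp (h6 : IsUnit (6 : Φ)) (hV : V.StronglyNondegenerate)
    (x : MaxQuot.grading hV.tkk_semiprime (grading V) 1)
    (y : MaxQuot.grading hV.tkk_semiprime (grading V) (-1))
    (z : MaxQuot.grading hV.tkk_semiprime (grading V) 1) :
    ((quotPair h6 hV).Dp x y z : MaxQuot hV.tkk_semiprime) =
      ⁅⁅(x : MaxQuot hV.tkk_semiprime), (y : MaxQuot hV.tkk_semiprime)⁆,
        (z : MaxQuot hV.tkk_semiprime)⁆ := (quotPair_isAssociatedPair h6 hV).plus x y z

theorem quotPair_Dm (h6 : IsUnit (6 : Φ)) (hV : V.StronglyNondegenerate)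
    (x : MaxQuot.grading hV.tkk_semiprime (grading V) (-1))
    (y : MaxQuot.grading hV.tkk_semiprime (grading V) 1)
    (z : MaxQuot.grading hV.tkk_semiprime (grading V) (-1)) :
    ((quotPair h6 hV).Dm x y z : MaxQuot hV.tkk_semiprime) =
      ⁅⁅(x : MaxQuot hV.tkk_semiprime), (y : MaxQuot hV.tkk_semiprime)⁆,
        (z : MaxQuot hV.tkk_semiprime)⁆ := (quotPair_isAssociatedPair h6 hV).minus x y z

/-- A homomorphism of Lie algebras `TKK(U) → Q_m(TKK(V))` preserving degrees `1` and `-1` restricts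
to a homomorphism of Jordan pairs. -/
def homOfLieHom (h6 : IsUnit (6 : Φ)) (hV : V.StronglyNondegenerate)
    (φ : U.TKK →ₗ⁅Φ⁆ MaxQuot hV.tkk_semiprime)
    (hp : ∀ x, φ (ofPlus U x) ∈ MaxQuot.grading hV.tkk_semiprime (grading V) 1)
    (hm : ∀ y, φ (ofMinus U y) ∈ MaxQuot.grading hV.tkk_semiprime (grading V) (-1)) :
    U.Hom (quotPair h6 hV) :=
  .ofTriple (((φ : U.TKK →ₗ[Φ] MaxQuot hV.tkk_semiprime) ∘ₗ ofPlusₗ U).codRestrict _ hp)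
    (((φ : U.TKK →ₗ[Φ] MaxQuot hV.tkk_semiprime) ∘ₗ ofMinusₗ U).codRestrict _ hm)
    (fun x y => Subtype.ext (by
      rw [quotPair_Dp]
      change φ (ofPlus U (U.Dp x y x)) = ⁅⁅φ (ofPlus U x), φ (ofMinus U y)⁆, φ (ofPlus U x)⁆
      rw [← lie_triple_plus, LieHom.map_lie, LieHom.map_lie]))
    (fun x y => Subtype.ext (by
      rw [quotPair_Dm]
      change φ (ofMinus U (U.Dm x y x)) = ⁅⁅φ (ofMinus U x), φ (ofPlus U y)⁆, φ (ofMinus U x)⁆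
      rw [← lie_triple_minus, LieHom.map_lie, LieHom.map_lie]))

/-- The embedding of `V` in the pair of the components of degree `1` and `-1` of `Q_m(TKK(V))`. -/
def quotHom (h6 : IsUnit (6 : Φ)) (hV : V.StronglyNondegenerate) : V.Hom (quotPair h6 hV) :=
  homOfLieHom h6 hV (MaxQuot.ofHom hV.tkk_semiprime)
    (fun x => MaxQuot.ofHom_mem_grading (isThreeGrading V) (mem_grading_one.2 ⟨x, rfl⟩))
    (fun y => MaxQuot.ofHom_mem_grading (isThreeGrading V) (mem_grading_neg_one.2 ⟨y, rfl⟩))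

theorem quotHom_plus (h6 : IsUnit (6 : Φ)) (hV : V.StronglyNondegenerate)
    (x : Vp) : ((quotHom h6 hV).plus x : MaxQuot hV.tkk_semiprime) =
    MaxQuot.ofHom hV.tkk_semiprime (ofPlus V x) := rfl

theorem quotHom_minus (h6 : IsUnit (6 : Φ)) (hV : V.StronglyNondegenerate)
    (y : Vm) : ((quotHom h6 hV).minus y : MaxQuot hV.tkk_semiprime) =
    MaxQuot.ofHom hV.tkk_semiprime (ofMinus V y) := rfl

theorem quotHom_absorbsPlus (h6 : IsUnit (6 : Φ)) (hV : V.StronglyNondegenerate) :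
    (quotHom h6 hV).AbsorbsPlus := by
  rintro ⟨q, hq⟩ hne
  obtain ⟨I, hIg, hP, hZ, hN⟩ := MaxQuot.exists_of_mem_grading_one (isThreeGrading V) hq
  obtain ⟨a1, a2, a3, a4⟩ := MaxQuot.absorbs_degree_one (nondegThreeGraded hV) h6 I hIg hP hZ hN
  have mp (x : Vp) : ofPlus V x ∈ grading V 1 := mem_grading_one.2 ⟨x, rfl⟩
  have mm (x : Vm) : ofMinus V x ∈ grading V (-1) := mem_grading_neg_one.2 ⟨x, rfl⟩
  refine ⟨_, PairIdeal.ofLieIdeal_annEqZero h6 hV I hIg, fun y hy v => ?_, fun w x hx => ?_,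
    fun y hy w => ?_, ?_⟩
  · obtain ⟨z, hz, he⟩ := a1 (ofMinus V y) hy (mm y) _ (mp v)
    obtain ⟨z, rfl⟩ := mem_grading_one.1 hz
    exact ⟨z, Subtype.ext (he.symm.trans (quotPair_Dp h6 hV ⟨q, hq⟩ ((quotHom h6 hV).minus y)
      ((quotHom h6 hV).plus v)).symm)⟩
  · obtain ⟨z, hz, he⟩ := a2 _ (mm w) (ofPlus V x) hx (mp x)
    obtain ⟨z, rfl⟩ := mem_grading_one.1 hz
    exact ⟨z, Subtype.ext (he.symm.trans (quotPair_Dp h6 hV ⟨q, hq⟩ ((quotHom h6 hV).minus w)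
      ((quotHom h6 hV).plus x)).symm)⟩
  · obtain ⟨z, hz, he⟩ := a3 (ofMinus V y) hy (mm y) _ (mm w)
    obtain ⟨z, rfl⟩ := mem_grading_neg_one.1 hz
    exact ⟨z, Subtype.ext (he.symm.trans (quotPair_Dm h6 hV ((quotHom h6 hV).minus y) ⟨q, hq⟩
      ((quotHom h6 hV).minus w)).symm)⟩
  · rcases a4 fun h => hne (Subtype.ext h) with ⟨y, hy, hyN, v, hv, h0⟩ | ⟨y, hy, hyN, w, hw, h0⟩
    · obtain ⟨y, rfl⟩ := mem_grading_neg_one.1 hyN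
      obtain ⟨v, rfl⟩ := mem_grading_one.1 hv
      exact Or.inl ⟨y, hy, v, fun h => h0 ((quotPair_Dp h6 hV ⟨q, hq⟩ ((quotHom h6 hV).minus y)
        ((quotHom h6 hV).plus v)).symm.trans (congrArg Subtype.val h))⟩
    · obtain ⟨y, rfl⟩ := mem_grading_neg_one.1 hyN
      obtain ⟨w, rfl⟩ := mem_grading_neg_one.1 hw
      exact Or.inr (Or.inr ⟨y, hy, w, fun h => h0 ((quotPair_Dm h6 hV ((quotHom h6 hV).minus y)
        ⟨q, hq⟩ ((quotHom h6 hV).minus w)).symm.trans (congrArg Subtype.val h))⟩)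

theorem quotHom_absorbsMinus (h6 : IsUnit (6 : Φ)) (hV : V.StronglyNondegenerate) :
    (quotHom h6 hV).op.AbsorbsPlus := by
  rintro ⟨q, hq⟩ hne
  obtain ⟨I, hIg, hP, hZ, hN⟩ := MaxQuot.exists_of_mem_grading_neg_one (isThreeGrading V) hq
  obtain ⟨a1, a2, a3, a4⟩ :=
    MaxQuot.absorbs_degree_one (nondegThreeGraded hV).symm h6 I hIg.symm hP hZ hN
  have mp (x : Vp) : ofPlus V x ∈ grading V 1 := mem_grading_one.2 ⟨x, rfl⟩
  have mm (x : Vm) : ofMinus V x ∈ grading V (-1) := mem_grading_neg_one.2 ⟨x, rfl⟩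
  refine ⟨_, (PairIdeal.ofLieIdeal_annEqZero h6 hV I hIg).op, fun y hy v => ?_, fun w x hx => ?_,
    fun y hy w => ?_, ?_⟩
  · obtain ⟨z, hz, he⟩ := a1 (ofPlus V y) hy (mp y) _ (mm v)
    obtain ⟨z, rfl⟩ := mem_grading_neg_one.1 hz
    exact ⟨z, Subtype.ext (he.symm.trans (quotPair_Dm h6 hV ⟨q, hq⟩ ((quotHom h6 hV).plus y)
      ((quotHom h6 hV).minus v)).symm)⟩
  · obtain ⟨z, hz, he⟩ := a2 _ (mp w) (ofMinus V x) hx (mm x)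
    obtain ⟨z, rfl⟩ := mem_grading_neg_one.1 hz
    exact ⟨z, Subtype.ext (he.symm.trans (quotPair_Dm h6 hV ⟨q, hq⟩ ((quotHom h6 hV).plus w)
      ((quotHom h6 hV).minus x)).symm)⟩
  · obtain ⟨z, hz, he⟩ := a3 (ofPlus V y) hy (mp y) _ (mp w)
    obtain ⟨z, rfl⟩ := mem_grading_one.1 hz
    exact ⟨z, Subtype.ext (he.symm.trans (quotPair_Dp h6 hV ((quotHom h6 hV).plus y) ⟨q, hq⟩
      ((quotHom h6 hV).plus w)).symm)⟩
  · rcases a4 fun h => hne (Subtype.ext h) with ⟨y, hy, hyN, v, hv, h0⟩ | ⟨y, hy, hyN, w, hw, h0⟩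
    · obtain ⟨y, rfl⟩ := mem_grading_one.1 hyN
      obtain ⟨v, rfl⟩ := mem_grading_neg_one.1 hv
      exact Or.inl ⟨y, hy, v, fun h => h0 ((quotPair_Dm h6 hV ⟨q, hq⟩ ((quotHom h6 hV).plus y)
        ((quotHom h6 hV).minus v)).symm.trans
        (congrArg Subtype.val h))⟩
    · obtain ⟨y, rfl⟩ := mem_grading_one.1 hyN
      obtain ⟨w, rfl⟩ := mem_grading_one.1 hw
      exact Or.inr (Or.inr ⟨y, hy, w, fun h => h0 ((quotPair_Dp h6 hV ((quotHom h6 hV).plus y)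
        ⟨q, hq⟩ ((quotHom h6 hV).plus w)).symm.trans
        (congrArg Subtype.val h))⟩)

theorem quotHom_isMQuotient (h6 : IsUnit (6 : Φ)) (hV : V.StronglyNondegenerate) :
    (quotHom h6 hV).IsMQuotient where
  semiprime := hV.isSemiprime
  injective := ⟨fun _ _ h => ofPlus_injective (MaxQuot.ofHom_injective (congrArg Subtype.val h)),
    fun _ _ h => ofMinus_injective (MaxQuot.ofHom_injective (congrArg Subtype.val h))⟩
  absorbs_plus := quotHom_absorbsPlus h6 hV
  absorbs_minus := quotHom_absorbsMinus h6 hV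

end TKK

end JordanPair

namespace JordanPair

variable {Φ : Type u} [CommRing Φ] [Invertible (2 : Φ)]
  {Vp : Type v₁} {Vm : Type v₂} [AddCommGroup Vp] [Module Φ Vp] [AddCommGroup Vm] [Module Φ Vm]
  {Up : Type a₁} {Um : Type a₂} [AddCommGroup Up] [Module Φ Up] [AddCommGroup Um] [Module Φ Um]
  {V : JordanPair Φ Vp Vm} {U : JordanPair Φ Up Um}

/-! ### Maximality -/

namespace TKK

theorem span_mem_tkk (J : V.PairIdeal) (B : Submodule Φ V.TKK)
    (h1 : ∀ x ∈ J.plus, ∀ w, ⁅ofPlus V x, ofMinus V w⁆ ∈ B)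
    (h2 : ∀ v, ∀ y ∈ J.minus, ⁅ofPlus V v, ofMinus V y⁆ ∈ B) (g : V.TKK) (hg : g ∈ J.tkk)
    (hgZ : g ∈ grading V 0) : g ∈ B := by
  obtain ⟨g, rfl⟩ := mem_grading_zero.1 hgZ
  refine ofDer_mem_of_span (fun d hd => ?_) g hg.2.1
  obtain ⟨x, y, h | h, rfl⟩ := hd
  · exact ⟨x, y, rfl, h1 x h y⟩
  · exact ⟨x, y, rfl, h2 x y h⟩

theorem eq_ofPlus_of {f : V.TKK →ₗ⁅Φ⁆ U.TKK} {j : V.Hom U} (hp : ∀ a, (f a).plus = j.plus a.plus)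
    (hm : ∀ a, (f a).minus = j.minus a.minus) (hd : ∀ a, a.der = 0 → (f a).der = 0) (x : Vp) :
    f (ofPlus V x) = ofPlus U (j.plus x) :=
  TKK.ext (hp _) (hd _ rfl) ((hm _).trans (map_zero j.minus))

theorem eq_ofMinus_of {f : V.TKK →ₗ⁅Φ⁆ U.TKK} {j : V.Hom U} (hp : ∀ a, (f a).plus = j.plus a.plus)
    (hm : ∀ a, (f a).minus = j.minus a.minus) (hd : ∀ a, a.der = 0 → (f a).der = 0) (y : Vm) :
    f (ofMinus V y) = ofMinus U (j.minus y) :=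
  TKK.ext ((hp _).trans (map_zero j.plus)) (hd _ rfl) (hm _)

/-- If J absorbs q in the sense of pairs, the square of the essential ideal of TKK(V) generated by J
absorbs q in the sense of Lie algebras. -/
theorem absorbed_ofPlus (h6 : IsUnit (6 : Φ)) (hV : V.StronglyNondegenerate) {j : V.Hom U}
    (hj : j.AbsorbsPlus) {f : V.TKK →ₗ⁅Φ⁆ U.TKK} (hfp : ∀ x, f (ofPlus V x) = ofPlus U (j.plus x))
    (hfm : ∀ y, f (ofMinus V y) = ofMinus U (j.minus y)) (q : Up) : Absorbed f (ofPlus U q) := by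
  by_cases hq : q = 0
  · exact ⟨EssentialIdeal.top, fun x _ => ⟨0, by
      rw [hq, show ofPlus U 0 = 0 from rfl, zero_lie, map_zero]⟩⟩
  obtain ⟨J, hJ, a1, a2, a3, -⟩ := hj q hq
  refine Absorbed.of_degree_one (threeGraded V) hV.tkk_semiprime
    (fun B hp hm => mem_of_generators B (fun x => hp _ (mem_grading_one.2 ⟨x, rfl⟩))
      fun y => hm _ (mem_grading_neg_one.2 ⟨y, rfl⟩)) (J.tkkEssential h6 hV hJ)
    J.tkk_isThreeGraded (fun B h1 h2 => span_mem_tkk J B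
      (fun x hx w => h1 _ ⟨hx, zero_mem _, zero_mem _⟩ (mem_grading_one.2 ⟨x, rfl⟩) _
        (mem_grading_neg_one.2 ⟨w, rfl⟩))
      (fun v y hy => h2 _ (mem_grading_one.2 ⟨v, rfl⟩) _ ⟨zero_mem _, zero_mem _, hy⟩
        (mem_grading_neg_one.2 ⟨y, rfl⟩))) f _ ?_ ?_ ?_ ?_
  · intro p hp
    obtain ⟨p, rfl⟩ := mem_grading_one.1 hp
    rw [hfp, lie_plus_plus]
  · intro y hy hyN v hv
    obtain ⟨y, rfl⟩ := mem_grading_neg_one.1 hyN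
    obtain ⟨v, rfl⟩ := mem_grading_one.1 hv
    obtain ⟨z, hz⟩ := a1 y hy.2.2 v
    exact ⟨ofPlus V z, by rw [hfp, hfm, hfp, lie_triple_plus, hz]⟩
  · intro w hw x hx hxP
    obtain ⟨w, rfl⟩ := mem_grading_neg_one.1 hw
    obtain ⟨x, rfl⟩ := mem_grading_one.1 hxP
    obtain ⟨z, hz⟩ := a2 w x hx.1
    exact ⟨ofPlus V z, by rw [hfp, hfm, hfp, lie_triple_plus, hz]⟩
  · intro y hy hyN w hw
    obtain ⟨y, rfl⟩ := mem_grading_neg_one.1 hyN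
    obtain ⟨w, rfl⟩ := mem_grading_neg_one.1 hw
    obtain ⟨z, hz⟩ := a3 y hy.2.2 w
    exact ⟨ofMinus V z, by rw [hfm, hfm, hfm, lie_triple_minus, hz]⟩

theorem absorbed_ofMinus (h6 : IsUnit (6 : Φ)) (hV : V.StronglyNondegenerate) {j : V.Hom U}
    (hj : j.op.AbsorbsPlus) {f : V.TKK →ₗ⁅Φ⁆ U.TKK}
    (hfp : ∀ x, f (ofPlus V x) = ofPlus U (j.plus x))
    (hfm : ∀ y, f (ofMinus V y) = ofMinus U (j.minus y)) (q : Um) : Absorbed f (ofMinus U q) := by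
  by_cases hq : q = 0
  · exact ⟨EssentialIdeal.top, fun x _ => ⟨0, by
      rw [hq, show ofMinus U 0 = 0 from rfl, zero_lie, map_zero]⟩⟩
  obtain ⟨K, hK, a1, a2, a3, -⟩ := hj q hq
  let J : V.PairIdeal := K.op
  have hJ : J.AnnEqZero := hK.op
  refine Absorbed.of_degree_one (threeGraded V).symm hV.tkk_semiprime
    (fun B hm hp => mem_of_generators B (fun x => hp _ (mem_grading_one.2 ⟨x, rfl⟩))
      fun y => hm _ (mem_grading_neg_one.2 ⟨y, rfl⟩)) (J.tkkEssential h6 hV hJ)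
    J.tkk_isThreeGraded.symm (fun B h1 h2 => span_mem_tkk J B
      (fun x hx w => by
        rw [← lie_skew]
        exact B.neg_mem (h2 _ (mem_grading_neg_one.2 ⟨w, rfl⟩) _ ⟨hx, zero_mem _, zero_mem _⟩
          (mem_grading_one.2 ⟨x, rfl⟩)))
      (fun v y hy => by
        rw [← lie_skew]
        exact B.neg_mem (h1 _ ⟨zero_mem _, zero_mem _, hy⟩ (mem_grading_neg_one.2 ⟨y, rfl⟩) _
          (mem_grading_one.2 ⟨v, rfl⟩)))) f _ ?_ ?_ ?_ ?_
  · intro p hp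
    obtain ⟨p, rfl⟩ := mem_grading_neg_one.1 hp
    rw [hfm, lie_minus_minus]
  · intro y hy hyN v hv
    obtain ⟨y, rfl⟩ := mem_grading_one.1 hyN
    obtain ⟨v, rfl⟩ := mem_grading_neg_one.1 hv
    obtain ⟨z, hz⟩ := a1 y hy.1 v
    change j.minus z = U.Dm q (j.plus y) (j.minus v) at hz
    exact ⟨ofMinus V z, by rw [hfp, hfm, hfm, lie_triple_minus, hz]⟩
  · intro w hw x hx hxP
    obtain ⟨w, rfl⟩ := mem_grading_one.1 hw
    obtain ⟨x, rfl⟩ := mem_grading_neg_one.1 hxP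
    obtain ⟨z, hz⟩ := a2 w x hx.2.2
    change j.minus z = U.Dm q (j.plus w) (j.minus x) at hz
    exact ⟨ofMinus V z, by rw [hfp, hfm, hfm, lie_triple_minus, hz]⟩
  · intro y hy hyN w hw
    obtain ⟨y, rfl⟩ := mem_grading_one.1 hyN
    obtain ⟨w, rfl⟩ := mem_grading_one.1 hw
    obtain ⟨z, hz⟩ := a3 y hy.1 w
    change j.plus z = U.Dp (j.plus y) q (j.plus w) at hz
    exact ⟨ofPlus V z, by rw [hfp, hfp, hfp, lie_triple_plus, hz]⟩

/-- Existence in the universal property: embed TKK(V) in TKK(U), lift TKK(U) to Q_m(TKK(V)), and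
restrict the lift to degrees 1 and -1. -/
theorem exists_hom_of_isMQuotient (h6 : IsUnit (6 : Φ)) (hV : V.StronglyNondegenerate)
    {j : V.Hom U} (hj : j.IsMQuotient) : ∃ g : U.Hom (quotPair h6 hV),
      (∀ x, g.plus (j.plus x) = (quotHom h6 hV).plus x) ∧
      ∀ y, g.minus (j.minus y) = (quotHom h6 hV).minus y := by
  obtain ⟨f, hf, hp, hm, hd', hd⟩ := Hom.exists_tkk hj
  have hfp := eq_ofPlus_of hp hm hd
  have hfm := eq_ofMinus_of hp hm hd
  have habs : ∀ m, Absorbed f m := by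
    -- The absorbed elements form a subalgebra, so it suffices to treat the generators U⁺ and U⁻.
    refine fun m => mem_of_generators (V := U)
      { carrier := {m | Absorbed f m}
        zero_mem' := ⟨EssentialIdeal.top, fun x _ => ⟨0, by rw [zero_lie, map_zero]⟩⟩
        add_mem' := Absorbed.add
        smul_mem' := fun r _ => Absorbed.smul r
        lie_mem' := Absorbed.lie hV.tkk_semiprime hf }
      (absorbed_ofPlus h6 hV hj.absorbs_plus hfp hfm)
      (absorbed_ofMinus h6 hV hj.absorbs_minus hfp hfm) m
  -- Degrees are reflected as well as preserved by f, so the element z with [m, f x] = f z has the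
  -- degree required for `mem_grading_of`.
  have grade {i : ℤ} {a : V.TKK} : f a ∈ grading U i ↔ a ∈ grading V i := by
    constructor
    · rintro ⟨h1, h2, h3⟩
      refine ⟨fun hi => hj.injective.1 ?_, fun hi => hd' _ (h2 hi), fun hi => hj.injective.2 ?_⟩
      · rw [← hp, h1 hi, map_zero]
      · rw [← hm, h3 hi, map_zero]
    · rintro ⟨h1, h2, h3⟩
      refine ⟨fun hi => ?_, fun hi => hd _ (h2 hi), fun hi => ?_⟩
      · rw [hp, h1 hi, map_zero]
      · rw [hm, h3 hi, map_zero]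
  obtain ⟨φ, hφ⟩ := exists_lift hV.tkk_semiprime hf habs
  have hφg (i : ℤ) (m : U.TKK) (hmi : m ∈ grading U i) :
      φ m ∈ MaxQuot.grading hV.tkk_semiprime (grading V) i := by
    obtain ⟨I, hI⟩ := habs m
    refine MaxQuot.mem_grading_of (isThreeGrading V) (nondegThreeGraded hV) h6 I
      fun k x hx hk => ?_
    obtain ⟨z, hz⟩ := hI x hx
    refine ⟨z, grade.1 ?_, hφ m x z hz⟩
    rw [← hz]
    exact (isThreeGrading U).lie_mem _ _ _ _ hmi (grade.2 hk)
  refine ⟨homOfLieHom h6 hV φ (fun x => hφg 1 _ (mem_grading_one.2 ⟨x, rfl⟩))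
    (fun y => hφg (-1) _ (mem_grading_neg_one.2 ⟨y, rfl⟩)), fun x => Subtype.ext ?_,
    fun y => Subtype.ext ?_⟩
  · change φ (ofPlus U (j.plus x)) = _
    rw [← hfp, lift_comp _ hφ, quotHom_plus]
  · change φ (ofMinus U (j.minus y)) = _
    rw [← hfm, lift_comp _ hφ, quotHom_minus]

theorem quotHom_isMaximalMQuotient (h6 : IsUnit (6 : Φ)) (hV : V.StronglyNondegenerate) :
    Hom.IsMaximalMQuotient.{a₁, a₂} (quotHom h6 hV) := by
  have hι := quotHom_isMQuotient h6 hV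
  refine ⟨hι, fun Up Um _ _ _ _ U j hj => ?_⟩
  obtain ⟨g, hgp, hgm⟩ := exists_hom_of_isMQuotient h6 hV hj
  exact ⟨g, Hom.injective_of_comp hι.injective hj hgp hgm, ⟨hgp, hgm⟩, fun g' h1 h2 =>
    Hom.eq_of_comp hι hj h1 h2 hgp hgm⟩

end TKK

end JordanPair

/-! ### Isomorphisms of graded Lie algebras -/

section

variable {Φ : Type u} [CommRing Φ] {L : Type v} [LieRing L] [LieAlgebra Φ L]
  {L' : Type w} [LieRing L'] [LieAlgebra Φ L'] {𝓛 : ℤ → Submodule Φ L}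
  {𝓛' : ℤ → Submodule Φ L'}

theorem IsGradedIso.symm {e : L ≃ₗ⁅Φ⁆ L'} (he : IsGradedIso 𝓛 𝓛' e) :
    IsGradedIso 𝓛' 𝓛 e.symm := fun i x => by
  rw [he, LieEquiv.apply_symm_apply]

theorem IsGradedIdeal.comap_symm {e : L ≃ₗ⁅Φ⁆ L'} (he : IsGradedIso 𝓛 𝓛' e) {I : LieIdeal Φ L}
    (hI : IsGradedIdeal 𝓛 I) : IsGradedIdeal 𝓛' (I.comap e.symm.toLieHom) := by
  intro y hy hs j
  have := hI (y.mapRange e.symm (map_zero e.symm))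
    (fun j => by rw [Finsupp.mapRange_apply]; exact (he.symm j _).1 (hy j)) (by
      rw [Finsupp.sum_mapRange_index fun _ => rfl]
      have h := LieIdeal.mem_comap.1 hs
      rwa [map_finsuppSum] at h) j
  rwa [Finsupp.mapRange_apply] at this

/-- The image of an essential ideal under an isomorphism. -/
def EssentialIdeal.congr (e : L ≃ₗ⁅Φ⁆ L') (I : EssentialIdeal Φ L) : EssentialIdeal Φ L' :=
  ⟨I.1.comap e.symm.toLieHom, fun K hK h0 => I.2 (K.comap e.toLieHom)
    (fun h => hK ((LieSubmodule.eq_bot_iff K).2 fun x hx => by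
      have hx' : e.symm x ∈ K.comap e.toLieHom := LieIdeal.mem_comap.2 (by
        change e (e.symm x) ∈ K
        rwa [LieEquiv.apply_symm_apply])
      rw [h, LieSubmodule.mem_bot] at hx'
      rw [← e.apply_symm_apply x, hx', map_zero]))
    ((LieSubmodule.eq_bot_iff _).2 fun x hx => by
      have hx' : e x ∈ I.1.comap e.symm.toLieHom ⊓ K := ⟨LieIdeal.mem_comap.2 (by
        change e.symm (e x) ∈ I.1
        rw [LieEquiv.symm_apply_apply]
        exact hx.1), LieIdeal.mem_comap.1 hx.2⟩
      rw [h0, LieSubmodule.mem_bot] at hx'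
      rw [← e.symm_apply_apply x, hx', map_zero])⟩

theorem EssentialIdeal.mem_congr {e : L ≃ₗ⁅Φ⁆ L'} {I : EssentialIdeal Φ L} {x : L'} :
    x ∈ (I.congr e).1 ↔ e.symm x ∈ I.1 := LieIdeal.mem_comap

/-- Complements `mem_grading_of`: the ideal is already graded, so no nondegeneracy of L is needed.
This suits transport along an isomorphism. -/
theorem MaxQuot.mem_grading_of_isGradedIdeal {hs : LieSemiprime Φ L} {i : ℤ} {q : MaxQuot hs}
    (I : EssentialIdeal Φ L) (hI : IsGradedIdeal 𝓛 I.1)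
    (hq : ∀ x ∈ I.1, ∃ z, ⁅q, ofHom hs x⁆ = ofHom hs z ∧ ∀ k, x ∈ 𝓛 k → z ∈ 𝓛 (i + k)) :
    q ∈ grading hs 𝓛 i := by
  obtain ⟨d, hd⟩ := exists_pder (f := ofHom hs) ofHom_injective (m := q) I
    fun x hx => (hq x hx).imp fun _ h => h.1
  refine ⟨I, d, hI, fun k x hx => ?_, ext_lie I fun x hx => ?_⟩
  · obtain ⟨z, hz, hk⟩ := hq x x.2
    rw [ofHom_injective ((hd x).trans hz)]
    exact hk k hx
  · rw [lie_mk_of I d ⟨x, hx⟩, hd]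

/-- Q_m(L) is an extension of L' through the inverse of e, and its elements are absorbed by images
of essential ideals. So `exists_lift` applies; doing this in both directions gives the isomorphism.
-/
theorem MaxQuot.exists_graded_hom (hs : LieSemiprime Φ L) (hs' : LieSemiprime Φ L')
    {e : L ≃ₗ⁅Φ⁆ L'} (he : IsGradedIso 𝓛 𝓛' e) : ∃ φ : MaxQuot hs →ₗ⁅Φ⁆ MaxQuot hs',
      (∀ (q : MaxQuot hs) (x z : L), ⁅q, ofHom hs x⁆ = ofHom hs z →
        ⁅φ q, ofHom hs' (e x)⁆ = ofHom hs' (e z)) ∧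
      ∀ (i : ℤ) (q : MaxQuot hs), q ∈ grading hs 𝓛 i → φ q ∈ grading hs' 𝓛' i := by
  have hinj : Function.Injective ((ofHom hs).comp e.symm.toLieHom) :=
    ofHom_injective.comp e.symm.injective
  obtain ⟨φ, hφ⟩ := exists_lift hs' hinj fun q => by
    obtain ⟨I, hI⟩ := exists_absorbs q
    refine ⟨I.congr e, fun x hx => ?_⟩
    obtain ⟨z, hz⟩ := hI _ (EssentialIdeal.mem_congr.1 hx)
    exact ⟨e z, by
      change ⁅q, ofHom hs (e.symm x)⁆ = ofHom hs (e.symm (e z))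
      rw [LieEquiv.symm_apply_apply, hz]⟩
  have hφ' (q : MaxQuot hs) (x z : L) (h : ⁅q, ofHom hs x⁆ = ofHom hs z) :
      ⁅φ q, ofHom hs' (e x)⁆ = ofHom hs' (e z) := hφ q (e x) (e z) (by
    change ⁅q, ofHom hs (e.symm (e x))⁆ = ofHom hs (e.symm (e z))
    rwa [LieEquiv.symm_apply_apply, LieEquiv.symm_apply_apply])
  refine ⟨φ, hφ', fun i q hq => ?_⟩
  obtain ⟨I, d, hI, hd, rfl⟩ := hq
  refine mem_grading_of_isGradedIdeal (I.congr e) (hI.comap_symm he) fun x hx => ?_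
  have hx' := EssentialIdeal.mem_congr.1 hx
  have := hφ' _ _ _ (lie_mk_of (h := hs) I d ⟨_, hx'⟩)
  rw [LieEquiv.apply_symm_apply] at this
  exact ⟨_, this, fun k hk => (he _ _).1 (hd k ⟨_, hx'⟩ ((he.symm k x).1 hk))⟩

/-- Isomorphic graded Lie algebras have isomorphic maximal algebras of quotients. -/
theorem MaxQuot.exists_gradedIso (hs : LieSemiprime Φ L) (hs' : LieSemiprime Φ L')
    {e : L ≃ₗ⁅Φ⁆ L'} (he : IsGradedIso 𝓛 𝓛' e) : ∃ E : MaxQuot hs ≃ₗ⁅Φ⁆ MaxQuot hs',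
      IsGradedIso (grading hs 𝓛) (grading hs' 𝓛') E := by
  obtain ⟨φ, hφ, hφg⟩ := exists_graded_hom hs hs' he
  obtain ⟨ψ, hψ, hψg⟩ := exists_graded_hom hs' hs he.symm
  have h1 (q : MaxQuot hs) : ψ (φ q) = q := by
    obtain ⟨I, hI⟩ := exists_absorbs q
    refine ext_lie I fun x hx => ?_
    obtain ⟨z, hz⟩ := hI x hx
    have := hψ _ _ _ (hφ _ _ _ hz)
    rw [LieEquiv.symm_apply_apply, LieEquiv.symm_apply_apply] at this
    rw [this, hz]
  have h2 (q : MaxQuot hs') : φ (ψ q) = q := by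
    obtain ⟨I, hI⟩ := exists_absorbs q
    refine ext_lie I fun x hx => ?_
    obtain ⟨z, hz⟩ := hI x hx
    have := hφ _ _ _ (hψ _ _ _ hz)
    rw [LieEquiv.apply_symm_apply, LieEquiv.apply_symm_apply] at this
    rw [this, hz]
  refine ⟨{ φ with invFun := ψ, left_inv := h1, right_inv := h2 }, fun i q =>
    ⟨hφg i q, fun hq => ?_⟩⟩
  have := hψg i _ hq
  change ψ (φ q) ∈ _ at this
  rwa [h1] at this

/-- Since L_1 and L_{-1} generate L, an element that kills both is central. -/
theorem IsThreeGrading.lie_eq_zero (h : IsThreeGrading 𝓛)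
    (hspan : Submodule.span Φ {z | ∃ x ∈ 𝓛 1, ∃ y ∈ 𝓛 (-1), ⁅x, y⁆ = z} = 𝓛 0) {g : L}
    (h1 : ∀ x ∈ 𝓛 1, ⁅g, x⁆ = 0) (h2 : ∀ y ∈ 𝓛 (-1), ⁅g, y⁆ = 0) (a : L) : ⁅g, a⁆ = 0 := by
  obtain ⟨p, hp, z, hz, n, hn, rfl⟩ := h.threeGraded.exists_add a
  have h0 : ⁅g, z⁆ = 0 := by
    rw [← hspan] at hz
    induction hz using Submodule.span_induction with
    | mem z hz =>
      obtain ⟨x, hx, y, hy, rfl⟩ := hz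
      rw [leibniz_lie, h1 x hx, h2 y hy, zero_lie, lie_zero, add_zero]
    | zero => exact lie_zero g
    | add z z' _ _ hz hz' => rw [lie_add, hz, hz', add_zero]
    | smul r z _ hz => rw [lie_smul, hz, smul_zero]
  rw [lie_add, lie_add, h1 p hp, h0, h2 n hn, add_zero, add_zero]

theorem IsGradedIso.map_mem_span {e : L ≃ₗ⁅Φ⁆ L'} (he : IsGradedIso 𝓛 𝓛' e) {z : L}
    (hz : z ∈ Submodule.span Φ {z | ∃ x ∈ 𝓛 1, ∃ y ∈ 𝓛 (-1), ⁅x, y⁆ = z}) :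
    e z ∈ Submodule.span Φ {z | ∃ x ∈ 𝓛' 1, ∃ y ∈ 𝓛' (-1), ⁅x, y⁆ = z} := by
  induction hz using Submodule.span_induction with
  | mem z hz =>
    obtain ⟨x, hx, y, hy, rfl⟩ := hz
    exact Submodule.subset_span
      ⟨e x, (he _ _).1 hx, e y, (he _ _).1 hy, (LieEquiv.map_lie e x y).symm⟩
  | zero => rw [map_zero]; exact zero_mem _
  | add z z' _ _ hz hz' => rw [map_add]; exact add_mem hz hz'
  | smul r z _ hz => rw [map_smul]; exact Submodule.smul_mem _ r hz

theorem IsGradedIso.span_eq {e : L ≃ₗ⁅Φ⁆ L'} (he : IsGradedIso 𝓛 𝓛' e)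
    (hspan : Submodule.span Φ {z | ∃ x ∈ 𝓛 1, ∃ y ∈ 𝓛 (-1), ⁅x, y⁆ = z} = 𝓛 0) :
    Submodule.span Φ {z | ∃ x ∈ 𝓛' 1, ∃ y ∈ 𝓛' (-1), ⁅x, y⁆ = z} = 𝓛' 0 := by
  refine le_antisymm (fun z hz => ?_) (fun z hz => ?_)
  · have := he.symm.map_mem_span hz
    rwa [hspan, he, LieEquiv.apply_symm_apply] at this
  · have := (he.symm 0 z).1 hz
    rw [← hspan] at this
    simpa using he.map_mem_span this

end

/-! ### Jordan three-graded Lie algebras as Tits-Kantor-Koecher algebras -/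

section

variable {Φ : Type u} [CommRing Φ] [Invertible (2 : Φ)] {L : Type v} [LieRing L] [LieAlgebra Φ L]
  {𝓛 : ℤ → Submodule Φ L} {Wp : Type w₁} {Wm : Type w₂} [AddCommGroup Wp] [Module Φ Wp]
  [AddCommGroup Wm] [Module Φ Wm] {W : JordanPair Φ Wp Wm}

open JordanPair in
-- The inner derivation δ(x, y) is realized by the bracket [a x, b y] of degree 0; spans are handled
-- linearly.
theorem IsThreeGrading.exists_lie_eq_ider (h : IsThreeGrading 𝓛) {a : Wp →ₗ[Φ] L}
    {b : Wm →ₗ[Φ] L} (ha : ∀ x, a x ∈ 𝓛 1) (hb : ∀ y, b y ∈ 𝓛 (-1))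
    (hDp : ∀ x y z, a (W.Dp x y z) = ⁅⁅a x, b y⁆, a z⁆)
    (hDm : ∀ x y z, b (W.Dm x y z) = ⁅⁅b x, a y⁆, b z⁆) (d : W.IDer) :
    ∃ g ∈ 𝓛 0, (∀ x, ⁅g, a x⁆ = a (d.1.1 x)) ∧ ∀ y, ⁅g, b y⁆ = b (d.1.2 y) := by
  obtain ⟨d, hd⟩ := d
  induction hd using Submodule.span_induction with
  | mem d hd =>
    obtain ⟨x, y, rfl⟩ := hd
    refine ⟨⁅a x, b y⁆, h.lie_mem 1 (-1) _ _ (ha x) (hb y), fun z => (hDp x y z).symm,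
      fun z => ?_⟩
    change _ = b (-W.Dm y x z)
    rw [map_neg, hDm, ← lie_skew (a x), neg_lie]
  | zero => exact ⟨0, zero_mem _, fun x => (zero_lie _).trans (map_zero a).symm,
      fun y => (zero_lie _).trans (map_zero b).symm⟩
  | add d e _ _ hd he =>
    obtain ⟨g, h0, h1, h2⟩ := hd
    obtain ⟨g', h0', h1', h2'⟩ := he
    exact ⟨g + g', add_mem h0 h0', fun x => by rw [add_lie, h1, h1', ← map_add]; rfl,
      fun y => by rw [add_lie, h2, h2', ← map_add]; rfl⟩
  | smul r d _ hd =>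
    obtain ⟨g, h0, h1, h2⟩ := hd
    exact ⟨r • g, Submodule.smul_mem _ r h0, fun x => by rw [smul_lie, h1, ← map_smul]; rfl,
      fun y => by rw [smul_lie, h2, ← map_smul]; rfl⟩

open JordanPair in
/-- A three-graded Lie algebra `L` with `[L_1, L_{-1}] = L_0` acting faithfully on
`(L_1, L_{-1})` is the Tits-Kantor-Koecher algebra of its Jordan pair. -/
theorem IsThreeGrading.exists_tkk_equiv (h : IsThreeGrading 𝓛)
    (hspan : Submodule.span Φ {z | ∃ x ∈ 𝓛 1, ∃ y ∈ 𝓛 (-1), ⁅x, y⁆ = z} = 𝓛 0)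
    (hc : ∀ g ∈ 𝓛 0, (∀ x ∈ 𝓛 1, ⁅g, x⁆ = 0) → (∀ y ∈ 𝓛 (-1), ⁅g, y⁆ = 0) → g = 0)
    {a : Wp →ₗ[Φ] L} {b : Wm →ₗ[Φ] L} (hai : Function.Injective a) (hbi : Function.Injective b)
    (har : LinearMap.range a = 𝓛 1) (hbr : LinearMap.range b = 𝓛 (-1))
    (hDp : ∀ x y z, a (W.Dp x y z) = ⁅⁅a x, b y⁆, a z⁆)
    (hDm : ∀ x y z, b (W.Dm x y z) = ⁅⁅b x, a y⁆, b z⁆) :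
    ∃ e : W.TKK ≃ₗ⁅Φ⁆ L, IsGradedIso (TKK.grading W) 𝓛 e := by
  have ha (x : Wp) : a x ∈ 𝓛 1 := har ▸ ⟨x, rfl⟩
  have hb (y : Wm) : b y ∈ 𝓛 (-1) := hbr ▸ ⟨y, rfl⟩
  choose F F0 Fp Fm using h.exists_lie_eq_ider ha hb hDp hDm
  -- Faithfulness of the degree 0 part makes the realization of d unique. All algebraic properties
  -- of F, including compatibility with brackets, follow from this.
  have uniq (d : W.IDer) (g : L) (hg : g ∈ 𝓛 0) (h1 : ∀ x, ⁅g, a x⁆ = a (d.1.1 x))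
      (h2 : ∀ y, ⁅g, b y⁆ = b (d.1.2 y)) : F d = g := by
    rw [← sub_eq_zero]
    refine hc _ (sub_mem (F0 d) hg) (fun x hx => ?_) (fun y hy => ?_)
    · rw [← har] at hx
      obtain ⟨x, rfl⟩ := hx
      rw [sub_lie, Fp, h1, sub_self]
    · rw [← hbr] at hy
      obtain ⟨y, rfl⟩ := hy
      rw [sub_lie, Fm, h2, sub_self]
  have Fadd (d e : W.IDer) : F (d + e) = F d + F e :=
    uniq _ _ (add_mem (F0 d) (F0 e)) (fun x => by rw [add_lie, Fp, Fp, ← map_add]; rfl)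
      (fun y => by rw [add_lie, Fm, Fm, ← map_add]; rfl)
  have Fsmul (r : Φ) (d : W.IDer) : F (r • d) = r • F d :=
    uniq _ _ (Submodule.smul_mem _ r (F0 d)) (fun x => by rw [smul_lie, Fp, ← map_smul]; rfl)
      (fun y => by rw [smul_lie, Fm, ← map_smul]; rfl)
  have Fzero (d : W.IDer) (hd : F d = 0) : d = 0 := by
    refine Subtype.ext (Prod.ext (LinearMap.ext fun x => hai ?_) (LinearMap.ext fun y => hbi ?_))
    · rw [← Fp, hd, zero_lie]
      exact (map_zero a).symm
    · rw [← Fm, hd, zero_lie]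
      exact (map_zero b).symm
  have hlie (p p' g g' n n' : L) (hp : p ∈ 𝓛 1) (hp' : p' ∈ 𝓛 1) (hn : n ∈ 𝓛 (-1))
      (hn' : n' ∈ 𝓛 (-1)) : ⁅p + g + n, p' + g' + n'⁆ =
        (⁅g, p'⁆ - ⁅g', p⁆) + (⁅g, g'⁆ + ⁅p, n'⁆ - ⁅p', n⁆) + (⁅g, n'⁆ - ⁅g', n⁆) := by
    simp only [add_lie, lie_add, h.threeGraded.lie_PP p hp p' hp',
      h.threeGraded.lie_NN n hn n' hn']
    rw [← lie_skew p g', ← lie_skew n p', ← lie_skew n g']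
    abel
  let f : W.TKK →ₗ⁅Φ⁆ L :=
    { toFun := fun t => a t.plus + F t.der + b t.minus
      map_add' := fun s t => by
        change a (s.plus + t.plus) + F (s.der + t.der) + b (s.minus + t.minus) = _
        rw [map_add, map_add, Fadd]
        abel
      map_smul' := fun r t => by
        change a (r • t.plus) + F (r • t.der) + b (r • t.minus) = _
        rw [map_smul, map_smul, Fsmul, RingHom.id_apply, smul_add, smul_add]
      map_lie' := fun {s t} => by
        rw [hlie _ _ _ _ _ _ (ha _) (ha _) (hb _) (hb _)]
        refine congrArg₂ (· + ·) (congrArg₂ (· + ·) ?_ (uniq _ _ ?_ (fun x => ?_)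
          fun y => ?_)) ?_
        · rw [TKK.lie_fst, map_sub, Fp, Fp]
        · exact sub_mem (add_mem (h.threeGraded.lie_ZZ _ (F0 _) _ (F0 _))
            (h.threeGraded.lie_PN _ (ha _) _ (hb _))) (h.threeGraded.lie_PN _ (ha _) _ (hb _))
        · rw [TKK.lie_mid, sub_lie, add_lie, lie_lie, Fp, Fp, Fp, Fp, ← hDp, ← hDp, ← map_sub,
            ← map_add, ← map_sub]
          rfl
        · have e (u : Wp) (v : Wm) : ⁅⁅a u, b v⁆, b y⁆ = b ((W.innerDer u v).2 y) := by
            rw [TKK.innerDer_snd, map_neg, hDm, ← lie_skew (a u), neg_lie]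
          rw [TKK.lie_mid, sub_lie, add_lie, lie_lie, Fm, Fm, Fm, Fm, e, e, ← map_sub,
            ← map_add, ← map_sub]
          rfl
        · rw [TKK.lie_lst, map_sub, Fm, Fm] }
  have hf (t : W.TKK) : f t = a t.plus + F t.der + b t.minus := rfl
  have surj0 (g : L) (hg : g ∈ 𝓛 0) : ∃ d, F d = g := by
    rw [← hspan] at hg
    induction hg using Submodule.span_induction with
    | mem g hg =>
      obtain ⟨x, hx, y, hy, rfl⟩ := hg
      rw [← har] at hx
      rw [← hbr] at hy
      obtain ⟨x, rfl⟩ := hx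
      obtain ⟨y, rfl⟩ := hy
      refine ⟨W.inner x y, uniq _ _ (h.threeGraded.lie_PN _ (ha _) _ (hb _))
        (fun z => (hDp x y z).symm) (fun z => ?_)⟩
      change _ = b (-W.Dm y x z)
      rw [map_neg, hDm, ← lie_skew (a x), neg_lie]
    | zero => exact ⟨0, uniq _ _ (zero_mem _) (fun x => (zero_lie _).trans (map_zero a).symm)
        fun y => (zero_lie _).trans (map_zero b).symm⟩
    | add g g' _ _ hg hg' =>
      obtain ⟨d, rfl⟩ := hg
      obtain ⟨d', rfl⟩ := hg'
      exact ⟨d + d', Fadd d d'⟩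
    | smul r g _ hg =>
      obtain ⟨d, rfl⟩ := hg
      exact ⟨r • d, Fsmul r d⟩
  have proj_f (t : W.TKK) : h.proj 1 (f t) = a t.plus ∧ h.proj 0 (f t) = F t.der ∧
      h.proj (-1) (f t) = b t.minus := by
    simp only [hf, map_add]
    refine ⟨?_, ?_, ?_⟩
    · rw [h.proj_of_mem (ha _), h.proj_of_ne (by decide) (F0 _), h.proj_of_ne (by decide) (hb _),
        add_zero, add_zero]
    · rw [h.proj_of_mem (F0 _), h.proj_of_ne (by decide) (ha _), h.proj_of_ne (by decide) (hb _),
        add_zero, zero_add]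
    · rw [h.proj_of_mem (hb _), h.proj_of_ne (by decide) (ha _), h.proj_of_ne (by decide) (F0 _),
        add_zero, zero_add]
  have za (x : Wp) (hx : a x = 0) : x = 0 := hai (hx.trans (map_zero a).symm)
  have zb (y : Wm) (hy : b y = 0) : y = 0 := hbi (hy.trans (map_zero b).symm)
  have bij : Function.Bijective f := by
    refine ⟨(injective_iff_map_eq_zero f).2 fun t ht => ?_, fun x => ?_⟩
    · obtain ⟨h1, h2, h3⟩ := proj_f t
      rw [ht, map_zero] at h1 h2 h3
      exact TKK.ext (za _ h1.symm) (Fzero _ h2.symm) (zb _ h3.symm)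
    · obtain ⟨p, hp, g, hg, n, hn, rfl⟩ := h.threeGraded.exists_add x
      rw [← har] at hp
      rw [← hbr] at hn
      obtain ⟨x, rfl⟩ := hp
      obtain ⟨y, rfl⟩ := hn
      obtain ⟨d, rfl⟩ := surj0 g hg
      exact ⟨⟨x, d, y⟩, rfl⟩
  refine ⟨LieEquiv.ofBijective f bij, fun i t => ⟨fun ht => ?_, fun ht => ?_⟩⟩
  · change f t ∈ 𝓛 i
    rw [hf]
    refine add_mem (add_mem ?_ ?_) ?_
    · by_cases hi : i = 1
      · rw [hi]; exact ha _
      · rw [ht.1 hi, map_zero]; exact zero_mem _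
    · by_cases hi : i = 0
      · rw [hi]; exact F0 _
      -- Homogeneity with scalar 0 gives F 0 = 0.
      · have := Fsmul 0 0
        rw [zero_smul, zero_smul] at this
        rw [ht.2.1 hi, this]; exact zero_mem _
    · by_cases hi : i = -1
      · rw [hi]; exact hb _
      · rw [ht.2.2 hi, map_zero]; exact zero_mem _
  · change f t ∈ 𝓛 i at ht
    obtain ⟨h1, h2, h3⟩ := proj_f t
    exact ⟨fun hi => za _ (h1.symm.trans (h.proj_of_ne hi ht)),
      fun hi => Fzero _ (h2.symm.trans (h.proj_of_ne hi ht)),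
      fun hi => zb _ (h3.symm.trans (h.proj_of_ne hi ht))⟩

end

/-- The faithfulness needed for the reconstruction holds because an element of L_0 killing L_1 and
L_{-1} is central, hence an absolute zero divisor. -/
theorem IsAssociatedPair.exists_tkk_equiv {Φ : Type u} [CommRing Φ] [Invertible (2 : Φ)]
    {L : Type v} [LieRing L] [LieAlgebra Φ L] {𝓛 : ℤ → Submodule Φ L}
    {V : JordanPair Φ (𝓛 1) (𝓛 (-1))} (hV : IsAssociatedPair 𝓛 V) (h : IsJordanThreeGrading 𝓛)
    (hL : LieStronglyNondegenerate L) :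
    ∃ e : V.TKK ≃ₗ⁅Φ⁆ L, IsGradedIso (JordanPair.TKK.grading V) 𝓛 e :=
  h.toIsThreeGrading.exists_tkk_equiv h.lie_eq_zero_part
    (fun g _ h1 h2 => hL g fun _ =>
      h.toIsThreeGrading.lie_eq_zero h.lie_eq_zero_part h1 h2 _)
    (𝓛 1).injective_subtype (𝓛 (-1)).injective_subtype (𝓛 1).range_subtype (𝓛 (-1)).range_subtype
    hV.plus hV.minus

/-! ### The Tits-Kantor-Koecher algebra of the maximal pair of quotients. -/

namespace JordanPair

variable {Φ : Type u} [CommRing Φ] [Invertible (2 : Φ)]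
  {Vp : Type v₁} {Vm : Type v₂} [AddCommGroup Vp] [Module Φ Vp] [AddCommGroup Vm] [Module Φ Vm]
  {Wp : Type w₁} {Wm : Type w₂} [AddCommGroup Wp] [Module Φ Wp] [AddCommGroup Wm] [Module Φ Wm]
  {Up : Type a₁} {Um : Type a₂} [AddCommGroup Up] [Module Φ Up] [AddCommGroup Um] [Module Φ Um]
  {V : JordanPair Φ Vp Vm} {W : JordanPair Φ Wp Wm} {U : JordanPair Φ Up Um}

/-- The identity homomorphism. -/
def Hom.id (V : JordanPair Φ Vp Vm) : V.Hom V :=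
  ⟨LinearMap.id, LinearMap.id, fun _ _ => rfl, fun _ _ => rfl⟩

/-- The composition of homomorphisms. -/
def Hom.comp (g : W.Hom U) (f : V.Hom W) : V.Hom U where
  plus := g.plus ∘ₗ f.plus
  minus := g.minus ∘ₗ f.minus
  map_Qp x y := by simp only [LinearMap.comp_apply, f.map_Qp, g.map_Qp]
  map_Qm y x := by simp only [LinearMap.comp_apply, f.map_Qm, g.map_Qm]

/-- Homomorphisms over `V` between pairs of `𝔐`-quotients are inverse to each other. -/
theorem Hom.leftInverse_of_comp {ι : V.Hom W} (hι : ι.IsMQuotient) {j : V.Hom U} {f : U.Hom W}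
    (hfp : ∀ x, f.plus (j.plus x) = ι.plus x) (hfm : ∀ y, f.minus (j.minus y) = ι.minus y)
    {g : W.Hom U} (hgp : ∀ x, g.plus (ι.plus x) = j.plus x)
    (hgm : ∀ y, g.minus (ι.minus y) = j.minus y) :
    Function.LeftInverse f.plus g.plus ∧ Function.LeftInverse f.minus g.minus := by
  have : f.comp g = Hom.id W := Hom.eq_of_comp hι hι
    (fun x => (congrArg f.plus (hgp x)).trans (hfp x))
    (fun y => (congrArg f.minus (hgm y)).trans (hfm y)) (fun _ => rfl) (fun _ => rfl)
  exact ⟨fun x => LinearMap.congr_fun (congrArg Hom.plus this) x,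
    fun y => LinearMap.congr_fun (congrArg Hom.minus this) y⟩

/-- W is isomorphic to the pair of the components of degree 1 and -1, since both are maximal. Once
these components generate Q_m(TKK(V)), an element of degree 0 killing them is central, hence zero,
and the reconstruction theorem applies. -/
theorem TKK.exists_tkk_equiv_maxQuot {Vp Vm : Type v} [AddCommGroup Vp] [Module Φ Vp]
    [AddCommGroup Vm] [Module Φ Vm] {V : JordanPair Φ Vp Vm} (h6 : IsUnit (6 : Φ))
    (hV : V.StronglyNondegenerate) {ι : V.Hom W} (hι : Hom.IsMaximalMQuotient.{v, v} ι)
    (hspan : Submodule.span Φ {z | ∃ x ∈ MaxQuot.grading hV.tkk_semiprime (grading V) 1,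
      ∃ y ∈ MaxQuot.grading hV.tkk_semiprime (grading V) (-1), ⁅x, y⁆ = z} =
        MaxQuot.grading hV.tkk_semiprime (grading V) 0) :
    ∃ e : W.TKK ≃ₗ⁅Φ⁆ MaxQuot hV.tkk_semiprime,
      IsGradedIso (grading W) (MaxQuot.grading hV.tkk_semiprime (grading V)) e := by
  have hQ := quotHom_isMQuotient h6 hV
  have h3 := maxQuot_isThreeGrading h6 hV
  -- The direct construction of g puts no restriction on the universes of W. Only f uses the
  -- maximality of W, tested on a pair in the universe of V.
  obtain ⟨g, hgp, hgm⟩ := exists_hom_of_isMQuotient h6 hV hι.1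
  obtain ⟨f, -, ⟨hfp, hfm⟩, -⟩ := hι.2 _ _ (quotPair h6 hV) (quotHom h6 hV) hQ
  obtain ⟨hfg, hfg'⟩ := Hom.leftInverse_of_comp hι.1 hfp hfm hgp hgm
  obtain ⟨hgf, hgf'⟩ := Hom.leftInverse_of_comp hQ hgp hgm hfp hfm
  refine h3.exists_tkk_equiv hspan (fun q _ h1 h2 => MaxQuot.eq_zero_of_lie EssentialIdeal.top
      fun x _ => h3.lie_eq_zero hspan h1 h2 _)
    (a := Submodule.subtype _ ∘ₗ g.plus) (b := Submodule.subtype _ ∘ₗ g.minus)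
    (Subtype.val_injective.comp hfg.injective) (Subtype.val_injective.comp hfg'.injective) ?_ ?_
    (fun x y z => ?_) (fun x y z => ?_)
  · rw [LinearMap.range_comp, LinearMap.range_eq_top.2 hgf.surjective, Submodule.map_top,
      Submodule.range_subtype]
  · rw [LinearMap.range_comp, LinearMap.range_eq_top.2 hgf'.surjective, Submodule.map_top,
      Submodule.range_subtype]
  · rw [LinearMap.comp_apply, g.map_Dp]
    exact quotPair_Dp h6 hV _ _ _
  · rw [LinearMap.comp_apply, g.map_Dm]
    exact quotPair_Dm h6 hV _ _ _

end JordanPair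

end

theorem mainTheorem1 {Φ : Type u} [CommRing Φ] [Invertible (2 : Φ)]
    (h6 : IsUnit (6 : Φ)) :
    -- (i) the pair of the degree 1 and degree -1 components of `Q_m(TKK(V))`
    (∀ {Vp : Type v₁} {Vm : Type v₂} [AddCommGroup Vp] [Module Φ Vp] [AddCommGroup Vm]
      [Module Φ Vm] (V : JordanPair Φ Vp Vm) (hV : V.StronglyNondegenerate),
      IsThreeGrading (MaxQuot.grading hV.tkk_semiprime (JordanPair.TKK.grading V)) ∧
      ∃ Q : JordanPair Φ (MaxQuot.grading hV.tkk_semiprime (JordanPair.TKK.grading V) 1)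
          (MaxQuot.grading hV.tkk_semiprime (JordanPair.TKK.grading V) (-1)),
        IsAssociatedPair (MaxQuot.grading hV.tkk_semiprime (JordanPair.TKK.grading V)) Q ∧
        ∃ ι : V.Hom Q,
          (∀ x : Vp, (ι.plus x : MaxQuot hV.tkk_semiprime) =
            MaxQuot.of hV.tkk_semiprime (JordanPair.TKK.ofPlus V x)) ∧
          (∀ y : Vm, (ι.minus y : MaxQuot hV.tkk_semiprime) =
            MaxQuot.of hV.tkk_semiprime (JordanPair.TKK.ofMinus V y)) ∧
          JordanPair.Hom.IsMaximalMQuotient.{a₁, a₂} ι) ∧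
    -- (ii) `Q_m(L) ≅ Q_m(TKK(V)) ≅ TKK(Q_m(V))`, where `Q_m(V)` is `W`
    (∀ {L : Type v} [LieRing L] [LieAlgebra Φ L] (𝓛 : ℤ → Submodule Φ L)
      (h𝓛 : IsJordanThreeGrading 𝓛) (hL : LieStronglyNondegenerate L),
      IsJordanThreeGrading (MaxQuot.grading (hL.semiprime (Φ := Φ)) 𝓛) →
      ∀ (V : JordanPair Φ (𝓛 1) (𝓛 (-1))) (hV : IsAssociatedPair 𝓛 V)
        {Wp : Type w₁} {Wm : Type w₂} [AddCommGroup Wp] [Module Φ Wp] [AddCommGroup Wm]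
        [Module Φ Wm] (W : JordanPair Φ Wp Wm) (ι : V.Hom W),
        JordanPair.Hom.IsMaximalMQuotient.{v, v} ι →
        (∃ e : MaxQuot (hL.semiprime (Φ := Φ)) ≃ₗ⁅Φ⁆
            MaxQuot (hV.stronglyNondegenerate h𝓛.toIsThreeGrading hL).tkk_semiprime,
          IsGradedIso (MaxQuot.grading (hL.semiprime (Φ := Φ)) 𝓛)
            (MaxQuot.grading (hV.stronglyNondegenerate h𝓛.toIsThreeGrading hL).tkk_semiprime
              (JordanPair.TKK.grading V)) e) ∧
        (∃ e : MaxQuot (hV.stronglyNondegenerate h𝓛.toIsThreeGrading hL).tkk_semiprime ≃ₗ⁅Φ⁆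
            W.TKK,
          IsGradedIso
            (MaxQuot.grading (hV.stronglyNondegenerate h𝓛.toIsThreeGrading hL).tkk_semiprime
              (JordanPair.TKK.grading V))
            (JordanPair.TKK.grading W) e)) := by
  refine ⟨fun {Vp} {Vm} _ _ _ _ V hV => ⟨JordanPair.TKK.maxQuot_isThreeGrading h6 hV,
    JordanPair.TKK.quotPair h6 hV, JordanPair.TKK.quotPair_isAssociatedPair h6 hV,
    JordanPair.TKK.quotHom h6 hV, fun _ => rfl, fun _ => rfl,
    JordanPair.TKK.quotHom_isMaximalMQuotient h6 hV⟩, ?_⟩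
  intro L _ _ 𝓛 h𝓛 hL hQ V hV Wp Wm _ _ _ _ W ι hι
  have hVn := hV.stronglyNondegenerate h𝓛.toIsThreeGrading hL
  obtain ⟨e, he⟩ := hV.exists_tkk_equiv h𝓛 hL
  obtain ⟨E, hE⟩ := MaxQuot.exists_gradedIso (hL.semiprime (Φ := Φ)) hVn.tkk_semiprime he.symm
  refine ⟨⟨E, hE⟩, ?_⟩
  -- Of the assumption that Q_m(L) is Jordan three-graded, only the spanning of degree 0 has to be
  -- transported along E; the grading and the pair of Q_m(TKK(V)) come from part (i).
  obtain ⟨e', he'⟩ := JordanPair.TKK.exists_tkk_equiv_maxQuot h6 hVn hι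
    (hE.span_eq hQ.lie_eq_zero_part)
  exact ⟨e'.symm, he'.symm⟩
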